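/- Let $\pi: M\to B$ be a smooth fibre bundle with fibre $F$ and structure group a compact Lie group $G$ acting smoothly on $F$ (on the left): there are smooth local trivializations $\phi_i:\pi^{-1}(U_i)\to U_i\times F$ over an open cover of $B$ and continuous functions $\varphi_{ij}:U_i\cap U_j\to G$ with $\phi_i\circ\phi_j^{-1}(b,f)=(b,\varphi_{ij}(b)f)$. Let $\mathcal P\to B$ be the associated principal $G$-bundle, i.e. the one with smooth trivializations over the same $U_i$ and transition maps $(b,a)\mapsto(b,\varphi_{ij}(b)a)$ on $(U_i\cap U_j)\times G$, with $G$ acting on the left by $r(b,a)=(b,ar^{-1})$ in these trivializations. Let $\bar\pi:\mathcal P\times F\to M$ be the quotient map of the diagonal action $r(p,f)=(rp,rf)$, which in trivializations is $((b,a),f)\mapsto(b,af)$. Let $g$ and $g_F$ be smooth $G$-invariant Riemannian metrics on $\mathcal P$ and $F$, let $Q$ be a biinvariant Riemannian metric on $G$, and write $Q$ also for the induced inner product on the Lie algebra $\mathfrak g$. For $t>0$ let $g_t$ be the Cheeger deformation of $g$, i.e. the metric on $\mathcal P$ for which $(\mathcal P\times G,\ g\times\frac1tQ)\to\mathcal P$,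 $(p,a)\mapsto ap$, is a Riemannian submersion, and let $h_t$ be the metric on $M$ for which $\bar\pi:(\mathcal P\times F,\ g_t\times g_F)\to(M,h_t)$ is a Riemannian submersion. Fix $(p,f)\in\mathcal P\times F$. For $U\in\mathfrak g$ let $U^*_f=\frac{d}{ds}\big|_{s=0}e^{sU}f$, let $\mathfrak g_f=\{V\in\mathfrak g: V^*_f=0\}$ be the isotropy algebra at $f$, let $\mathfrak m_f$ be its $Q$-orthogonal complement in $\mathfrak g$, and let $\{v_k(0)\}$ be a $Q$-orthonormal basis of $\mathfrak m_f$. Let $X\in T_p\mathcal P$ be $g$-orthogonal to the orbit $Gp$, let $X_F\in T_fF$ be $g_F$-orthogonal to the orbit $Gf$, let $U\in\mathfrak m_f$, and put $$X+X_F+U^*:=d\bar\pi_{(p,f)}(X,\,X_F+U^*_f)\in T_{\bar\pi(p,f)}M .$$ (Every tangent vector of $M$ at $\bar\pi(p,f)$ is of this form.) Write $\mathrm{Ric}(Y)=\mathrm{Ric}(Y,Y)$. For $Y$ tangent to $\mathcal P$ at $p$ (resp. to $F$ at $f$), let the horizontal Ricci curvature $\mathrm{Ric}^{\mathbf h}_g(Y)$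 (resp. $\mathrm{Ric}^{\mathbf h}_{g_F}(Y)$) be $\sum_i R(Y,e_i,e_i,Y)$, where $\{e_i\}$ is an orthonormal basis of the orthogonal complement of the tangent space to the $G$-orbit, and $R(Y,e,e,Y)$ is the unreduced sectional curvature. Then $\lim_{t\to\infty}\mathrm{Ric}_{h_t}(X+X_F+U^*)$ exists in $(-\infty,+\infty]$ and $$\lim_{t\to\infty}\mathrm{Ric}_{h_t}(X+X_F+U^*)\ \ge\ \mathrm{Ric}^{\mathbf h}_g(X)+\mathrm{Ric}^{\mathbf h}_{g_F}(X_F)+\frac14\sum_k\big\|[v_k(0),U]\big\|_Q^2 .$$ -/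

import Mathlib

open Bundle Set Filter
open scoped Manifold ContDiff Topology

noncomputable section

namespace CheegerBundle

/-! ### Metric tensors, curvature and Ricci curvature -/

/-- A field of scalar-valued pairings on the tangent spaces of `M`. The metrics constructed below
(products, submersion metrics, Cheeger deformations) are given pointwise in this form. -/
abbrev MetricField {E H : Type*} [NormedAddCommGroup E] [NormedSpace ℝ E] [TopologicalSpace H]
    (I : ModelWithCorners ℝ E H) (M : Type*) [TopologicalSpace M] [ChartedSpace H M] :=
  ∀ x : M, TangentSpace I x → TangentSpace I x → ℝ

/-- Smooth Riemannian metrics on a smooth manifold without boundary modelled on `E`. -/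
abbrev Metric (E : Type*) [NormedAddCommGroup E] [NormedSpace ℝ E]
    (M : Type*) [TopologicalSpace M] [ChartedSpace E M] [IsManifold 𝓘(ℝ, E) ∞ M] :=
  ContMDiffRiemannianMetric 𝓘(ℝ, E) ∞ E (fun x : M ↦ TangentSpace 𝓘(ℝ, E) x)

/-- The pairing on tangent spaces given by a smooth Riemannian metric. -/
def Metric.field {E M : Type*} [NormedAddCommGroup E] [NormedSpace ℝ E]
    [TopologicalSpace M] [ChartedSpace E M] [IsManifold 𝓘(ℝ, E) ∞ M] (g : Metric E M) :
    MetricField 𝓘(ℝ, E) M :=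
  fun x u v ↦ g.inner x u v

/-- `e` is an orthonormal basis of the subspace `W` with respect to the pairing `b`. -/
def IsOrthonormalBasisOf {κ V : Type*} [AddCommGroup V] [Module ℝ V] (b : V → V → ℝ)
    (W : Submodule ℝ V) (e : κ → V) : Prop :=
  (∀ i, b (e i) (e i) = 1) ∧ (∀ i j, i ≠ j → b (e i) (e j) = 0) ∧
    Submodule.span ℝ (range e) = W

section Coordinates

variable {E : Type*} [NormedAddCommGroup E] [NormedSpace ℝ E]

/-- Levi-Civita connection of a metric `k` on (an open subset of) a vector space: `christoffel k y u v`
is the vector `∇_u v` at `y` for constant vector fields `u`, `v`, that is, the unique vector `z`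
that satisfies the Koszul identity. -/
def christoffel (k : E → E → E → ℝ) (y u v : E) : E :=
  Classical.epsilon fun z ↦ ∀ w, k y z w =
    (fderiv ℝ (fun y' ↦ k y' v w) y u + fderiv ℝ (fun y' ↦ k y' u w) y v
      - fderiv ℝ (fun y' ↦ k y' u v) y w) / 2

/-- Curvature operator `R(u, v)w = ∇_u ∇_v w - ∇_v ∇_u w` for constant vector fields. -/
def curvatureOperator (k : E → E → E → ℝ) (y u v w : E) : E :=
  fderiv ℝ (fun y' ↦ christoffel k y' v w) y u - fderiv ℝ (fun y' ↦ christoffel k y' u w) y v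
    + christoffel k y u (christoffel k y v w) - christoffel k y v (christoffel k y u w)

variable {M : Type*} [TopologicalSpace M] [ChartedSpace E M]

/-- The metric `k` read in the preferred chart at `x`. -/
def metricInChart (k : MetricField 𝓘(ℝ, E) M) (x : M) : E → E → E → ℝ :=
  fun y u v ↦
    k ((extChartAt 𝓘(ℝ, E) x).symm y)
      (mfderiv 𝓘(ℝ, E) 𝓘(ℝ, E) (extChartAt 𝓘(ℝ, E) x).symm y u)
      (mfderiv 𝓘(ℝ, E) 𝓘(ℝ, E) (extChartAt 𝓘(ℝ, E) x).symm y v)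

/-- Coordinates of a tangent vector at `x` in the preferred chart at `x`. -/
def coordVec {x : M} (u : TangentSpace 𝓘(ℝ, E) x) : E :=
  mfderiv 𝓘(ℝ, E) 𝓘(ℝ, E) (extChartAt 𝓘(ℝ, E) x) x u

/-- Unreduced sectional curvature `R(u, v, v, u) = ⟨R(u, v)v, u⟩`. -/
def sectional (k : MetricField 𝓘(ℝ, E) M) (x : M) (u v : TangentSpace 𝓘(ℝ, E) x) : ℝ :=
  metricInChart k x (extChartAt 𝓘(ℝ, E) x x)
    (curvatureOperator (metricInChart k x) (extChartAt 𝓘(ℝ, E) x x)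
      (coordVec u) (coordVec v) (coordVec v))
    (coordVec u)

/-- `∑ᵢ R(u, eᵢ, eᵢ, u)` for an orthonormal basis `(eᵢ)` of the subspace `W` of the tangent space
at `x`; the value does not depend on the basis. -/
def ricciAlong (k : MetricField 𝓘(ℝ, E) M) (x : M) (W : Submodule ℝ (TangentSpace 𝓘(ℝ, E) x))
    (u : TangentSpace 𝓘(ℝ, E) x) : ℝ :=
  Classical.epsilon fun r ↦ ∃ (n : ℕ) (e : Fin n → TangentSpace 𝓘(ℝ, E) x),
    IsOrthonormalBasisOf (k x) W e ∧ r = ∑ i, sectional k x u (e i)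

/-- The Ricci curvature `Ric(u) = Ric(u, u)`. -/
def ricci (k : MetricField 𝓘(ℝ, E) M) (x : M) (u : TangentSpace 𝓘(ℝ, E) x) : ℝ :=
  ricciAlong k x ⊤ u

end Coordinates

/-! ### Isometries, products and submersion metrics -/

section Submersions

variable {E H : Type*} [NormedAddCommGroup E] [NormedSpace ℝ E] [TopologicalSpace H]
  {I : ModelWithCorners ℝ E H} {N : Type*} [TopologicalSpace N] [ChartedSpace H N]
  {E' H' : Type*} [NormedAddCommGroup E'] [NormedSpace ℝ E'] [TopologicalSpace H']
  {J : ModelWithCorners ℝ E' H'} {M : Type*} [TopologicalSpace M] [ChartedSpace H' M]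

/-- The self-map `s` preserves the metric `k`. -/
def PreservesMetric (k : MetricField I N) (s : N → N) : Prop :=
  ∀ (x : N) (u v : TangentSpace I x), k (s x) (mfderiv I I s x u) (mfderiv I I s x v) = k x u v

/-- The product metric on `N × M`. -/
def prodMetric (k : MetricField I N) (l : MetricField J M) : MetricField (I.prod J) (N × M) :=
  fun x (u v : E × E') ↦ k x.1 u.1 v.1 + l x.2 u.2 v.2

/-- `ξ`, tangent to `N` at `x`, is the horizontal lift with respect to `q` and the metric `k` of the
tangent vector `v` of `M`. -/
def IsHorizontalLift (J : ModelWithCorners ℝ E' H') (k : MetricField I N) (q : N → M) (x : N)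
    (ξ : TangentSpace I x) (v : TangentBundle J M) : Prop :=
  tangentMap I J q ⟨x, ξ⟩ = v ∧ ∀ η : TangentSpace I x, mfderiv I J q x η = 0 → k x ξ η = 0

/-- The submersion metric induced on `M` by `q : N → M` and the metric `k` on `N`: the common value
of `k ξ ζ` over all horizontal lifts `ξ` of `v` and `ζ` of `w` to a common point of `N`. -/
def submersionMetric (J : ModelWithCorners ℝ E' H') (k : MetricField I N) (q : N → M) :
    MetricField J M :=
  fun y v w ↦ Classical.epsilon fun r ↦ ∃ (x : N) (ξ ζ : TangentSpace I x),
    IsHorizontalLift J k q x ξ ⟨y, v⟩ ∧ IsHorizontalLift J k q x ζ ⟨y, w⟩ ∧ r = k x ξ ζ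

end Submersions

/-! ### Group actions and Cheeger deformations -/

section Actions

variable {EG G : Type*} [NormedAddCommGroup EG] [NormedSpace ℝ EG] [Group G] [TopologicalSpace G]
  [ChartedSpace EG G] [LieGroup 𝓘(ℝ, EG) ∞ G]
  {EN N : Type*} [NormedAddCommGroup EN] [NormedSpace ℝ EN] [TopologicalSpace N]
  [ChartedSpace EN N] [IsManifold 𝓘(ℝ, EN) ∞ N] [MulAction G N]

/-- The metric is invariant under the action of `G`. -/
def IsInvariant (G : Type*) [Group G] [MulAction G N] (g : Metric EN N) : Prop :=
  ∀ a : G, PreservesMetric g.field (fun x ↦ a • x)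

/-- The metric on the Lie group is invariant under left and right translations. -/
def IsBiinvariant (Q : Metric EG G) : Prop :=
  ∀ a : G, PreservesMetric Q.field (fun x ↦ a * x) ∧ PreservesMetric Q.field (fun x ↦ x * a)

/-- The action vector `U*_x`, the velocity at `1` of the orbit map in the direction `U`. Here
`1 • x = x`, so the derivative takes values in the tangent space at `x`. -/
def actionVec (EN : Type*) [NormedAddCommGroup EN] [NormedSpace ℝ EN] [ChartedSpace EN N]
    (x : N) : GroupLieAlgebra 𝓘(ℝ, EG) G →L[ℝ] TangentSpace 𝓘(ℝ, EN) x :=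
  mfderiv 𝓘(ℝ, EG) 𝓘(ℝ, EN) (fun a : G ↦ a • x) 1

/-- The vectors at `x` that are orthogonal to the orbit of `x`. -/
def orbitNormal (EG G : Type*) [NormedAddCommGroup EG] [NormedSpace ℝ EG] [Group G]
    [TopologicalSpace G] [ChartedSpace EG G] [MulAction G N] (g : Metric EN N) (x : N) :
    Submodule ℝ (TangentSpace 𝓘(ℝ, EN) x) where
  carrier := {X | ∀ U : GroupLieAlgebra 𝓘(ℝ, EG) G, g.inner x X (actionVec EN x U) = 0}
  add_mem' hX hY U := by
    have h1 := hX U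
    have h2 := hY U
    simp [h1, h2]
  zero_mem' U := by simp
  smul_mem' c X hX U := by
    have h1 := hX U
    simp [h1]

/-- The `Q`-orthogonal complement, in the Lie algebra of `G`, of the isotropy algebra
`{V | V*_x = 0}` at `x`. -/
def isotropyComplement (EN : Type*) [NormedAddCommGroup EN] [NormedSpace ℝ EN] [ChartedSpace EN N]
    (Q : Metric EG G) (x : N) : Submodule ℝ (GroupLieAlgebra 𝓘(ℝ, EG) G) where
  carrier := {U | ∀ V : GroupLieAlgebra 𝓘(ℝ, EG) G, actionVec EN x V = 0 → Q.inner 1 U V = 0}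
  add_mem' hX hY U hU := by
    have h1 := hX U hU
    have h2 := hY U hU
    simp [h1, h2]
  zero_mem' U _ := by simp
  smul_mem' c X hX U hU := by
    have h1 := hX U hU
    simp [h1]

/-- Horizontal Ricci curvature: `∑ R(u, eᵢ, eᵢ, u)` over an orthonormal basis of the space normal
to the orbit. -/
def horizontalRicci (EG G : Type*) [NormedAddCommGroup EG] [NormedSpace ℝ EG] [Group G]
    [TopologicalSpace G] [ChartedSpace EG G] [MulAction G N] (g : Metric EN N) (x : N)
    (u : TangentSpace 𝓘(ℝ, EN) x) : ℝ :=
  ricciAlong g.field x (orbitNormal EG G g x) u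

/-- The Cheeger deformation `g_t`: the submersion metric induced by `(x, a) ↦ a • x` from the product
metric `g × t⁻¹ Q` on `N × G`. -/
def cheegerDeformation (g : Metric EN N) (Q : Metric EG G) (t : ℝ) : MetricField 𝓘(ℝ, EN) N :=
  submersionMetric 𝓘(ℝ, EN) (prodMetric g.field (fun a u v ↦ t⁻¹ * Q.field a u v))
    (fun z : N × G ↦ z.2 • z.1)

end Actions

/-! ### Fibre bundles with structure group -/

section Bundles

variable {EB B EF F EM M EG G EP P : Type*}
  [NormedAddCommGroup EB] [NormedSpace ℝ EB] [TopologicalSpace B] [ChartedSpace EB B]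
  [NormedAddCommGroup EF] [NormedSpace ℝ EF] [TopologicalSpace F] [ChartedSpace EF F]
  [NormedAddCommGroup EM] [NormedSpace ℝ EM] [TopologicalSpace M] [ChartedSpace EM M]
  [NormedAddCommGroup EG] [NormedSpace ℝ EG] [TopologicalSpace G] [ChartedSpace EG G]
  [NormedAddCommGroup EP] [NormedSpace ℝ EP] [TopologicalSpace P] [ChartedSpace EP P]
  [Group G] [MulAction G F] [MulAction G P]

/-- The local trivialization `φ` is a diffeomorphism onto its image. -/
structure IsSmoothTrivialization (EB EF EM : Type*)
    [NormedAddCommGroup EB] [NormedSpace ℝ EB] [ChartedSpace EB B]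
    [NormedAddCommGroup EF] [NormedSpace ℝ EF] [ChartedSpace EF F]
    [NormedAddCommGroup EM] [NormedSpace ℝ EM] [ChartedSpace EM M]
    {proj : M → B} (φ : Trivialization F proj) : Prop where
  contMDiffOn : ContMDiffOn 𝓘(ℝ, EM) (𝓘(ℝ, EB).prod 𝓘(ℝ, EF)) ∞ φ φ.source
  contMDiffOn_symm : ContMDiffOn (𝓘(ℝ, EB).prod 𝓘(ℝ, EF)) 𝓘(ℝ, EM) ∞
    φ.toOpenPartialHomeomorph.symm φ.target

/-- A smooth fibre bundle `M → B` with fibre `F` and structure group `G`: local trivializations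
`φ i : π⁻¹(U i) → U i × F` over an open cover, and transition functions with values in `G`. -/
structure GBundle (ι EB B EF F EM M G : Type*)
    [NormedAddCommGroup EB] [NormedSpace ℝ EB] [TopologicalSpace B] [ChartedSpace EB B]
    [NormedAddCommGroup EF] [NormedSpace ℝ EF] [TopologicalSpace F] [ChartedSpace EF F]
    [NormedAddCommGroup EM] [NormedSpace ℝ EM] [TopologicalSpace M] [ChartedSpace EM M]
    [TopologicalSpace G] [Group G] [MulAction G F] where
  proj : M → B
  triv : ι → Trivialization F proj
  smooth_triv : ∀ i, IsSmoothTrivialization EB EF EM (triv i)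
  cover : ∀ b, ∃ i, b ∈ (triv i).baseSet
  trans : ι → ι → B → G
  continuousOn_trans : ∀ i j, ContinuousOn (trans i j) ((triv i).baseSet ∩ (triv j).baseSet)
  triv_triv_symm : ∀ i j, ∀ b ∈ (triv i).baseSet ∩ (triv j).baseSet, ∀ f : F,
    triv i ((triv j).toOpenPartialHomeomorph.symm (b, f)) = (b, trans i j b • f)

/-- The principal `G`-bundle `P → B` associated to a fibre bundle with structure group `G`: it has
local trivializations over the same open cover with the same transition functions, acting on `G` by
left translations. In these trivializations the principal action, written as a left action, is
`r • (b, a) = (b, a * r⁻¹)`. -/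
structure GBundle.PrincipalBundle {ι : Type*} (ξ : GBundle ι EB B EF F EM M G)
    (EG EP P : Type*)
    [NormedAddCommGroup EG] [NormedSpace ℝ EG] [ChartedSpace EG G]
    [NormedAddCommGroup EP] [NormedSpace ℝ EP] [TopologicalSpace P] [ChartedSpace EP P]
    [MulAction G P] where
  proj : P → B
  triv : ι → Trivialization G proj
  smooth_triv : ∀ i, IsSmoothTrivialization EB EG EP (triv i)
  baseSet_eq : ∀ i, (triv i).baseSet = (ξ.triv i).baseSet
  triv_triv_symm : ∀ i j, ∀ b ∈ (triv i).baseSet ∩ (triv j).baseSet, ∀ a : G,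
    triv i ((triv j).toOpenPartialHomeomorph.symm (b, a)) = (b, ξ.trans i j b * a)
  proj_smul : ∀ (r : G) (p : P), proj (r • p) = proj p
  triv_smul : ∀ i (r : G) (p : P), proj p ∈ (triv i).baseSet →
    triv i (r • p) = (proj p, (triv i p).2 * r⁻¹)

variable {ι : Type*} {ξ : GBundle ι EB B EF F EM M G}

/-- The principal projection `P × F → M`, the quotient by `r • (p, f) = (r • p, r • f)`. If `p`
corresponds to `(b, a)` in a trivialization of `P`, then `(p, f)` goes to the point that corresponds
to `(b, a • f)` in the trivialization of `M` over the same set; the result does not depend on the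
trivialization. -/
def GBundle.PrincipalBundle.quotientMap (pb : ξ.PrincipalBundle EG EP P) (z : P × F) : M :=
  let i := (ξ.cover (pb.proj z.1)).choose
  (ξ.triv i).toOpenPartialHomeomorph.symm (pb.proj z.1, (pb.triv i z.1).2 • z.2)

variable [LieGroup 𝓘(ℝ, EG) ∞ G] [IsManifold 𝓘(ℝ, EF) ∞ F] [IsManifold 𝓘(ℝ, EP) ∞ P]

/-- The deformed metric `h_t` on `M`: the submersion metric induced by `P × F → M` from `g_t × g_F`,
where `g_t` is the Cheeger deformation of `g`. -/
def GBundle.PrincipalBundle.deformedMetric (pb : ξ.PrincipalBundle EG EP P) (g : Metric EP P)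
    (gF : Metric EF F) (Q : Metric EG G) (t : ℝ) : MetricField 𝓘(ℝ, EM) M :=
  submersionMetric 𝓘(ℝ, EM) (prodMetric (cheegerDeformation g Q t) gF.field) pb.quotientMap

/-- The tangent vector `X + X_F + U*` of `M` at the image of `(p, f)`, that is, the image of
`(X, X_F + U*_f)` under the differential of `P × F → M`. -/
def GBundle.PrincipalBundle.tangentVec (pb : ξ.PrincipalBundle EG EP P) (p : P) (f : F)
    (X : TangentSpace 𝓘(ℝ, EP) p) (XF : TangentSpace 𝓘(ℝ, EF) f)
    (U : GroupLieAlgebra 𝓘(ℝ, EG) G) : TangentSpace 𝓘(ℝ, EM) (pb.quotientMap (p, f)) :=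
  mfderiv (𝓘(ℝ, EP).prod 𝓘(ℝ, EF)) 𝓘(ℝ, EM) pb.quotientMap (p, f)
    ((X, XF + actionVec EF f U) : EP × EF)

end Bundles

end CheegerBundle

end

noncomputable section

namespace CheegerBundle

/-! ### Riemannian geometry on open subsets of a vector space -/

section CoordinateGeometry

set_option maxSynthPendingDepth 3

variable {E : Type*} [NormedAddCommGroup E] [NormedSpace ℝ E]

/-! The two submersions compose: `h_t` is the metric induced by `(p, a, f) ↦ [a • p, f]` from `g ×
t⁻¹Q × g_F` on `P × G × F`. The metric `t⁻¹Q` has cometric `t Q⁻¹`, and a submersion pushes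
cometrics forward, so the cometric of `h_t` is affine in the parameter, `A + tB`, with `A` positive
definite and `B` positive semidefinite. This makes the cometric the convenient object throughout.

For two functions, the sectional curvature of the plane of their gradients is a polynomial in the
cometric and its derivatives minus `3/4` of the squared length of the bracket of the gradients
(`IsMetricPair.sectional_grad`). The formula serves twice. Under a submersion the polynomial part is
preserved and the bracket can only become shorter, which is O'Neill's inequality
(`sec_le_of_submersion`). For the family `A + tB` it shows that the Ricci curvature in a fixed
direction is a rational function of `t` (`isRat_ricci`), so that it has a limit in `[-∞, ∞]`.

For the lower bound, take covectors `w a` that are orthonormal for `A` and diagonalize `B` with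
eigenvalues `μ a`. The vectors `√(1 + μ a t) • A (w a)` form an orthonormal frame of `h_t`.
O'Neill's inequality bounds each curvature term below by curvatures of the horizontal lifts in the
product, with weight `(1 + μ a t)⁻¹` on the `P` and `F` parts and `t (1 + μ a t)⁻¹` on the group
part after rescaling. In the limit the covectors with `μ a = 0` give an orthonormal frame of the two
normal spaces, those with `μ a > 0` give a `Q`-orthonormal frame of the complement of the isotropy
algebra, and the lift of `X + X_F + U*` has limiting components `X`, `X_F` and, after multiplying
the covector by `t`, `-U` (`limit_base`, `limit_group`). The group part is then a sum of curvatures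
of a biinvariant metric, `1/4 ‖[v, U]‖²` each (`IsBiinvariant.sectional_one`). The bound is a real
number, so the limit is not `-∞`. Everything is done in charts (`exists_tendsto_ricci_coord`); the
remaining work identifies the metrics and derivatives on the manifolds with their coordinate forms.
-/

/-- `κ` is a smooth Riemannian metric on the open set `U`, and `K` is the inverse metric on
covectors. -/
structure IsMetricPair (κ : E → E →L[ℝ] E →L[ℝ] ℝ) (K : E → (E →L[ℝ] ℝ) →L[ℝ] E)
    (U : Set E) : Prop where
  isOpen : IsOpen U
  smooth : ContDiffOn ℝ ∞ κ U
  smooth_inv : ContDiffOn ℝ ∞ K U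
  symm : ∀ y ∈ U, ∀ u v, κ y u v = κ y v u
  pos : ∀ y ∈ U, ∀ u, u ≠ 0 → 0 < κ y u u
  left_inv : ∀ y ∈ U, ∀ u, K y (κ y u) = u
  right_inv : ∀ y ∈ U, ∀ α, κ y (K y α) = α

theorem two_le_infty : (2 : WithTop ℕ∞) ≤ ∞ :=
  WithTop.coe_le_coe.2 (le_top : (2 : ℕ∞) ≤ ⊤)

theorem smoothOn_fderiv {F : Type*} [NormedAddCommGroup F] [NormedSpace ℝ F] {f : E → F}
    {U : Set E} (hU : IsOpen U) (hf : ContDiffOn ℝ ∞ f U) : ContDiffOn ℝ ∞ (fderiv ℝ f) U :=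
  hf.fderiv_of_isOpen hU (by simp)

theorem smoothOn_differentiableAt {F : Type*} [NormedAddCommGroup F] [NormedSpace ℝ F] {f : E → F}
    {U : Set E} (hU : IsOpen U) (hf : ContDiffOn ℝ ∞ f U) {y : E} (hy : y ∈ U) :
    DifferentiableAt ℝ f y :=
  (hf.contDiffAt (hU.mem_nhds hy)).differentiableAt (by simp)

theorem fderiv_fderiv_symm {F : Type*} [NormedAddCommGroup F] [NormedSpace ℝ F] {f : E → F}
    {U : Set E} (hU : IsOpen U) (hf : ContDiffOn ℝ ∞ f U) {y : E} (hy : y ∈ U) (u v : E) :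
    fderiv ℝ (fderiv ℝ f) y u v = fderiv ℝ (fderiv ℝ f) y v u :=
  (hf.contDiffAt (hU.mem_nhds hy)).isSymmSndFDerivAt (n := ∞) (by simpa using two_le_infty) u v

theorem fderiv_eq_of_eqOn {F : Type*} [NormedAddCommGroup F] [NormedSpace ℝ F] {f h : E → F}
    {U : Set E} (hU : IsOpen U) (hfh : EqOn f h U) {y : E} (hy : y ∈ U) :
    fderiv ℝ f y = fderiv ℝ h y :=
  (hfh.eventuallyEq_of_mem (hU.mem_nhds hy)).fderiv_eq

/-- The right-hand side of the Koszul identity as a function of the derivative of the metric. -/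
def koszul : (E →L[ℝ] E →L[ℝ] E →L[ℝ] ℝ) →L[ℝ] (E →L[ℝ] E →L[ℝ] E →L[ℝ] ℝ) :=
  let fl : (E →L[ℝ] E →L[ℝ] E →L[ℝ] ℝ) →L[ℝ] (E →L[ℝ] E →L[ℝ] E →L[ℝ] ℝ) :=
    (ContinuousLinearMap.flipₗᵢ ℝ E E (E →L[ℝ] ℝ)).toContinuousLinearEquiv
  let fr : (E →L[ℝ] E →L[ℝ] ℝ) →L[ℝ] (E →L[ℝ] E →L[ℝ] ℝ) :=
    (ContinuousLinearMap.flipₗᵢ ℝ E E ℝ).toContinuousLinearEquiv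
  (1 / 2 : ℝ) • (ContinuousLinearMap.id ℝ _ + fl
    - (ContinuousLinearMap.compL ℝ E (E →L[ℝ] E →L[ℝ] ℝ) (E →L[ℝ] E →L[ℝ] ℝ) fr).comp fl)

theorem koszul_apply (T : E →L[ℝ] E →L[ℝ] E →L[ℝ] ℝ) (u v w : E) :
    koszul T u v w = (T u v w + T v u w - T w u v) / 2 := by
  change (1 / 2 : ℝ) * (T u v w + T v u w - T w u v) = _
  ring

/-- The Christoffel symbols of `κ` as bilinear maps. -/
def chr (κ : E → E →L[ℝ] E →L[ℝ] ℝ) (K : E → (E →L[ℝ] ℝ) →L[ℝ] E) (y : E) :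
    E →L[ℝ] E →L[ℝ] E :=
  (ContinuousLinearMap.compL ℝ E (E →L[ℝ] ℝ) E (K y)).comp (koszul (fderiv ℝ κ y))

theorem chr_apply (κ : E → E →L[ℝ] E →L[ℝ] ℝ) (K : E → (E →L[ℝ] ℝ) →L[ℝ] E) (y u v : E) :
    chr κ K y u v = K y (koszul (fderiv ℝ κ y) u v) := rfl

/-- The covariant derivative of the vector field `Z` in the direction `u`. -/
def nab (κ : E → E →L[ℝ] E →L[ℝ] ℝ) (K : E → (E →L[ℝ] ℝ) →L[ℝ] E) (Z : E → E) (y u : E) : E :=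
  fderiv ℝ Z y u + chr κ K y u (Z y)

namespace IsMetricPair

variable {κ : E → E →L[ℝ] E →L[ℝ] ℝ} {K : E → (E →L[ℝ] ℝ) →L[ℝ] E} {U : Set E} {y : E}

theorem mono (h : IsMetricPair κ K U) {V : Set E} (hV : IsOpen V) (hVU : V ⊆ U) :
    IsMetricPair κ K V where
  isOpen := hV
  smooth := h.smooth.mono hVU
  smooth_inv := h.smooth_inv.mono hVU
  symm y hy := h.symm y (hVU hy)
  pos y hy := h.pos y (hVU hy)
  left_inv y hy := h.left_inv y (hVU hy)
  right_inv y hy := h.right_inv y (hVU hy)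

theorem ext_inner (h : IsMetricPair κ K U) (hy : y ∈ U) {u v : E}
    (huv : ∀ w, κ y u w = κ y v w) : u = v := by
  have : κ y u = κ y v := by ext w; exact huv w
  rw [← h.left_inv y hy u, this, h.left_inv y hy]

theorem inner_inv (h : IsMetricPair κ K U) (hy : y ∈ U) (α : E →L[ℝ] ℝ) (w : E) :
    κ y (K y α) w = α w := by rw [h.right_inv y hy]

theorem inner_inv' (h : IsMetricPair κ K U) (hy : y ∈ U) (α : E →L[ℝ] ℝ) (w : E) :
    κ y w (K y α) = α w := by rw [h.symm y hy, h.right_inv y hy]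

theorem cometric_symm (h : IsMetricPair κ K U) (hy : y ∈ U) (α β : E →L[ℝ] ℝ) :
    α (K y β) = β (K y α) := by
  rw [← h.inner_inv hy α, h.symm y hy, h.inner_inv hy]

theorem fderiv_metric_symm (h : IsMetricPair κ K U) (hy : y ∈ U) (u v w : E) :
    fderiv ℝ κ y u v w = fderiv ℝ κ y u w v := by
  have hd : DifferentiableAt ℝ κ y := smoothOn_differentiableAt h.isOpen h.smooth hy
  have key : ∀ a b : E, fderiv ℝ (fun z ↦ κ z a b) y u = fderiv ℝ κ y u a b := by
    intro a b
    have h1 : HasFDerivAt (fun z ↦ κ z a b) _ y :=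
      (hd.hasFDerivAt.clm_apply (hasFDerivAt_const a y)).clm_apply (hasFDerivAt_const b y)
    rw [h1.fderiv]
    simp
  rw [← key v w, ← key w v]
  congr 1
  exact fderiv_eq_of_eqOn h.isOpen (fun z hz ↦ h.symm z hz v w) hy

theorem chr_inner (h : IsMetricPair κ K U) (hy : y ∈ U) (u v w : E) :
    κ y (chr κ K y u v) w
      = (fderiv ℝ κ y u v w + fderiv ℝ κ y v u w - fderiv ℝ κ y w u v) / 2 := by
  rw [chr_apply, h.inner_inv hy, koszul_apply]

theorem chr_symm (h : IsMetricPair κ K U) (hy : y ∈ U) (u v : E) :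
    chr κ K y u v = chr κ K y v u := by
  refine h.ext_inner hy fun w ↦ ?_
  rw [h.chr_inner hy, h.chr_inner hy, h.fderiv_metric_symm hy w u v]
  ring

theorem smooth_chr (h : IsMetricPair κ K U) : ContDiffOn ℝ ∞ (chr κ K) U := by
  have h1 := smoothOn_fderiv h.isOpen h.smooth
  have h2 : ContDiffOn ℝ ∞ (fun y ↦ koszul (fderiv ℝ κ y)) U :=
    koszul.contDiff.comp_contDiffOn h1
  have h3 : ContDiffOn ℝ ∞
      (fun y ↦ ContinuousLinearMap.compL ℝ E (E →L[ℝ] ℝ) E (K y)) U :=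
    (ContinuousLinearMap.compL ℝ E (E →L[ℝ] ℝ) E).contDiff.comp_contDiffOn h.smooth_inv
  exact h3.clm_comp h2

/-- The vector `christoffel` is picked by `Classical.epsilon`. The Koszul identity has the solution
`chr κ K y u v`, and nondegeneracy makes it the only one, so the choice is forced. The function `k`
has to agree with `κ` only on `U`, which is how metrics known merely pointwise on a chart domain
enter. -/
theorem christoffel_eq (h : IsMetricPair κ K U) {k : E → E → E → ℝ}
    (hk : ∀ y ∈ U, ∀ u v, k y u v = κ y u v) (hy : y ∈ U) (u v : E) :
    christoffel k y u v = chr κ K y u v := by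
  have hd : DifferentiableAt ℝ κ y := smoothOn_differentiableAt h.isOpen h.smooth hy
  have key : ∀ a b c : E, fderiv ℝ (fun z ↦ k z a b) y c = fderiv ℝ κ y c a b := by
    intro a b c
    rw [fderiv_eq_of_eqOn h.isOpen (fun z hz ↦ hk z hz a b) hy]
    have h1 : HasFDerivAt (fun z ↦ κ z a b) _ y :=
      (hd.hasFDerivAt.clm_apply (hasFDerivAt_const a y)).clm_apply (hasFDerivAt_const b y)
    rw [h1.fderiv]
    simp
  have hex : ∃ z, ∀ w, k y z w =
      (fderiv ℝ (fun y' ↦ k y' v w) y u + fderiv ℝ (fun y' ↦ k y' u w) y v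
        - fderiv ℝ (fun y' ↦ k y' u v) y w) / 2 :=
    ⟨chr κ K y u v, fun w ↦ by rw [hk y hy, key, key, key, h.chr_inner hy]⟩
  have := Classical.epsilon_spec hex
  refine h.ext_inner hy fun w ↦ ?_
  rw [h.chr_inner hy, ← hk y hy, christoffel, this w, key, key, key]

theorem curvatureOperator_eq (h : IsMetricPair κ K U) {k : E → E → E → ℝ}
    (hk : ∀ y ∈ U, ∀ u v, k y u v = κ y u v) (hy : y ∈ U) (u v w : E) :
    curvatureOperator k y u v w =
      fderiv ℝ (chr κ K) y u v w - fderiv ℝ (chr κ K) y v u w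
        + chr κ K y u (chr κ K y v w) - chr κ K y v (chr κ K y u w) := by
  have hd : DifferentiableAt ℝ (chr κ K) y := smoothOn_differentiableAt h.isOpen h.smooth_chr hy
  have key : ∀ a b c : E,
      fderiv ℝ (fun z ↦ christoffel k z a b) y c = fderiv ℝ (chr κ K) y c a b := by
    intro a b c
    rw [fderiv_eq_of_eqOn h.isOpen (fun z hz ↦ h.christoffel_eq hk hz a b) hy]
    have h1 : HasFDerivAt (fun z ↦ chr κ K z a b) _ y :=
      (hd.hasFDerivAt.clm_apply (hasFDerivAt_const a y)).clm_apply (hasFDerivAt_const b y)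
    rw [h1.fderiv]
    simp
  simp only [curvatureOperator, key, h.christoffel_eq hk hy]

/-- Compatibility of the connection with the metric: in the sum of the two Koszul identities
everything cancels except the derivative of `κ`. -/
theorem fderiv_inner (h : IsMetricPair κ K U) (hy : y ∈ U) {A B : E → E}
    (hA : DifferentiableAt ℝ A y) (hB : DifferentiableAt ℝ B y) (u : E) :
    fderiv ℝ (fun z ↦ κ z (A z) (B z)) y u
      = κ y (nab κ K A y u) (B y) + κ y (A y) (nab κ K B y u) := by
  have hd : DifferentiableAt ℝ κ y := smoothOn_differentiableAt h.isOpen h.smooth hy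
  have h1 : HasFDerivAt (fun z ↦ κ z (A z) (B z)) _ y :=
    (hd.hasFDerivAt.clm_apply hA.hasFDerivAt).clm_apply hB.hasFDerivAt
  rw [h1.fderiv]
  have e1 := h.chr_inner hy u (A y) (B y)
  have e2 := h.chr_inner hy u (B y) (A y)
  have e3 := h.fderiv_metric_symm hy u (A y) (B y)
  have e4 := h.fderiv_metric_symm hy (A y) u (B y)
  have e5 := h.fderiv_metric_symm hy (B y) u (A y)
  have e6 := h.symm y hy (A y) (chr κ K y u (B y))
  simp only [nab, map_add, add_apply, e6, e1, e2,
    ContinuousLinearMap.flip_apply, ContinuousLinearMap.comp_apply]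
  linarith

theorem nab_sub_nab (h : IsMetricPair κ K U) (hy : y ∈ U) (A B : E → E) :
    nab κ K B y (A y) - nab κ K A y (B y) = VectorField.lieBracket ℝ A B y := by
  simp only [nab, VectorField.lieBracket, h.chr_symm hy (B y) (A y)]
  abel

theorem smooth_nab (h : IsMetricPair κ K U) {A B : E → E} (hA : ContDiffOn ℝ ∞ A U)
    (hB : ContDiffOn ℝ ∞ B U) : ContDiffOn ℝ ∞ (fun z ↦ nab κ K B z (A z)) U :=
  ((smoothOn_fderiv h.isOpen hB).clm_apply hA).add ((h.smooth_chr.clm_apply hA).clm_apply hB)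

/-- The curvature operator in terms of covariant derivatives of vector fields. -/
theorem curvatureOperator_fields (h : IsMetricPair κ K U) {k : E → E → E → ℝ}
    (hk : ∀ y ∈ U, ∀ u v, k y u v = κ y u v) (hy : y ∈ U) {A B C : E → E}
    (hA : ContDiffOn ℝ ∞ A U) (hB : ContDiffOn ℝ ∞ B U) (hC : ContDiffOn ℝ ∞ C U) :
    curvatureOperator k y (A y) (B y) (C y) =
      nab κ K (fun z ↦ nab κ K C z (B z)) y (A y) - nab κ K (fun z ↦ nab κ K C z (A z)) y (B y)
        - nab κ K C y (VectorField.lieBracket ℝ A B y) := by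
  have dd : ∀ {B : E → E}, ContDiffOn ℝ ∞ B U → ∀ u : E,
      fderiv ℝ (fun z ↦ nab κ K C z (B z)) y u =
        fderiv ℝ (fderiv ℝ C) y u (B y) + fderiv ℝ C y (fderiv ℝ B y u)
        + (fderiv ℝ (chr κ K) y u (B y) (C y) + chr κ K y (fderiv ℝ B y u) (C y)
          + chr κ K y (B y) (fderiv ℝ C y u)) := by
    intro B hB u
    have dB := (smoothOn_differentiableAt h.isOpen hB hy).hasFDerivAt
    have dC := (smoothOn_differentiableAt h.isOpen hC hy).hasFDerivAt
    have dC' := (smoothOn_differentiableAt h.isOpen (smoothOn_fderiv h.isOpen hC) hy).hasFDerivAt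
    have dchr := (smoothOn_differentiableAt h.isOpen h.smooth_chr hy).hasFDerivAt
    have h1 : HasFDerivAt (fun z ↦ nab κ K C z (B z)) _ y :=
      (dC'.clm_apply dB).add ((dchr.clm_apply dB).clm_apply dC)
    rw [h1.fderiv]
    simp only [add_apply, ContinuousLinearMap.flip_apply,
      ContinuousLinearMap.comp_apply]
    abel
  -- The second derivatives of `C` cancel by symmetry; the bracket term absorbs the first
  -- derivatives of `A` and `B`. What remains is tensorial.
  have s1 := fderiv_fderiv_symm h.isOpen hC hy (A y) (B y)
  have hbr : VectorField.lieBracket ℝ A B y = fderiv ℝ B y (A y) - fderiv ℝ A y (B y) := rfl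
  rw [h.curvatureOperator_eq hk hy]
  have e : ∀ W : E → E, ∀ u, nab κ K W y u = fderiv ℝ W y u + chr κ K y u (W y) := fun _ _ ↦ rfl
  rw [e (fun z ↦ nab κ K C z (B z)), e (fun z ↦ nab κ K C z (A z)), dd hB, dd hA, hbr, s1]
  simp only [e, map_add, map_sub, sub_apply]
  abel

end IsMetricPair

/-! ### The curvature in terms of the cometric -/

/-- The pairing of the differentials of `f` and `h` for the cometric `K`. -/
def car (K : E → (E →L[ℝ] ℝ) →L[ℝ] E) (f h : E → ℝ) (y : E) : ℝ :=
  fderiv ℝ f y (K y (fderiv ℝ h y))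

/-- The gradient of `f` for the cometric `K`. -/
def grad (K : E → (E →L[ℝ] ℝ) →L[ℝ] E) (f : E → ℝ) (y : E) : E := K y (fderiv ℝ f y)

/-- The part of the sectional curvature of the plane of two gradients that is a polynomial in the
cometric and its derivatives. -/
def cometricCurvature (K : E → (E →L[ℝ] ℝ) →L[ℝ] E) (f h : E → ℝ) (y : E) : ℝ :=
  1 / 2 * car K f (car K f (car K h h)) y + 1 / 2 * car K h (car K h (car K f f)) y
    - 1 / 2 * (car K f (car K h (car K f h)) y + car K h (car K f (car K f h)) y)
    - 1 / 4 * car K (car K f f) (car K h h) y + 1 / 4 * car K (car K f h) (car K f h) y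

theorem car_congr {K : E → (E →L[ℝ] ℝ) →L[ℝ] E} {U : Set E} (hU : IsOpen U) {f f' h h' : E → ℝ}
    (hf : EqOn f f' U) (hh : EqOn h h' U) : EqOn (car K f h) (car K f' h') U := fun y hy ↦ by
  simp only [car, fderiv_eq_of_eqOn hU hf hy, fderiv_eq_of_eqOn hU hh hy]

theorem smooth_grad {K : E → (E →L[ℝ] ℝ) →L[ℝ] E} {U : Set E} (hU : IsOpen U)
    (hK : ContDiffOn ℝ ∞ K U) {f : E → ℝ} (hf : ContDiffOn ℝ ∞ f U) :
    ContDiffOn ℝ ∞ (grad K f) U :=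
  hK.clm_apply (smoothOn_fderiv hU hf)

theorem smooth_car {K : E → (E →L[ℝ] ℝ) →L[ℝ] E} {U : Set E} (hU : IsOpen U)
    (hK : ContDiffOn ℝ ∞ K U) {f h : E → ℝ} (hf : ContDiffOn ℝ ∞ f U)
    (hh : ContDiffOn ℝ ∞ h U) : ContDiffOn ℝ ∞ (car K f h) U :=
  (smoothOn_fderiv hU hf).clm_apply (smooth_grad hU hK hh)

namespace IsMetricPair

variable {κ : E → E →L[ℝ] E →L[ℝ] ℝ} {K : E → (E →L[ℝ] ℝ) →L[ℝ] E} {U : Set E} {y : E}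
  {f h : E → ℝ}

theorem fderiv_grad (H : IsMetricPair κ K U) (hy : y ∈ U) (f h : E → ℝ) :
    fderiv ℝ h y (grad K f y) = car K f h y :=
  H.cometric_symm hy _ _

theorem inner_grad (H : IsMetricPair κ K U) (hy : y ∈ U) (f : E → ℝ) (w : E) :
    κ y (grad K f y) w = fderiv ℝ f y w := H.inner_inv hy _ _

/-- The Hessian of a function is symmetric. -/
theorem nab_grad_symm (H : IsMetricPair κ K U) (hy : y ∈ U) (hf : ContDiffOn ℝ ∞ f U) (u w : E) :
    κ y (nab κ K (grad K f) y u) w = κ y (nab κ K (grad K f) y w) u := by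
  have hd := (smoothOn_differentiableAt H.isOpen H.smooth hy).hasFDerivAt
  have hg := (smoothOn_differentiableAt H.isOpen (smooth_grad H.isOpen H.smooth_inv hf) hy).hasFDerivAt
  have h1 : HasFDerivAt (fun z ↦ κ z (grad K f z)) _ y := hd.clm_apply hg
  -- Differentiating the identity `κ (grad f) = df` expresses the derivative of the gradient through
  -- the second derivative of `f` and that of `κ`, without differentiating `K`.
  have h2 : fderiv ℝ (fun z ↦ κ z (grad K f z)) y = fderiv ℝ (fderiv ℝ f) y :=
    fderiv_eq_of_eqOn H.isOpen (fun z hz ↦ H.right_inv z hz _) hy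
  have key : ∀ u w, κ y (fderiv ℝ (grad K f) y u) w
      = fderiv ℝ (fderiv ℝ f) y u w - fderiv ℝ κ y u (grad K f y) w := by
    intro u w
    rw [← h2, h1.fderiv]
    simp
  have s1 := fderiv_fderiv_symm H.isOpen hf hy u w
  have e1 := H.chr_inner hy u (grad K f y) w
  have e2 := H.chr_inner hy w (grad K f y) u
  have e3 := H.fderiv_metric_symm hy w u (grad K f y)
  have e4 := H.fderiv_metric_symm hy u w (grad K f y)
  have e5 := H.fderiv_metric_symm hy (grad K f y) u w
  simp only [nab, map_add, add_apply, key, e1, e2]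
  linarith

/-- A bracket acts on functions as a commutator of derivations, and the derivation along `grad K f`
is `car K f`. So the components of the bracket are polynomial in the cometric and its derivatives,
with no Christoffel symbols. -/
theorem fderiv_lieBracket_grad (H : IsMetricPair κ K U) (hy : y ∈ U) (hf : ContDiffOn ℝ ∞ f U)
    (hh : ContDiffOn ℝ ∞ h U) {φ : E → ℝ} (hφ : ContDiffOn ℝ ∞ φ U) :
    fderiv ℝ φ y (VectorField.lieBracket ℝ (grad K f) (grad K h) y)
      = car K f (car K h φ) y - car K h (car K f φ) y := by
  have hf' := smoothOn_differentiableAt H.isOpen (smooth_grad H.isOpen H.smooth_inv hf) hy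
  have hh' := smoothOn_differentiableAt H.isOpen (smooth_grad H.isOpen H.smooth_inv hh) hy
  rw [VectorField.fderiv_apply_lieBracket (n := ∞) (hφ.contDiffAt (H.isOpen.mem_nhds hy))
    (by simpa using two_le_infty) hh' hf']
  rw [fderiv_eq_of_eqOn H.isOpen (fun z hz ↦ H.fderiv_grad hz h φ) hy,
    fderiv_eq_of_eqOn H.isOpen (fun z hz ↦ H.fderiv_grad hz f φ) hy, H.fderiv_grad hy,
    H.fderiv_grad hy]

/-- The sectional curvature of the plane spanned by two gradients. -/
theorem sectional_grad (H : IsMetricPair κ K U) {k : E → E → E → ℝ}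
    (hk : ∀ y ∈ U, ∀ u v, k y u v = κ y u v) (hy : y ∈ U) (hf : ContDiffOn ℝ ∞ f U)
    (hh : ContDiffOn ℝ ∞ h U) :
    κ y (curvatureOperator k y (grad K f y) (grad K h y) (grad K h y)) (grad K f y) =
      cometricCurvature K f h y
        - 3 / 4 * κ y (VectorField.lieBracket ℝ (grad K f) (grad K h) y)
            (VectorField.lieBracket ℝ (grad K f) (grad K h) y) := by
  set X := grad K f with hX
  set Y := grad K h with hY
  have sX : ContDiffOn ℝ ∞ X U := smooth_grad H.isOpen H.smooth_inv hf
  have sY : ContDiffOn ℝ ∞ Y U := smooth_grad H.isOpen H.smooth_inv hh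
  set A : E → E := fun z ↦ nab κ K Y z (Y z) with hA
  set C : E → E := fun z ↦ nab κ K Y z (X z) with hC
  set D : E → E := fun z ↦ nab κ K X z (Y z) with hD
  set S : E → E := fun z ↦ nab κ K X z (X z) with hS
  have sA : ContDiffOn ℝ ∞ A U := H.smooth_nab sY sY
  have sC : ContDiffOn ℝ ∞ C U := H.smooth_nab sX sY
  have dif : ∀ {Z : E → E}, ContDiffOn ℝ ∞ Z U → ∀ {z}, z ∈ U → DifferentiableAt ℝ Z z :=
    fun hZ _ hz ↦ smoothOn_differentiableAt H.isOpen hZ hz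
  have nX : ∀ z ∈ U, ∀ u w, κ z (nab κ K X z u) w = κ z (nab κ K X z w) u :=
    fun z hz u w ↦ H.nab_grad_symm hz hf u w
  have nY : ∀ z ∈ U, ∀ u w, κ z (nab κ K Y z u) w = κ z (nab κ K Y z w) u :=
    fun z hz u w ↦ H.nab_grad_symm hz hh u w
  have car_eq : ∀ a b : E → ℝ, EqOn (fun z ↦ κ z (grad K a z) (grad K b z)) (car K a b) U :=
    fun a b z hz ↦ H.inner_grad hz a _
  -- Symmetry of the Hessian gives `∇_Y Y = ½ grad |Y|²`; in the same way `∇_X X = ½ grad |X|²` and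
  -- `∇_X Y + ∇_Y X = grad ⟨X, Y⟩`. These replace every covariant derivative below by iterated
  -- pairings.
  have iA : ∀ z ∈ U, ∀ w, κ z (A z) w = fderiv ℝ (car K h h) z w / 2 := by
    intro z hz w
    rw [← fderiv_eq_of_eqOn H.isOpen (car_eq h h) hz,
      H.fderiv_inner hz (dif sY hz) (dif sY hz), H.symm z hz (grad K h z), hA]
    have := nY z hz (Y z) w
    simp only [hY] at this ⊢
    linarith
  have iS : ∀ z ∈ U, ∀ w, κ z (S z) w = fderiv ℝ (car K f f) z w / 2 := by
    intro z hz w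
    rw [← fderiv_eq_of_eqOn H.isOpen (car_eq f f) hz,
      H.fderiv_inner hz (dif sX hz) (dif sX hz), H.symm z hz (grad K f z), hS]
    have := nX z hz (X z) w
    simp only [hX] at this ⊢
    linarith
  have iCD : ∀ z ∈ U, ∀ w, κ z (C z) w + κ z (D z) w = fderiv ℝ (car K f h) z w := by
    intro z hz w
    rw [← fderiv_eq_of_eqOn H.isOpen (car_eq f h) hz,
      H.fderiv_inner hz (dif sX hz) (dif sY hz), H.symm z hz (grad K f z)]
    have h1 := nY z hz (X z) w
    have h2 := nX z hz (Y z) w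
    simp only [hX, hY, hC, hD] at h1 h2 ⊢
    linarith
  set b := VectorField.lieBracket ℝ X Y y with hb
  have bCD : C y - D y = b := H.nab_sub_nab hy X Y
  -- the three terms of the curvature operator
  have t1 : κ y (nab κ K A y (X y)) (X y)
      = 1 / 2 * car K f (car K f (car K h h)) y - 1 / 4 * car K (car K f f) (car K h h) y := by
    have h1 := H.fderiv_inner hy (dif sA hy) (dif sX hy) (X y)
    have h2 : EqOn (fun z ↦ κ z (A z) (X z)) (fun z ↦ (1 / 2 : ℝ) * car K f (car K h h) z) U := by
      intro z hz
      simp only [iA z hz, hX, H.fderiv_grad hz]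
      ring
    have d2 : DifferentiableAt ℝ (car K f (car K h h)) y :=
      smoothOn_differentiableAt H.isOpen (smooth_car H.isOpen H.smooth_inv hf
        (smooth_car H.isOpen H.smooth_inv hh hh)) hy
    rw [fderiv_eq_of_eqOn H.isOpen h2 hy, fderiv_const_mul d2, smul_apply,
      hX, H.fderiv_grad hy] at h1
    have h3 : κ y (A y) (S y) = 1 / 4 * car K (car K f f) (car K h h) y := by
      have e1 : S y = (1 / 2 : ℝ) • grad K (car K f f) y := by
        refine H.ext_inner hy fun w ↦ ?_
        rw [iS y hy, map_smul, smul_apply, H.inner_grad hy, smul_eq_mul]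
        ring
      rw [iA y hy, e1, map_smul, H.fderiv_grad hy, smul_eq_mul]
      ring
    have h4 : κ y (A y) (nab κ K (grad K f) y (grad K f y))
      = 1 / 4 * car K (car K f f) (car K h h) y := h3
    rw [h4, smul_eq_mul] at h1
    linarith
  have t2 : κ y (nab κ K C y (Y y)) (X y) = car K h (car K f (car K f h)) y
      - 1 / 2 * car K h (car K h (car K f f)) y - κ y (C y) (D y) := by
    have h1 := H.fderiv_inner hy (dif sC hy) (dif sX hy) (Y y)
    have h2 : EqOn (fun z ↦ κ z (C z) (X z))
        (fun z ↦ car K f (car K f h) z - (1 / 2 : ℝ) * car K h (car K f f) z) U := by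
      intro z hz
      have a1 := iCD z hz (X z)
      have a2 : κ z (D z) (X z) = κ z (S z) (Y z) := nX z hz (Y z) (X z)
      have a3 := iS z hz (Y z)
      rw [hX, H.fderiv_grad hz] at a1
      rw [hY, H.fderiv_grad hz] at a3
      change κ z (C z) (grad K f z) = _
      change κ z (D z) (grad K f z) = κ z (S z) (grad K h z) at a2
      linarith
    have d1 : DifferentiableAt ℝ (car K f (car K f h)) y :=
      smoothOn_differentiableAt H.isOpen (smooth_car H.isOpen H.smooth_inv hf
        (smooth_car H.isOpen H.smooth_inv hf hh)) hy
    have d2 : DifferentiableAt ℝ (car K h (car K f f)) y :=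
      smoothOn_differentiableAt H.isOpen (smooth_car H.isOpen H.smooth_inv hh
        (smooth_car H.isOpen H.smooth_inv hf hf)) hy
    rw [fderiv_eq_of_eqOn H.isOpen h2 hy, fderiv_fun_sub d1 (d2.const_mul _), fderiv_const_mul d2,
      sub_apply, smul_apply, hY, H.fderiv_grad hy,
      H.fderiv_grad hy, smul_eq_mul] at h1
    change _ = _ + κ y (C y) (D y) at h1
    rw [hY]
    linarith
  have t3 : κ y (nab κ K Y y b) (X y) = κ y (C y) b := nY y hy b (X y)
  have hcurv := H.curvatureOperator_fields hk hy sX sY sY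
  have hcd : κ y (C y) (D y) = κ y (D y) (C y) := H.symm y hy _ _
  have hgr : C y + D y = grad K (car K f h) y := by
    refine H.ext_inner hy fun w ↦ ?_
    rw [map_add, add_apply, iCD y hy, H.inner_grad hy]
  have t4 : κ y (C y + D y) (C y + D y) = car K (car K f h) (car K f h) y := by
    rw [hgr]; exact car_eq _ _ hy
  have t5 : κ y (C y + D y) b
      = car K f (car K h (car K f h)) y - car K h (car K f (car K f h)) y := by
    rw [hgr, H.inner_grad hy]
    exact H.fderiv_lieBracket_grad hy hf hh (smooth_car H.isOpen H.smooth_inv hf hh)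
  rw [hcurv]
  simp only [map_sub, sub_apply]
  rw [cometricCurvature]
  change κ y (nab κ K A y (X y)) (X y) - κ y (nab κ K C y (Y y)) (X y)
    - κ y (nab κ K Y y b) (X y) = _
  rw [t1, t2, t3, ← t4]
  -- What is left is `⟨C, D⟩ - ⟨C, b⟩` with `b = C - D`. In terms of `C + D = grad ⟨X, Y⟩` it equals
  -- `¼|C + D|² - ½⟨C + D, b⟩ - ¾|b|²`: the first two terms are polynomial in the cometric, and the
  -- last is the bracket term with its coefficient `3/4`.
  have hE : car K f (car K h (car K f h)) y
      = κ y (C y + D y) b + car K h (car K f (car K f h)) y := by rw [t5]; ring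
  rw [hE, ← bCD]
  simp only [map_sub, map_add, sub_apply, add_apply]
  rw [← hcd]
  ring

end IsMetricPair

end CoordinateGeometry

end CheegerBundle

end

noncomputable section

namespace CheegerBundle

/-! ### Sectional curvature: scaling, products and O'Neill's inequality -/

section Comparison

set_option maxSynthPendingDepth 3

variable {E : Type*} [NormedAddCommGroup E] [NormedSpace ℝ E]

/-- Unreduced sectional curvature of a metric on a vector space. -/
def sec (k : E → E → E → ℝ) (y u v : E) : ℝ := k y (curvatureOperator k y u v v) u

namespace IsMetricPair

variable {κ : E → E →L[ℝ] E →L[ℝ] ℝ} {K : E → (E →L[ℝ] ℝ) →L[ℝ] E} {U : Set E} {y : E}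
  {k : E → E → E → ℝ}

theorem sec_eq (H : IsMetricPair κ K U) (hk : ∀ y ∈ U, ∀ u v, k y u v = κ y u v) (hy : y ∈ U)
    (u v : E) :
    sec k y u v = κ y (fderiv ℝ (chr κ K) y u v v - fderiv ℝ (chr κ K) y v u v
        + chr κ K y u (chr κ K y v v) - chr κ K y v (chr κ K y u v)) u := by
  rw [sec, hk y hy, H.curvatureOperator_eq hk hy]

/-- Being the diagonal of a bilinear form is what makes sums over an orthonormal basis independent
of the basis, through `IsOrthonormalBasisOf.sum_eq`. -/
theorem sec_eq_bilin_right (H : IsMetricPair κ K U) (hk : ∀ y ∈ U, ∀ u v, k y u v = κ y u v)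
    (hy : y ∈ U) (u : E) : ∃ B : E →ₗ[ℝ] E →ₗ[ℝ] ℝ, ∀ v, sec k y u v = B v v := by
  refine ⟨LinearMap.mk₂ ℝ (fun v w ↦ κ y (fderiv ℝ (chr κ K) y u v w - fderiv ℝ (chr κ K) y v u w
        + chr κ K y u (chr κ K y v w) - chr κ K y v (chr κ K y u w)) u) ?_ ?_ ?_ ?_,
    fun v ↦ H.sec_eq hk hy u v⟩
  · intro a b c
    simp only [map_add, map_sub, add_apply, sub_apply]; ring
  · intro a b c
    simp only [map_smul, map_add, map_sub, add_apply, sub_apply, smul_apply, smul_eq_mul]; ring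
  · intro a b c
    simp only [map_add, map_sub, add_apply, sub_apply]; ring
  · intro a b c
    simp only [map_smul, map_add, map_sub, add_apply, sub_apply, smul_apply, smul_eq_mul]; ring

theorem sec_eq_bilin_left (H : IsMetricPair κ K U) (hk : ∀ y ∈ U, ∀ u v, k y u v = κ y u v)
    (hy : y ∈ U) (v : E) : ∃ B : E →ₗ[ℝ] E →ₗ[ℝ] ℝ, ∀ u, sec k y u v = B u u := by
  refine ⟨LinearMap.mk₂ ℝ (fun u w ↦ κ y (fderiv ℝ (chr κ K) y u v v - fderiv ℝ (chr κ K) y v u v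
        + chr κ K y u (chr κ K y v v) - chr κ K y v (chr κ K y u v)) w) ?_ ?_ ?_ ?_,
    fun u ↦ H.sec_eq hk hy u v⟩
  · intro a b c
    simp only [map_add, map_sub, add_apply, sub_apply]; ring
  · intro a b c
    simp only [map_smul, map_add, map_sub, add_apply, sub_apply, smul_apply, smul_eq_mul]; ring
  · intro a b c
    simp only [map_add]
  · intro a b c
    simp only [map_smul, smul_eq_mul]

theorem sec_smul_right (H : IsMetricPair κ K U) (hk : ∀ y ∈ U, ∀ u v, k y u v = κ y u v)
    (hy : y ∈ U) (u v : E) (c : ℝ) : sec k y u (c • v) = c ^ 2 * sec k y u v := by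
  obtain ⟨B, hB⟩ := H.sec_eq_bilin_right hk hy u
  simp only [hB, map_smul, LinearMap.smul_apply, smul_eq_mul]; ring

theorem sec_neg_left (H : IsMetricPair κ K U) (hk : ∀ y ∈ U, ∀ u v, k y u v = κ y u v)
    (hy : y ∈ U) (u v : E) : sec k y (-u) v = sec k y u v := by
  obtain ⟨B, hB⟩ := H.sec_eq_bilin_left hk hy v
  simp only [hB, map_neg, LinearMap.neg_apply, neg_neg]

theorem continuous_sec (H : IsMetricPair κ K U) (hk : ∀ y ∈ U, ∀ u v, k y u v = κ y u v)
    (hy : y ∈ U) (v : E) : Continuous fun u ↦ sec k y u v := by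
  simp only [H.sec_eq hk hy]
  fun_prop

/-- Positive multiples of a metric. -/
theorem const_smul (H : IsMetricPair κ K U) {c : ℝ} (hc : 0 < c) :
    IsMetricPair (fun y ↦ c • κ y) (fun y ↦ c⁻¹ • K y) U where
  isOpen := H.isOpen
  smooth := (contDiffOn_const (c := c)).smul H.smooth
  smooth_inv := (contDiffOn_const (c := c⁻¹)).smul H.smooth_inv
  symm y hy u v := by simp [H.symm y hy u v]
  pos y hy u hu := by simpa using mul_pos hc (H.pos y hy u hu)
  left_inv y hy u := by simp [H.left_inv y hy, hc.ne']
  right_inv y hy α := by simp [H.right_inv y hy, hc.ne']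

end IsMetricPair

/-- Both sides of the Koszul identity scale by `c`, so the predicate handed to `Classical.epsilon`
is literally the same; no uniqueness of the solution is needed, and `k` may be arbitrary. -/
theorem christoffel_const_mul (k : E → E → E → ℝ) {c : ℝ} (hc : c ≠ 0) :
    christoffel (fun y u v ↦ c * k y u v) = christoffel k := by
  funext y u v
  have h : ∀ a b : E, fderiv ℝ (fun y' ↦ c * k y' a b) y = c • fderiv ℝ (fun y' ↦ k y' a b) y :=
    fun a b ↦ congrFun (fderiv_const_smul_field (𝕜 := ℝ) (f := fun y' ↦ k y' a b) c) y
  simp only [christoffel, h]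
  congr 1
  funext z
  refine propext (forall_congr' fun w ↦ ?_)
  simp only [smul_apply, smul_eq_mul]
  rw [show (c * fderiv ℝ (fun y' ↦ k y' v w) y u + c * fderiv ℝ (fun y' ↦ k y' u w) y v
    - c * fderiv ℝ (fun y' ↦ k y' u v) y w) / 2 = c * ((fderiv ℝ (fun y' ↦ k y' v w) y u
      + fderiv ℝ (fun y' ↦ k y' u w) y v - fderiv ℝ (fun y' ↦ k y' u v) y w) / 2) by ring,
    mul_right_inj' hc]

theorem sec_const_mul (k : E → E → E → ℝ) {c : ℝ} (hc : c ≠ 0) (y u v : E) :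
    sec (fun y u v ↦ c * k y u v) y u v = c * sec k y u v := by
  simp only [sec, curvatureOperator, christoffel_const_mul k hc]

variable {E' : Type*} [NormedAddCommGroup E'] [NormedSpace ℝ E']

/-! #### Products -/

/-- The product of two metrics. -/
def prodForm (κ : E → E →L[ℝ] E →L[ℝ] ℝ) (κ' : E' → E' →L[ℝ] E' →L[ℝ] ℝ) (z : E × E') :
    (E × E') →L[ℝ] (E × E') →L[ℝ] ℝ :=
  (κ z.1).bilinearComp (.fst ℝ E E') (.fst ℝ E E')
    + (κ' z.2).bilinearComp (.snd ℝ E E') (.snd ℝ E E')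

/-- The product of two cometrics. -/
def prodCoform (K : E → (E →L[ℝ] ℝ) →L[ℝ] E) (K' : E' → (E' →L[ℝ] ℝ) →L[ℝ] E') (z : E × E') :
    ((E × E') →L[ℝ] ℝ) →L[ℝ] E × E' :=
  ((K z.1).comp ((ContinuousLinearMap.inl ℝ E E').precomp ℝ)).prod
    ((K' z.2).comp ((ContinuousLinearMap.inr ℝ E E').precomp ℝ))

@[simp] theorem prodForm_apply (κ : E → E →L[ℝ] E →L[ℝ] ℝ) (κ' : E' → E' →L[ℝ] E' →L[ℝ] ℝ)
    (z u v : E × E') : prodForm κ κ' z u v = κ z.1 u.1 v.1 + κ' z.2 u.2 v.2 := rfl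

@[simp] theorem prodCoform_apply (K : E → (E →L[ℝ] ℝ) →L[ℝ] E)
    (K' : E' → (E' →L[ℝ] ℝ) →L[ℝ] E') (z : E × E') (α : (E × E') →L[ℝ] ℝ) :
    prodCoform K K' z α = (K z.1 (α.comp (.inl ℝ E E')), K' z.2 (α.comp (.inr ℝ E E'))) := rfl

namespace IsMetricPair

variable {κ : E → E →L[ℝ] E →L[ℝ] ℝ} {K : E → (E →L[ℝ] ℝ) →L[ℝ] E} {U : Set E}
  {κ' : E' → E' →L[ℝ] E' →L[ℝ] ℝ} {K' : E' → (E' →L[ℝ] ℝ) →L[ℝ] E'} {U' : Set E'}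
  {k : E → E → E → ℝ} {k' : E' → E' → E' → ℝ} {z : E × E'}

theorem prod [FiniteDimensional ℝ E] [FiniteDimensional ℝ E'] (H : IsMetricPair κ K U)
    (H' : IsMetricPair κ' K' U') :
    IsMetricPair (prodForm κ κ') (prodCoform K K') (U ×ˢ U') where
  isOpen := H.isOpen.prod H'.isOpen
  smooth := by
    have h1 : ContDiffOn ℝ ∞ (fun z : E × E' ↦ κ z.1) (U ×ˢ U') :=
      H.smooth.comp contDiffOn_fst fun z hz ↦ hz.1
    have h2 : ContDiffOn ℝ ∞ (fun z : E × E' ↦ κ' z.2) (U ×ˢ U') :=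
      H'.smooth.comp contDiffOn_snd fun z hz ↦ hz.2
    refine contDiffOn_clm_apply.2 fun u ↦ contDiffOn_clm_apply.2 fun v ↦ ?_
    exact ((h1.clm_apply contDiffOn_const).clm_apply contDiffOn_const).add
      ((h2.clm_apply contDiffOn_const).clm_apply contDiffOn_const)
  smooth_inv := by
    have h1 : ContDiffOn ℝ ∞ (fun z : E × E' ↦ K z.1) (U ×ˢ U') :=
      H.smooth_inv.comp contDiffOn_fst fun z hz ↦ hz.1
    have h2 : ContDiffOn ℝ ∞ (fun z : E × E' ↦ K' z.2) (U ×ˢ U') :=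
      H'.smooth_inv.comp contDiffOn_snd fun z hz ↦ hz.2
    refine contDiffOn_clm_apply.2 fun α ↦ ?_
    exact (h1.clm_apply contDiffOn_const).prodMk (h2.clm_apply contDiffOn_const)
  symm z hz u v := by simp [H.symm _ hz.1 u.1, H'.symm _ hz.2 u.2]
  pos z hz u hu := by
    have h1 : ∀ w, 0 ≤ κ z.1 w w := fun w ↦ by
      by_cases hw : w = 0
      · simp [hw]
      · exact (H.pos _ hz.1 w hw).le
    have h2 : ∀ w, 0 ≤ κ' z.2 w w := fun w ↦ by
      by_cases hw : w = 0
      · simp [hw]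
      · exact (H'.pos _ hz.2 w hw).le
    by_cases h : u.1 = 0
    · have : u.2 ≠ 0 := fun h' ↦ hu (Prod.ext h h')
      exact add_pos_of_nonneg_of_pos (h1 _) (H'.pos _ hz.2 _ this)
    · exact add_pos_of_pos_of_nonneg (H.pos _ hz.1 _ h) (h2 _)
  left_inv z hz u := by
    have h1 : (prodForm κ κ' z u).comp (.inl ℝ E E') = κ z.1 u.1 := by ext w; simp
    have h2 : (prodForm κ κ' z u).comp (.inr ℝ E E') = κ' z.2 u.2 := by ext w; simp
    rw [prodCoform_apply, h1, h2, H.left_inv _ hz.1, H'.left_inv _ hz.2]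
  right_inv z hz α := by
    ext w
    · simp [H.right_inv _ hz.1]
    · simp [H'.right_inv _ hz.2]

theorem christoffel_prod [FiniteDimensional ℝ E] [FiniteDimensional ℝ E']
    (H : IsMetricPair κ K U) (H' : IsMetricPair κ' K' U') (hz : z ∈ U ×ˢ U') (u v : E × E') :
    chr (prodForm κ κ') (prodCoform K K') z u v = (chr κ K z.1 u.1 v.1, chr κ' K' z.2 u.2 v.2) := by
  have HH := H.prod H'
  have dκ : DifferentiableAt ℝ κ z.1 := smoothOn_differentiableAt H.isOpen H.smooth hz.1
  have dκ' : DifferentiableAt ℝ κ' z.2 := smoothOn_differentiableAt H'.isOpen H'.smooth hz.2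
  have key : ∀ a b c : E × E', fderiv ℝ (prodForm κ κ') z a b c
      = fderiv ℝ κ z.1 a.1 b.1 c.1 + fderiv ℝ κ' z.2 a.2 b.2 c.2 := by
    intro a b c
    have d := smoothOn_differentiableAt HH.isOpen HH.smooth hz
    have e1 : HasFDerivAt (fun w ↦ prodForm κ κ' w b c) _ z :=
      (d.hasFDerivAt.clm_apply (hasFDerivAt_const b z)).clm_apply (hasFDerivAt_const c z)
    have e2 : HasFDerivAt (fun w : E × E' ↦ κ w.1 b.1 c.1 + κ' w.2 b.2 c.2) _ z :=
      (((dκ.hasFDerivAt.comp z hasFDerivAt_fst).clm_apply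
        (hasFDerivAt_const b.1 z)).clm_apply (hasFDerivAt_const c.1 z)).add
      (((dκ'.hasFDerivAt.comp z hasFDerivAt_snd).clm_apply
        (hasFDerivAt_const b.2 z)).clm_apply (hasFDerivAt_const c.2 z))
    have := congrArg (fun L ↦ L a) (e1.unique e2)
    simpa using this
  refine HH.ext_inner hz fun w ↦ ?_
  rw [HH.chr_inner hz, prodForm_apply, H.chr_inner hz.1, H'.chr_inner hz.2, key, key, key]
  ring

/-- The sectional curvature of a product. -/
theorem sec_prod [FiniteDimensional ℝ E] [FiniteDimensional ℝ E']
    (H : IsMetricPair κ K U) (H' : IsMetricPair κ' K' U')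
    (hk : ∀ y ∈ U, ∀ u v, k y u v = κ y u v) (hk' : ∀ y ∈ U', ∀ u v, k' y u v = κ' y u v)
    {kk : E × E' → E × E' → E × E' → ℝ}
    (hkk : ∀ y ∈ U ×ˢ U', ∀ u v, kk y u v = prodForm κ κ' y u v)
    (hz : z ∈ U ×ˢ U') (u v : E × E') :
    sec kk z u v = sec k z.1 u.1 v.1 + sec k' z.2 u.2 v.2 := by
  have HH := H.prod H'
  have dc : DifferentiableAt ℝ (chr κ K) z.1 :=
    smoothOn_differentiableAt H.isOpen H.smooth_chr hz.1
  have dc' : DifferentiableAt ℝ (chr κ' K') z.2 :=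
    smoothOn_differentiableAt H'.isOpen H'.smooth_chr hz.2
  have key : ∀ a b c : E × E', fderiv ℝ (chr (prodForm κ κ') (prodCoform K K')) z a b c
      = (fderiv ℝ (chr κ K) z.1 a.1 b.1 c.1, fderiv ℝ (chr κ' K') z.2 a.2 b.2 c.2) := by
    intro a b c
    have d := smoothOn_differentiableAt HH.isOpen HH.smooth_chr hz
    have e1 : HasFDerivAt (fun w ↦ chr (prodForm κ κ') (prodCoform K K') w b c) _ z :=
      (d.hasFDerivAt.clm_apply (hasFDerivAt_const b z)).clm_apply (hasFDerivAt_const c z)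
    have e2 : HasFDerivAt (fun w : E × E' ↦ (chr κ K w.1 b.1 c.1, chr κ' K' w.2 b.2 c.2)) _ z :=
      (((dc.hasFDerivAt.comp z hasFDerivAt_fst).clm_apply
        (hasFDerivAt_const b.1 z)).clm_apply (hasFDerivAt_const c.1 z)).prodMk
      (((dc'.hasFDerivAt.comp z hasFDerivAt_snd).clm_apply
        (hasFDerivAt_const b.2 z)).clm_apply (hasFDerivAt_const c.2 z))
    have e3 := fderiv_eq_of_eqOn HH.isOpen (fun w hw ↦ H.christoffel_prod H' hw b c) hz
    rw [e1.fderiv, e2.fderiv] at e3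
    have := congrArg (fun L ↦ L a) e3
    simpa using this
  rw [HH.sec_eq hkk hz, H.sec_eq hk hz.1, H'.sec_eq hk' hz.2]
  simp only [key, H.christoffel_prod H' hz]
  simp only [prodForm_apply, Prod.fst_add, Prod.fst_sub, Prod.snd_add, Prod.snd_sub]

end IsMetricPair

/-! #### Riemannian submersions do not decrease the sectional curvature -/

/-- The hypothesis `hK` is the condition of a Riemannian submersion on the cotangent side: pulling
back covectors and pushing the dual vector forward recovers the cometric below. Since the result is
again a pulled-back function, it can be iterated through all nested pairings of `cometricCurvature`.
-/
theorem car_comp {K : E → (E →L[ℝ] ℝ) →L[ℝ] E} {U : Set E}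
    {K' : E' → (E' →L[ℝ] ℝ) →L[ℝ] E'} {U' : Set E'} {q : E → E'}
    (hU : IsOpen U) (hU' : IsOpen U') (hq : ContDiffOn ℝ ∞ q U) (hm : MapsTo q U U')
    (hK : ∀ z ∈ U, ∀ α : E' →L[ℝ] ℝ,
      fderiv ℝ q z (K z (α.comp (fderiv ℝ q z))) = K' (q z) α)
    {f h : E' → ℝ} (hf : ContDiffOn ℝ ∞ f U') (hh : ContDiffOn ℝ ∞ h U') :
    EqOn (car K (f ∘ q) (h ∘ q)) (car K' f h ∘ q) U := by
  intro z hz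
  have dq := smoothOn_differentiableAt hU hq hz
  have df := smoothOn_differentiableAt hU' hf (hm hz)
  have dh := smoothOn_differentiableAt hU' hh (hm hz)
  simp only [car, Function.comp_apply]
  rw [fderiv_comp z df dq, fderiv_comp z dh dq, ContinuousLinearMap.comp_apply, hK z hz]

/-- Compare the formula of `sectional_grad` for a pair of covectors, seen as linear functions, with
that for their pullbacks. The parts that are polynomial in the cometrics agree. The bracket upstairs
projects to the bracket downstairs and is at least as long; it enters with a negative sign. -/
theorem sec_le_of_submersion {κ : E → E →L[ℝ] E →L[ℝ] ℝ} {K : E → (E →L[ℝ] ℝ) →L[ℝ] E}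
    {U : Set E} {κ' : E' → E' →L[ℝ] E' →L[ℝ] ℝ} {K' : E' → (E' →L[ℝ] ℝ) →L[ℝ] E'} {U' : Set E'}
    {k : E → E → E → ℝ} {k' : E' → E' → E' → ℝ} {q : E → E'}
    (H : IsMetricPair κ K U) (H' : IsMetricPair κ' K' U')
    (hk : ∀ y ∈ U, ∀ u v, k y u v = κ y u v) (hk' : ∀ y ∈ U', ∀ u v, k' y u v = κ' y u v)
    (hq : ContDiffOn ℝ ∞ q U) (hm : MapsTo q U U')
    (hK : ∀ z ∈ U, ∀ α : E' →L[ℝ] ℝ,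
      fderiv ℝ q z (K z (α.comp (fderiv ℝ q z))) = K' (q z) α)
    {y : E} (hy : y ∈ U) (α β : E' →L[ℝ] ℝ) :
    sec k y (K y (α.comp (fderiv ℝ q y))) (K y (β.comp (fderiv ℝ q y)))
      ≤ sec k' (q y) (K' (q y) α) (K' (q y) β) := by
  have sα : ContDiffOn ℝ ∞ (α : E' → ℝ) U' := α.contDiff.contDiffOn
  have sβ : ContDiffOn ℝ ∞ (β : E' → ℝ) U' := β.contDiff.contDiffOn
  have sqα : ContDiffOn ℝ ∞ (α ∘ q) U := sα.comp hq hm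
  have sqβ : ContDiffOn ℝ ∞ (β ∘ q) U := sβ.comp hq hm
  have dq := smoothOn_differentiableAt H.isOpen hq hy
  have g1 : ∀ γ : E' →L[ℝ] ℝ, grad K (γ ∘ q) y = K y (γ.comp (fderiv ℝ q y)) := fun γ ↦ by
    rw [grad, fderiv_comp y γ.differentiableAt dq, ContinuousLinearMap.fderiv]
  have g2 : ∀ γ : E' →L[ℝ] ℝ, grad K' γ (q y) = K' (q y) γ := fun γ ↦ by
    rw [grad, ContinuousLinearMap.fderiv]
  have m1 := H.sectional_grad hk hy sqα sqβ
  have m2 := H'.sectional_grad hk' (hm hy) sα sβ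
  rw [g1, g1] at m1
  rw [g2, g2] at m2
  have car1 : ∀ {f h : E' → ℝ}, ContDiffOn ℝ ∞ f U' → ContDiffOn ℝ ∞ h U' →
      EqOn (car K (f ∘ q) (h ∘ q)) (car K' f h ∘ q) U :=
    fun hf hh ↦ car_comp H.isOpen H'.isOpen hq hm hK hf hh
  have sc : ∀ {f h : E' → ℝ}, ContDiffOn ℝ ∞ f U' → ContDiffOn ℝ ∞ h U' →
      ContDiffOn ℝ ∞ (car K' f h) U' := fun hf hh ↦ smooth_car H'.isOpen H'.smooth_inv hf hh
  have car3 : ∀ {f h : E' → ℝ} {φ ψ : E → ℝ}, ContDiffOn ℝ ∞ f U' → ContDiffOn ℝ ∞ h U' →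
      EqOn φ (f ∘ q) U → EqOn ψ (h ∘ q) U → EqOn (car K φ ψ) (car K' f h ∘ q) U :=
    fun hf hh hφ hψ ↦ (car_congr H.isOpen hφ hψ).trans (car1 hf hh)
  have rf : ∀ {f : E' → ℝ}, EqOn (f ∘ q) (f ∘ q) U := fun {_} ↦ eqOn_refl _ _
  have hcc : cometricCurvature K (α ∘ q) (β ∘ q) y = cometricCurvature K' α β (q y) := by
    have a1 := car3 sα (sc sα (sc sβ sβ)) rf (car3 sα (sc sβ sβ) rf (car1 sβ sβ)) hy
    have a2 := car3 sβ (sc sβ (sc sα sα)) rf (car3 sβ (sc sα sα) rf (car1 sα sα)) hy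
    have a3 := car3 sα (sc sβ (sc sα sβ)) rf (car3 sβ (sc sα sβ) rf (car1 sα sβ)) hy
    have a4 := car3 sβ (sc sα (sc sα sβ)) rf (car3 sα (sc sα sβ) rf (car1 sα sβ)) hy
    have a5 := car3 (sc sα sα) (sc sβ sβ) (car1 sα sα) (car1 sβ sβ) hy
    have a6 := car3 (sc sα sβ) (sc sα sβ) (car1 sα sβ) (car1 sα sβ) hy
    simp only [cometricCurvature, a1, a2, a3, a4, a5, a6, Function.comp_apply]
  set b := VectorField.lieBracket ℝ (grad K (α ∘ q)) (grad K (β ∘ q)) y with hb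
  set b' := VectorField.lieBracket ℝ (grad K' α) (grad K' β) (q y) with hb'
  have hbb : ∀ γ : E' →L[ℝ] ℝ, γ (fderiv ℝ q y b) = γ b' := by
    intro γ
    have sγ : ContDiffOn ℝ ∞ (γ : E' → ℝ) U' := γ.contDiff.contDiffOn
    have e1 := H.fderiv_lieBracket_grad hy sqα sqβ (sγ.comp hq hm)
    have e2 := H'.fderiv_lieBracket_grad (hm hy) sα sβ sγ
    rw [fderiv_comp y γ.differentiableAt dq, ContinuousLinearMap.fderiv] at e1
    rw [ContinuousLinearMap.fderiv] at e2
    have a1 := car3 sα (sc sβ sγ) rf (car1 sβ sγ) hy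
    have a2 := car3 sβ (sc sα sγ) rf (car1 sα sγ) hy
    rw [a1, a2, ContinuousLinearMap.comp_apply] at e1
    exact e1.trans e2.symm
  have hle : κ' (q y) b' b' ≤ κ y b b := by
    -- The vector `c` is the horizontal lift of `b'`, hence the horizontal part of `b`, and `0 ≤ |b
    -- - c|² = |b|² - |b'|²`.
    set c := K y ((κ' (q y) b').comp (fderiv ℝ q y)) with hc
    have c1 : κ y b c = κ' (q y) b' b' := by
      rw [hc, H.inner_inv' hy, ContinuousLinearMap.comp_apply, hbb]
    have c2 : κ y c c = κ' (q y) b' b' := by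
      rw [hc, H.inner_inv hy, ContinuousLinearMap.comp_apply, hK y hy, H'.left_inv _ (hm hy)]
    have c3 : κ y c b = κ y b c := H.symm y hy _ _
    have : 0 ≤ κ y (b - c) (b - c) := by
      by_cases h0 : b - c = 0
      · simp [h0]
      · exact (H.pos y hy _ h0).le
    simp only [map_sub, sub_apply] at this
    linarith
  rw [sec, sec, hk y hy, hk' _ (hm hy), m1, m2, hcc]
  linarith

end Comparison

end CheegerBundle

end

noncomputable section

namespace CheegerBundle

/-! ### Orthonormal bases and simultaneous diagonalization -/

section LinearAlgebra

variable {V : Type*} [AddCommGroup V] [Module ℝ V]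

theorem IsOrthonormalBasisOf.eq_sum {ι : Type*} [Fintype ι] {b : V → V → ℝ}
    {β : V →ₗ[ℝ] V →ₗ[ℝ] ℝ} (hb : ∀ u v, b u v = β u v) {W : Submodule ℝ V} {e : ι → V}
    (he : IsOrthonormalBasisOf b W e) {v : V} (hv : v ∈ W) : v = ∑ j, β v (e j) • e j := by
  classical
  obtain ⟨h1, h2, h3⟩ := he
  rw [← h3] at hv
  obtain ⟨c, rfl⟩ := (Submodule.mem_span_range_iff_exists_fun ℝ).1 hv
  refine Finset.sum_congr rfl fun j _ ↦ ?_
  congr 1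
  rw [map_sum, LinearMap.sum_apply, Finset.sum_eq_single j]
  · rw [map_smul, LinearMap.smul_apply, ← hb, h1, smul_eq_mul, mul_one]
  · intro i _ hij
    rw [map_smul, LinearMap.smul_apply, ← hb, h2 i j hij, smul_zero]
  · simp

/-- The trace of a bilinear form over an orthonormal basis does not depend on the basis. -/
theorem IsOrthonormalBasisOf.sum_eq {ι ι' : Type*} [Fintype ι] [Fintype ι'] {b : V → V → ℝ}
    {β : V →ₗ[ℝ] V →ₗ[ℝ] ℝ} (hb : ∀ u v, b u v = β u v) (hs : ∀ u v, β u v = β v u)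
    {W : Submodule ℝ V} {e : ι → V} {e' : ι' → V} (he : IsOrthonormalBasisOf b W e)
    (he' : IsOrthonormalBasisOf b W e') (B : V →ₗ[ℝ] V →ₗ[ℝ] ℝ) :
    ∑ i, B (e i) (e i) = ∑ j, B (e' j) (e' j) := by
  classical
  have mem : ∀ i, e i ∈ W := fun i ↦ he.2.2 ▸ Submodule.subset_span (mem_range_self i)
  have mem' : ∀ i, e' i ∈ W := fun i ↦ he'.2.2 ▸ Submodule.subset_span (mem_range_self i)
  have expand : ∀ i, B (e i) (e i)
      = ∑ j, ∑ k, β (e i) (e' j) * β (e i) (e' k) * B (e' j) (e' k) := by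
    intro i
    have h := he'.eq_sum hb (mem i)
    conv_lhs => rw [h]
    simp only [map_sum, LinearMap.sum_apply, map_smul, LinearMap.smul_apply, smul_eq_mul]
    simp only [Finset.mul_sum]
    rw [Finset.sum_comm]
    exact Finset.sum_congr rfl fun j _ ↦ Finset.sum_congr rfl fun k _ ↦ by ring
  have delta : ∀ j k, ∑ i, β (e i) (e' j) * β (e i) (e' k) = if j = k then 1 else 0 := by
    intro j k
    have h : β (e' j) (e' k) = ∑ i, β (e i) (e' j) * β (e i) (e' k) := by
      have h0 := he.eq_sum hb (mem' j)
      conv_lhs => rw [h0]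
      simp only [map_sum, LinearMap.sum_apply, map_smul, LinearMap.smul_apply, smul_eq_mul]
      exact Finset.sum_congr rfl fun i _ ↦ by rw [hs (e' j)]
    rw [← h, ← hb]
    split_ifs with hjk
    · rw [hjk]; exact he'.1 k
    · exact he'.2.1 j k hjk
  simp only [expand]
  rw [Finset.sum_comm]
  refine Finset.sum_congr rfl fun j _ ↦ ?_
  rw [Finset.sum_comm]
  simp only [← Finset.sum_mul, delta]
  simp

/-- A symmetric bilinear form is diagonal in some orthonormal basis. -/
theorem exists_basis_diagonal [FiniteDimensional ℝ V] (b₀ b₁ : V →ₗ[ℝ] V →ₗ[ℝ] ℝ)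
    (h₀ : ∀ u v, b₀ u v = b₀ v u) (hpos : ∀ u, u ≠ 0 → 0 < b₀ u u)
    (h₁ : ∀ u v, b₁ u v = b₁ v u) :
    ∃ (n : ℕ) (w : Module.Basis (Fin n) ℝ V) (μ : Fin n → ℝ),
      (∀ i, b₀ (w i) (w i) = 1) ∧ (∀ i j, i ≠ j → b₀ (w i) (w j) = 0) ∧
      (∀ i, b₁ (w i) (w i) = μ i) ∧ (∀ i j, i ≠ j → b₁ (w i) (w j) = 0) := by
  let core : InnerProductSpace.Core ℝ V :=
    { inner := fun u v ↦ b₀ u v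
      conj_inner_symm := fun u v ↦ by simpa using h₀ v u
      re_inner_nonneg := fun u ↦ by
        by_cases hu : u = 0
        · simp [hu]
        · simpa using (hpos u hu).le
      add_left := fun u v w ↦ by simp
      smul_left := fun u v r ↦ by simp
      definite := fun u hu ↦ by
        by_contra h
        exact (hpos u h).ne' hu }
  let : NormedAddCommGroup V := core.toNormedAddCommGroup
  let : InnerProductSpace ℝ V := InnerProductSpace.ofCore core.toCore
  have hin : ∀ u v : V, inner ℝ u v = b₀ u v := fun _ _ ↦ rfl
  have inj : Function.Injective b₀ := by
    rw [← LinearMap.ker_eq_bot, LinearMap.ker_eq_bot']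
    intro u hu
    by_contra h
    exact (hpos u h).ne' (by rw [hu]; rfl)
  let e : V ≃ₗ[ℝ] (V →ₗ[ℝ] ℝ) := LinearEquiv.ofInjectiveOfFinrankEq b₀ inj (by simp)
  have he : ∀ u, e u = b₀ u := fun u ↦ rfl
  -- The operator that represents `b₁` with respect to `b₀` is self-adjoint for the inner product
  -- `b₀`; its eigenvector basis diagonalizes both forms.
  let T : V →ₗ[ℝ] V := e.symm.toLinearMap ∘ₗ b₁
  have hT : ∀ u v, b₀ (T u) v = b₁ u v := fun u v ↦ by
    rw [← he]
    simp [T]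
  have symT : T.IsSymmetric := fun u v ↦ by
    rw [hin, hin, hT, h₀, hT, h₁]
  let w := symT.eigenvectorBasis rfl
  have worth : ∀ i j, b₀ (w i) (w j) = if i = j then 1 else 0 := fun i j ↦ by
    rw [← hin]; exact orthonormal_iff_ite.1 w.orthonormal i j
  have w1 : ∀ i j, b₁ (w i) (w j) = symT.eigenvalues rfl i * b₀ (w i) (w j) := fun i j ↦ by
    rw [← hT, symT.apply_eigenvectorBasis]
    simp [w]
  refine ⟨_, w.toBasis, symT.eigenvalues rfl, ?_, ?_, ?_, ?_⟩
  · intro i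
    simp [worth]
  · intro i j hij
    simp [worth, hij]
  · intro i
    simp [w1, worth]
  · intro i j hij
    simp [w1, worth, hij]

theorem exists_isOrthonormalBasisOf [FiniteDimensional ℝ V] {b : V → V → ℝ}
    {β : V →ₗ[ℝ] V →ₗ[ℝ] ℝ} (hb : ∀ u v, b u v = β u v) (hs : ∀ u v, β u v = β v u)
    (hpos : ∀ u, u ≠ 0 → 0 < β u u) (W : Submodule ℝ V) :
    ∃ (n : ℕ) (e : Fin n → V), IsOrthonormalBasisOf b W e := by
  -- Diagonalizing the zero form on `W` leaves just an orthonormal basis.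
  obtain ⟨n, w, -, h1, h2, -, -⟩ := exists_basis_diagonal
    ((β.domRestrict₁₂ W W)) 0 (fun u v ↦ hs u v)
    (fun u hu ↦ hpos u (fun h ↦ hu (Subtype.ext h))) (fun _ _ ↦ rfl)
  refine ⟨n, fun i ↦ w i, fun i ↦ by rw [hb]; exact h1 i, fun i j hij ↦ by rw [hb]; exact h2 i j hij,
    ?_⟩
  have : range (fun i ↦ (w i : V)) = W.subtype '' range w := by
    rw [← range_comp]; rfl
  rw [this, Submodule.span_image, w.span_eq, Submodule.map_top, Submodule.range_subtype]

end LinearAlgebra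

/-! ### Rational functions and their limits -/

/-- The function is given near infinity by a rational function. -/
def IsRat (φ : ℝ → ℝ) : Prop :=
  ∃ p q : Polynomial ℝ, q ≠ 0 ∧ ∀ᶠ t in atTop, φ t * q.eval t = p.eval t

namespace IsRat

variable {φ ψ : ℝ → ℝ}

theorem congr (h : IsRat φ) (he : ∀ᶠ t in atTop, ψ t = φ t) : IsRat ψ := by
  obtain ⟨p, q, hq, h⟩ := h
  exact ⟨p, q, hq, by filter_upwards [h, he] with t h1 h2; rw [h2, h1]⟩

theorem const (c : ℝ) : IsRat fun _ ↦ c :=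
  ⟨Polynomial.C c, 1, one_ne_zero, Eventually.of_forall fun t ↦ by simp⟩

theorem id : IsRat fun t ↦ t :=
  ⟨Polynomial.X, 1, one_ne_zero, Eventually.of_forall fun t ↦ by simp⟩

theorem add (h : IsRat φ) (h' : IsRat ψ) : IsRat fun t ↦ φ t + ψ t := by
  obtain ⟨p, q, hq, h⟩ := h
  obtain ⟨p', q', hq', h'⟩ := h'
  refine ⟨p * q' + p' * q, q * q', mul_ne_zero hq hq', ?_⟩
  filter_upwards [h, h'] with t h1 h2
  simp only [Polynomial.eval_add, Polynomial.eval_mul, ← h1, ← h2]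
  ring

theorem mul (h : IsRat φ) (h' : IsRat ψ) : IsRat fun t ↦ φ t * ψ t := by
  obtain ⟨p, q, hq, h⟩ := h
  obtain ⟨p', q', hq', h'⟩ := h'
  refine ⟨p * p', q * q', mul_ne_zero hq hq', ?_⟩
  filter_upwards [h, h'] with t h1 h2
  simp only [Polynomial.eval_mul, ← h1, ← h2]
  ring

theorem const_mul (h : IsRat φ) (c : ℝ) : IsRat fun t ↦ c * φ t := (const c).mul h

theorem sub (h : IsRat φ) (h' : IsRat ψ) : IsRat fun t ↦ φ t - ψ t :=
  (h.add (h'.const_mul (-1))).congr (Eventually.of_forall fun t ↦ by ring)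

theorem sum {ι : Type*} {s : Finset ι} {φ : ι → ℝ → ℝ} (h : ∀ i ∈ s, IsRat (φ i)) :
    IsRat fun t ↦ ∑ i ∈ s, φ i t := by
  classical
  induction s using Finset.induction_on with
  | empty => simpa using const 0
  | insert a s ha ih =>
    simp only [Finset.sum_insert ha]
    exact (h a (Finset.mem_insert_self a s)).add (ih fun i hi ↦ h i (Finset.mem_insert_of_mem hi))

theorem inv_linear {μ : ℝ} (hμ : 0 ≤ μ) : IsRat fun t ↦ (1 + μ * t)⁻¹ := by
  refine ⟨1, 1 + Polynomial.C μ * Polynomial.X, fun h ↦ ?_, ?_⟩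
  · have := congrArg (Polynomial.eval 0) h
    simp at this
  · filter_upwards [eventually_gt_atTop 0] with t ht
    have : 1 + μ * t ≠ 0 := by positivity
    simp [this]

/-- Comparing degrees of numerator and denominator decides the behaviour at infinity. The value `⊥`
is allowed here; in the application it is excluded by a lower bound that converges to a real number.
-/
theorem exists_tendsto (h : IsRat φ) :
    ∃ L : EReal, Tendsto (fun t ↦ ((φ t : ℝ) : EReal)) atTop (𝓝 L) := by
  obtain ⟨p, q, hq, h⟩ := h
  have he : ∀ᶠ t in atTop, p.eval t / q.eval t = φ t := by
    filter_upwards [h, q.eventually_atTop_not_isRoot hq] with t h1 h2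
    rw [← h1, mul_div_assoc, div_self h2, mul_one]
  have real : ∀ {l : ℝ}, Tendsto (fun t ↦ p.eval t / q.eval t) atTop (𝓝 l) →
      ∃ L : EReal, Tendsto (fun t ↦ ((φ t : ℝ) : EReal)) atTop (𝓝 L) := fun {l} hl ↦
    ⟨l, (continuous_coe_real_ereal.tendsto l).comp (hl.congr' he)⟩
  rcases lt_trichotomy p.degree q.degree with hd | hd | hd
  · exact real (p.div_tendsto_atTop_zero_of_degree_lt q hd)
  · exact real (p.div_tendsto_atTop_leadingCoeff_div_of_degree_eq q hd)
  · rcases le_total 0 (p.leadingCoeff / q.leadingCoeff) with hl | hl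
    · exact ⟨⊤, EReal.tendsto_coe_nhds_top_iff.2
        ((p.div_tendsto_atTop_of_degree_gt q hd hq hl).congr' he)⟩
    · exact ⟨⊥, EReal.tendsto_coe_nhds_bot_iff.2
        ((p.div_tendsto_atBot_of_degree_gt q hd hq hl).congr' he)⟩

end IsRat

/-! ### The Ricci curvature of an affine family of cometrics -/

section AffineFamily

set_option maxSynthPendingDepth 3

variable {E : Type*} [NormedAddCommGroup E] [NormedSpace ℝ E]

/-- Polynomials in a parameter whose coefficients are smooth functions on `U`. -/
inductive PolyIn (U : Set E) : (ℝ → E → ℝ) → Prop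
  | base (c : E → ℝ) (hc : ContDiffOn ℝ ∞ c U) : PolyIn U (fun _ ↦ c)
  | add (φ ψ : ℝ → E → ℝ) (hφ : PolyIn U φ) (hψ : PolyIn U ψ) :
      PolyIn U (fun t y ↦ φ t y + ψ t y)
  | tmul (φ : ℝ → E → ℝ) (hφ : PolyIn U φ) : PolyIn U (fun t y ↦ t * φ t y)
  | congr (φ ψ : ℝ → E → ℝ) (hφ : PolyIn U φ) (h : ∀ t, EqOn (ψ t) (φ t) U) : PolyIn U ψ

namespace PolyIn

variable {U : Set E} {φ ψ : ℝ → E → ℝ}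

theorem smooth (h : PolyIn U φ) (t : ℝ) : ContDiffOn ℝ ∞ (φ t) U := by
  induction h with
  | base c hc => exact hc
  | add φ ψ _ _ h1 h2 => exact h1.add h2
  | tmul φ _ h1 => exact contDiffOn_const.mul h1
  | congr φ ψ _ h h1 => exact h1.congr (h t)

theorem isRat (h : PolyIn U φ) {y : E} (hy : y ∈ U) : IsRat fun t ↦ φ t y := by
  induction h with
  | base c hc => exact .const _
  | add φ ψ _ _ h1 h2 => exact h1.add h2
  | tmul φ _ h1 => exact IsRat.id.mul h1
  | congr φ ψ _ h h1 => exact h1.congr (Eventually.of_forall fun t ↦ h t hy)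

variable {A B : E → (E →L[ℝ] ℝ) →L[ℝ] E}

/-- Pairing with `A + tB` is bilinear and affine in the parameter, so it sends polynomials in `t`
with smooth coefficients to such polynomials. The constructor `congr` asks for equality on `U` only,
which suffices because `U` is open and the pairing is local. -/
theorem car (hU : IsOpen U) (hA : ContDiffOn ℝ ∞ A U) (hB : ContDiffOn ℝ ∞ B U)
    (hφ : PolyIn U φ) (hψ : PolyIn U ψ) :
    PolyIn U (fun t ↦ car (fun x ↦ A x + t • B x) (φ t) (ψ t)) := by
  induction hφ with
  | base c hc =>
    induction hψ with
    | base d hd =>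
      refine congr _ _ (add _ _ (base _ (smooth_car hU hA hc hd))
        (tmul _ (base _ (smooth_car hU hB hc hd)))) fun t y hy ↦ ?_
      simp [CheegerBundle.car]
    | add ψ₁ ψ₂ h1 h2 i1 i2 =>
      refine congr _ _ (add _ _ i1 i2) fun t y hy ↦ ?_
      have d1 := smoothOn_differentiableAt hU (h1.smooth t) hy
      have d2 := smoothOn_differentiableAt hU (h2.smooth t) hy
      simp only [CheegerBundle.car, fderiv_fun_add d1 d2, map_add]
    | tmul ψ h i =>
      refine congr _ _ (tmul _ i) fun t y hy ↦ ?_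
      have d := smoothOn_differentiableAt hU (h.smooth t) hy
      simp only [CheegerBundle.car, fderiv_const_mul d, map_smul, smul_eq_mul]
    | congr ψ ψ' h he i =>
      exact congr _ _ i fun t ↦ car_congr hU (eqOn_refl _ _) (he t)
  | add φ₁ φ₂ h1 h2 i1 i2 =>
    refine congr _ _ (add _ _ i1 i2) fun t y hy ↦ ?_
    have d1 := smoothOn_differentiableAt hU (h1.smooth t) hy
    have d2 := smoothOn_differentiableAt hU (h2.smooth t) hy
    simp only [CheegerBundle.car, fderiv_fun_add d1 d2, add_apply]
  | tmul φ h i =>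
    refine congr _ _ (tmul _ i) fun t y hy ↦ ?_
    have d := smoothOn_differentiableAt hU (h.smooth t) hy
    simp only [CheegerBundle.car, fderiv_const_mul d, smul_apply, smul_eq_mul]
  | congr φ φ' h he i =>
    exact congr _ _ i fun t ↦ car_congr hU (he t) (eqOn_refl _ _)

theorem clm (α : E →L[ℝ] ℝ) : PolyIn U (fun _ ↦ α) := base _ α.contDiff.contDiffOn

theorem isRat_cometricCurvature (hU : IsOpen U) (hA : ContDiffOn ℝ ∞ A U)
    (hB : ContDiffOn ℝ ∞ B U) {y : E} (hy : y ∈ U) (hφ : PolyIn U φ) (hψ : PolyIn U ψ) :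
    IsRat fun t ↦ cometricCurvature (fun x ↦ A x + t • B x) (φ t) (ψ t) y := by
  have c : ∀ {φ ψ : ℝ → E → ℝ}, PolyIn U φ → PolyIn U ψ →
      PolyIn U (fun t ↦ CheegerBundle.car (fun x ↦ A x + t • B x) (φ t) (ψ t)) :=
    fun h1 h2 ↦ car hU hA hB h1 h2
  have r : ∀ {φ ψ : ℝ → E → ℝ}, PolyIn U φ → PolyIn U ψ →
      IsRat (fun t ↦ CheegerBundle.car (fun x ↦ A x + t • B x) (φ t) (ψ t) y) :=
    fun h1 h2 ↦ (c h1 h2).isRat hy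
  exact (((((r hφ (c hφ (c hψ hψ))).const_mul _).add ((r hψ (c hψ (c hφ hφ))).const_mul _)).sub
    (((r hφ (c hψ (c hφ hψ))).add (r hψ (c hφ (c hφ hψ)))).const_mul _)).sub
    ((r (c hφ hφ) (c hψ hψ)).const_mul _)).add ((r (c hφ hψ) (c hφ hψ)).const_mul _)

end PolyIn

theorem eq_zero_of_basis_apply {ι : Type*} [Fintype ι] (w : Module.Basis ι ℝ (E →L[ℝ] ℝ)) {v : E}
    (h : ∀ a, w a v = 0) : v = 0 := by
  by_contra hne
  obtain ⟨α, hα⟩ := SeparatingDual.exists_ne_zero (R := ℝ) hne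
  apply hα
  have h1 := congrArg (fun γ : E →L[ℝ] ℝ ↦ γ v) (w.sum_repr α)
  have h2 : (∑ i, w.repr α i • w i) v = 0 := by
    rw [sum_apply]
    exact Finset.sum_eq_zero fun i _ ↦ by rw [smul_apply, h, smul_zero]
  exact h1.symm.trans h2

/-- A basis of covectors in which the cometrics `A` and `B` are diagonal, `A` with coefficients `1`
and `B` with coefficients `μ`. -/
structure IsDiagonalBasis {n : ℕ} (A B : (E →L[ℝ] ℝ) →L[ℝ] E)
    (w : Module.Basis (Fin n) ℝ (E →L[ℝ] ℝ)) (μ : Fin n → ℝ) : Prop where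
  nonneg : ∀ a, 0 ≤ μ a
  left : ∀ a b, w a (A (w b)) = if a = b then 1 else 0
  right : ∀ a, B (w a) = μ a • A (w a)

namespace IsDiagonalBasis

variable {n : ℕ} {A B : (E →L[ℝ] ℝ) →L[ℝ] E} {w : Module.Basis (Fin n) ℝ (E →L[ℝ] ℝ)}
  {μ : Fin n → ℝ}

theorem eq_sum [FiniteDimensional ℝ E] (h : IsDiagonalBasis A B w μ) (v : E) :
    v = ∑ a, w a v • A (w a) := by
  classical
  refine sub_eq_zero.1 (eq_zero_of_basis_apply w fun b ↦ ?_)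
  simp [h.left]

theorem family_apply (h : IsDiagonalBasis A B w μ) (t : ℝ) (a : Fin n) :
    (A + t • B) (w a) = (1 + μ a * t) • A (w a) := by
  rw [add_apply, smul_apply, h.right, smul_smul, add_smul, one_smul, mul_comm]

end IsDiagonalBasis

theorem exists_isDiagonalBasis [FiniteDimensional ℝ E] (A B : (E →L[ℝ] ℝ) →L[ℝ] E)
    (hA : ∀ α β : E →L[ℝ] ℝ, α (A β) = β (A α)) (hB : ∀ α β : E →L[ℝ] ℝ, α (B β) = β (B α))
    (hpos : ∀ α : E →L[ℝ] ℝ, α ≠ 0 → 0 < α (A α)) (hnn : ∀ α : E →L[ℝ] ℝ, 0 ≤ α (B α)) :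
    ∃ (n : ℕ) (w : Module.Basis (Fin n) ℝ (E →L[ℝ] ℝ)) (μ : Fin n → ℝ),
      IsDiagonalBasis A B w μ := by
  let form : ((E →L[ℝ] ℝ) →L[ℝ] E) → ((E →L[ℝ] ℝ) →ₗ[ℝ] (E →L[ℝ] ℝ) →ₗ[ℝ] ℝ) := fun C ↦
    LinearMap.mk₂ ℝ (fun α β ↦ α (C β)) (fun _ _ _ ↦ by simp) (fun _ _ _ ↦ by simp)
      (fun _ _ _ ↦ by simp) (fun _ _ _ ↦ by simp)
  have hf : ∀ C α β, form C α β = α (C β) := fun _ _ _ ↦ rfl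
  obtain ⟨n, w, μ, h1, h2, h3, h4⟩ := exists_basis_diagonal (form A) (form B)
    (fun u v ↦ hA u v) (fun u hu ↦ hpos u hu) (fun u v ↦ hB u v)
  simp only [hf] at h1 h2 h3 h4
  refine ⟨n, w, μ, fun a ↦ by rw [← h3]; exact hnn _, fun a b ↦ ?_, fun b ↦ ?_⟩
  · split_ifs with hab
    · rw [hab, h1]
    · exact h2 a b hab
  · refine sub_eq_zero.1 (eq_zero_of_basis_apply w fun a ↦ ?_)
    by_cases hab : a = b
    · subst hab; simp [h3, h1]
    · simp [h4 a b hab, h2 a b hab]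

variable {U : Set E} {y : E} {A B : E → (E →L[ℝ] ℝ) →L[ℝ] E} {κ : ℝ → E → E →L[ℝ] E →L[ℝ] ℝ}
  {k : ℝ → E → E → E → ℝ} {n : ℕ} {w : Module.Basis (Fin n) ℝ (E →L[ℝ] ℝ)} {μ : Fin n → ℝ}

/-- In `sectional_grad` the first part is polynomial in `t`. The components `w a b` of the bracket
are polynomial as well, but its squared length involves the inverse of `A + tB`; in the diagonal
basis this inverse contributes only the factors `(1 + μ a t)⁻¹`. -/
theorem isRat_sec_covectors [FiniteDimensional ℝ E] (hU : IsOpen U) (hA : ContDiffOn ℝ ∞ A U)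
    (hB : ContDiffOn ℝ ∞ B U)
    (H : ∀ t, 0 < t → IsMetricPair (κ t) (fun x ↦ A x + t • B x) U)
    (hk : ∀ t, 0 < t → ∀ y ∈ U, ∀ u v, k t y u v = κ t y u v) (hy : y ∈ U)
    (hw : IsDiagonalBasis (A y) (B y) w μ) (α β : E →L[ℝ] ℝ) :
    IsRat fun t ↦ sec (k t) y ((A y + t • B y) α) ((A y + t • B y) β) := by
  set Kt : ℝ → E → (E →L[ℝ] ℝ) →L[ℝ] E := fun t x ↦ A x + t • B x with hKt
  have poly : ∀ γ : E →L[ℝ] ℝ, PolyIn U (fun _ ↦ γ) := fun γ ↦ PolyIn.clm γ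
  have c : ∀ {φ ψ : ℝ → E → ℝ}, PolyIn U φ → PolyIn U ψ →
      PolyIn U (fun t ↦ car (Kt t) (φ t) (ψ t)) := fun h1 h2 ↦ h1.car hU hA hB h2
  have br : ∀ a, IsRat fun t ↦ car (Kt t) α (car (Kt t) β (w a)) y
      - car (Kt t) β (car (Kt t) α (w a)) y := fun a ↦
    ((c (poly α) (c (poly β) (poly (w a)))).isRat hy).sub
      ((c (poly β) (c (poly α) (poly (w a)))).isRat hy)
  have main : IsRat fun t ↦ cometricCurvature (Kt t) α β y - 3 / 4 * ∑ a, (1 + μ a * t)⁻¹ *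
      ((car (Kt t) α (car (Kt t) β (w a)) y - car (Kt t) β (car (Kt t) α (w a)) y)
      * (car (Kt t) α (car (Kt t) β (w a)) y - car (Kt t) β (car (Kt t) α (w a)) y)) :=
    (PolyIn.isRat_cometricCurvature hU hA hB hy (poly α) (poly β)).sub
      ((IsRat.sum fun a _ ↦ (IsRat.inv_linear (hw.nonneg a)).mul ((br a).mul (br a))).const_mul _)
  refine main.congr ?_
  filter_upwards [eventually_gt_atTop 0] with t ht
  have Ht := H t ht
  have sα : ContDiffOn ℝ ∞ (α : E → ℝ) U := α.contDiff.contDiffOn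
  have sβ : ContDiffOn ℝ ∞ (β : E → ℝ) U := β.contDiff.contDiffOn
  have g : ∀ γ : E →L[ℝ] ℝ, grad (Kt t) γ y = (A y + t • B y) γ := fun γ ↦ by
    rw [grad, ContinuousLinearMap.fderiv]
  have m := Ht.sectional_grad (hk t ht) hy sα sβ
  set b := VectorField.lieBracket ℝ (grad (Kt t) α) (grad (Kt t) β) y with hb
  have wb : ∀ a, w a b = car (Kt t) α (car (Kt t) β (w a)) y
      - car (Kt t) β (car (Kt t) α (w a)) y := fun a ↦ by
    rw [← Ht.fderiv_lieBracket_grad hy sα sβ (w a).contDiff.contDiffOn,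
      ContinuousLinearMap.fderiv]
  -- Expand one copy of `b` in the frame `A y (w a)`; the metric turns `(A + tB) (w a)` back into
  -- the covector `w a`.
  have kb : κ t y b b = ∑ a, (1 + μ a * t)⁻¹ * (w a b * w a b) := by
    have h0 : κ t y b b = κ t y b (∑ a, w a b • A y (w a)) := by rw [← hw.eq_sum b]
    rw [h0, map_sum]
    refine Finset.sum_congr rfl fun a _ ↦ ?_
    have pos : 1 + μ a * t ≠ 0 := by
      have := hw.nonneg a
      positivity
    have e : A y (w a) = (1 + μ a * t)⁻¹ • Kt t y (w a) := by
      rw [hKt]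
      simp only [hw.family_apply, smul_smul, inv_mul_cancel₀ pos, one_smul]
    rw [e, map_smul, map_smul, Ht.inner_inv' hy]
    simp only [smul_eq_mul]
    ring
  rw [sec, hk t ht y hy, ← g, ← g]
  refine m.trans ?_
  rw [kb]
  simp only [wb, hKt]

/-- The trace of the curvature of an affine family of cometrics is a rational function of the
parameter. -/
theorem isRat_ricci [FiniteDimensional ℝ E] (hU : IsOpen U) (hA : ContDiffOn ℝ ∞ A U)
    (hB : ContDiffOn ℝ ∞ B U)
    (H : ∀ t, 0 < t → IsMetricPair (κ t) (fun x ↦ A x + t • B x) U)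
    (hk : ∀ t, 0 < t → ∀ y ∈ U, ∀ u v, k t y u v = κ t y u v) (hy : y ∈ U)
    (hw : IsDiagonalBasis (A y) (B y) w μ) (v : E) :
    IsRat fun t ↦ ∑ a, (1 + μ a * t) * sec (k t) y v (A y (w a)) := by
  have R := fun α β ↦ isRat_sec_covectors hU hA hB H hk hy hw α β
  set s : Fin n → ℝ → ℝ := fun b t ↦ w b v * (1 + μ b * t)⁻¹ with hs
  have sr : ∀ b, IsRat (s b) := fun b ↦ (IsRat.inv_linear (hw.nonneg b)).const_mul _
  -- The previous lemma needs covectors that do not depend on `t`, whereas the covector dual to the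
  -- fixed vector `v` does. So `v` is expanded in the vectors dual to the `w b`, with rational
  -- coefficients `s b`, and the mixed terms are recovered from curvatures by polarization.
  have main : IsRat fun t ↦ ∑ a, (1 + μ a * t)⁻¹ * ∑ b, ∑ c, (s b t * s c t) * (1 / 2 *
      (sec (k t) y ((A y + t • B y) (w b + w c)) ((A y + t • B y) (w a))
        - sec (k t) y ((A y + t • B y) (w b)) ((A y + t • B y) (w a))
        - sec (k t) y ((A y + t • B y) (w c)) ((A y + t • B y) (w a)))) :=
    IsRat.sum fun a _ ↦ (IsRat.inv_linear (hw.nonneg a)).mul (IsRat.sum fun b _ ↦ IsRat.sum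
      fun c _ ↦ ((sr b).mul (sr c)).mul ((((R _ _).sub (R _ _)).sub (R _ _)).const_mul _))
  refine main.congr ?_
  filter_upwards [eventually_gt_atTop 0] with t ht
  have Ht := H t ht
  refine Finset.sum_congr rfl fun a _ ↦ ?_
  have pos : ∀ a, 1 + μ a * t ≠ 0 := fun a ↦ by
    have := hw.nonneg a
    positivity
  have e : ∀ a, A y (w a) = (1 + μ a * t)⁻¹ • (A y + t • B y) (w a) := fun a ↦ by
    rw [hw.family_apply, smul_smul, inv_mul_cancel₀ (pos a), one_smul]
  have ev : v = ∑ b, s b t • (A y + t • B y) (w b) := by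
    conv_lhs => rw [hw.eq_sum v]
    exact Finset.sum_congr rfl fun b _ ↦ by rw [e, smul_smul]
  rw [e a, Ht.sec_smul_right (hk t ht) hy]
  obtain ⟨Q, hQ⟩ := Ht.sec_eq_bilin_left (hk t ht) hy ((A y + t • B y) (w a))
  simp only [hQ]
  rw [show (1 + μ a * t) * ((1 + μ a * t)⁻¹ ^ 2 * Q v v) = (1 + μ a * t)⁻¹ * Q v v by
    field_simp [pos a]]
  congr 1
  set F : Fin n → E := fun b ↦ (A y + t • B y) (w b) with hF
  have q1 : Q v v = ∑ b, ∑ c, (s b t * s c t) * Q (F b) (F c) := by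
    rw [ev]
    simp only [map_sum, LinearMap.sum_apply, map_smul, LinearMap.smul_apply, smul_eq_mul]
    simp only [Finset.mul_sum]
    rw [Finset.sum_comm]
    exact Finset.sum_congr rfl fun b _ ↦ Finset.sum_congr rfl fun c _ ↦ by ring
  have q2 : Q v v = ∑ b, ∑ c, (s b t * s c t) * Q (F c) (F b) := by
    rw [q1, Finset.sum_comm]
    exact Finset.sum_congr rfl fun b _ ↦ Finset.sum_congr rfl fun c _ ↦ by ring
  -- The bilinear form `Q` is not known to be symmetric, and polarization sees only its symmetric
  -- part; hence the average of the two orders.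
  have q3 : Q v v = 1 / 2 * (∑ b, ∑ c, (s b t * s c t) * Q (F b) (F c)
      + ∑ b, ∑ c, (s b t * s c t) * Q (F c) (F b)) := by rw [← q1, ← q2]; ring
  rw [q3, ← Finset.sum_add_distrib, Finset.mul_sum]
  refine Finset.sum_congr rfl fun b _ ↦ ?_
  rw [← Finset.sum_add_distrib, Finset.mul_sum]
  refine Finset.sum_congr rfl fun c _ ↦ ?_
  simp only [map_add, LinearMap.add_apply, hF]
  ring

end AffineFamily

end CheegerBundle

end

noncomputable section

namespace CheegerBundle

/-! ### Metrics induced by submersions, in coordinates -/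

section Descent

set_option maxSynthPendingDepth 3

variable {E₁ E₀ : Type*} [NormedAddCommGroup E₁] [NormedSpace ℝ E₁] [NormedAddCommGroup E₀]
  [NormedSpace ℝ E₀]

/-- A smooth map has a smooth local section through each point at which it is a submersion. -/
theorem exists_smooth_section [FiniteDimensional ℝ E₁] [FiniteDimensional ℝ E₀] {q : E₁ → E₀}
    {U : Set E₁} (hU : IsOpen U) (hq : ContDiffOn ℝ ∞ q U) {y : E₁} (hy : y ∈ U)
    (hs : Function.Surjective (fderiv ℝ q y)) :
    ∃ (U₀ : Set E₀) (σ : E₀ → E₁), IsOpen U₀ ∧ q y ∈ U₀ ∧ ContDiffOn ℝ ∞ σ U₀ ∧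
      MapsTo σ U₀ U ∧ (∀ x ∈ U₀, q (σ x) = x) ∧ σ (q y) = y := by
  have : CompleteSpace E₀ := FiniteDimensional.complete ℝ E₀
  obtain ⟨S, hS⟩ := (fderiv ℝ q y).toLinearMap.exists_rightInverse_of_surjective
    (LinearMap.range_eq_top.2 hs)
  let S' : E₀ →L[ℝ] E₁ := S.toContinuousLinearMap
  have hS' : (fderiv ℝ q y).comp S' = ContinuousLinearMap.id ℝ E₀ := by
    ext w; exact LinearMap.congr_fun hS w
  -- Restricting `q` to the affine slice through `y` given by a right inverse of its differential
  -- makes the derivative the identity, so the inverse function theorem applies; the section is the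
  -- slice composed with the local inverse.
  let s : E₀ → E₁ := fun w ↦ y + S' w
  have ss : ContDiff ℝ ∞ s := contDiff_const.add S'.contDiff
  have s0 : s 0 = y := by simp [s]
  let V : Set E₀ := s ⁻¹' U
  have hV : IsOpen V := hU.preimage ss.continuous
  let φ : E₀ → E₀ := q ∘ s
  have hφ : ContDiffOn ℝ ∞ φ V := hq.comp ss.contDiffOn fun _ h ↦ h
  have h0V : (0 : E₀) ∈ V := by change s 0 ∈ U; rw [s0]; exact hy
  have hφ0 : ContDiffAt ℝ ∞ φ 0 := hφ.contDiffAt (hV.mem_nhds h0V)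
  have ds : HasFDerivAt s S' 0 := S'.hasFDerivAt.const_add y
  have dq : HasFDerivAt q (fderiv ℝ q y) (s 0) := by
    rw [s0]; exact (smoothOn_differentiableAt hU hq hy).hasFDerivAt
  have dφ : HasFDerivAt φ ((ContinuousLinearEquiv.refl ℝ E₀ : E₀ ≃L[ℝ] E₀) : E₀ →L[ℝ] E₀) 0 := by
    have := dq.comp 0 ds
    rw [hS'] at this
    exact this
  let Φ := hφ0.toOpenPartialHomeomorph φ dφ (by simp)
  have hΦ0 : (0 : E₀) ∈ Φ.source := hφ0.mem_toOpenPartialHomeomorph_source dφ (by simp)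
  have hΦ : ∀ x, Φ x = φ x := fun _ ↦ rfl
  let I : Set (E₀ →L[ℝ] E₀) := range ((↑) : (E₀ ≃L[ℝ] E₀) → (E₀ →L[ℝ] E₀))
  have hI : IsOpen I := ContinuousLinearEquiv.isOpen
  -- The local inverse is smooth at a point as soon as the derivative of `φ` at the preimage is
  -- invertible. This is an open condition, and `W` is the set where it holds.
  let W : Set E₀ := V ∩ fderiv ℝ φ ⁻¹' I
  have hW : IsOpen W := (smoothOn_fderiv hV hφ).continuousOn.isOpen_inter_preimage hV hI
  have h0W : (0 : E₀) ∈ W := ⟨h0V, ⟨ContinuousLinearEquiv.refl ℝ E₀, dφ.fderiv.symm⟩⟩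
  refine ⟨Φ.target ∩ Φ.symm ⁻¹' W, s ∘ Φ.symm, Φ.isOpen_inter_preimage_symm hW, ?_, ?_, ?_, ?_, ?_⟩
  · have e : q y = Φ 0 := by rw [hΦ]; simp [φ, s0]
    rw [e]
    exact ⟨Φ.map_source hΦ0, by rw [mem_preimage, Φ.left_inv hΦ0]; exact h0W⟩
  · refine ss.comp_contDiffOn fun x hx ↦ ContDiffAt.contDiffWithinAt ?_
    obtain ⟨e, he⟩ := hx.2.2
    refine Φ.contDiffAt_symm (f₀' := e) hx.1 ?_ (hφ.contDiffAt (hV.mem_nhds hx.2.1))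
    rw [he]
    exact (smoothOn_differentiableAt hV hφ hx.2.1).hasFDerivAt
  · exact fun x hx ↦ hx.2.1
  · exact fun x hx ↦ Φ.right_inv hx.1
  · have e : q y = Φ 0 := by rw [hΦ]; simp [φ, s0]
    rw [e, Function.comp_apply, Φ.left_inv hΦ0, s0]

/-- The image of the cometric `C` under the differential of `q`, at the points of the section `σ`. -/
def push (q : E₁ → E₀) (σ : E₀ → E₁) (C : E₁ → (E₁ →L[ℝ] ℝ) →L[ℝ] E₁) (x : E₀) :
    (E₀ →L[ℝ] ℝ) →L[ℝ] E₀ :=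
  (fderiv ℝ q (σ x)).comp ((C (σ x)).comp ((fderiv ℝ q (σ x)).precomp ℝ))

theorem push_apply (q : E₁ → E₀) (σ : E₀ → E₁) (C : E₁ → (E₁ →L[ℝ] ℝ) →L[ℝ] E₁) (x : E₀)
    (α : E₀ →L[ℝ] ℝ) :
    push q σ C x α = fderiv ℝ q (σ x) (C (σ x) (α.comp (fderiv ℝ q (σ x)))) := rfl

theorem smooth_push [FiniteDimensional ℝ E₀] {q : E₁ → E₀} {σ : E₀ → E₁}
    {C : E₁ → (E₁ →L[ℝ] ℝ) →L[ℝ] E₁} {U : Set E₁} {U₀ : Set E₀} (hU : IsOpen U)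
    (hq : ContDiffOn ℝ ∞ q U) (hσ : ContDiffOn ℝ ∞ σ U₀) (hm : MapsTo σ U₀ U)
    (hC : ContDiffOn ℝ ∞ C U) : ContDiffOn ℝ ∞ (push q σ C) U₀ := by
  have h1 : ContDiffOn ℝ ∞ (fun x ↦ fderiv ℝ q (σ x)) U₀ := (smoothOn_fderiv hU hq).comp hσ hm
  have h2 : ContDiffOn ℝ ∞ (fun x ↦ C (σ x)) U₀ := hC.comp hσ hm
  refine contDiffOn_clm_apply.2 fun α ↦ ?_
  exact h1.clm_apply (h2.clm_apply (contDiffOn_const.clm_comp h1))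

theorem IsMetricPair.cometric_pos {κ : E₁ → E₁ →L[ℝ] E₁ →L[ℝ] ℝ}
    {K : E₁ → (E₁ →L[ℝ] ℝ) →L[ℝ] E₁} {U : Set E₁} (H : IsMetricPair κ K U) {y : E₁} (hy : y ∈ U)
    {α : E₁ →L[ℝ] ℝ} (hα : α ≠ 0) : 0 < α (K y α) := by
  rw [← H.inner_inv hy α]
  refine H.pos y hy _ fun h0 ↦ hα ?_
  rw [← H.right_inv y hy α, h0, map_zero]

/-- The metric induced by a submersion, in coordinates: if `h` is induced by `q` from the metric `κ`,
then its cometric is the image of the cometric of `κ`. -/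
theorem isMetricPair_push [FiniteDimensional ℝ E₀] {q : E₁ → E₀} {σ : E₀ → E₁}
    {κ : E₁ → E₁ →L[ℝ] E₁ →L[ℝ] ℝ} {K : E₁ → (E₁ →L[ℝ] ℝ) →L[ℝ] E₁} {U : Set E₁} {U₀ : Set E₀}
    (H : IsMetricPair κ K U) (hq : ContDiffOn ℝ ∞ q U) (hU₀ : IsOpen U₀)
    (hσ : ContDiffOn ℝ ∞ σ U₀) (hm : MapsTo σ U₀ U) (hqσ : ∀ x ∈ U₀, q (σ x) = x)
    (hs : ∀ z ∈ U, Function.Surjective (fderiv ℝ q z)) {h : E₀ → E₀ → E₀ → ℝ}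
    (hh : ∀ z ∈ U, ∀ α β : E₀ →L[ℝ] ℝ, h (q z) (fderiv ℝ q z (K z (α.comp (fderiv ℝ q z))))
      (fderiv ℝ q z (K z (β.comp (fderiv ℝ q z))))
        = α (fderiv ℝ q z (K z (β.comp (fderiv ℝ q z))))) :
    IsMetricPair (fun x ↦ ContinuousLinearMap.inverse (push q σ K x)) (push q σ K) U₀ ∧
    (∀ x ∈ U₀, ∀ u v, h x u v = ContinuousLinearMap.inverse (push q σ K x) u v) ∧
    ∀ z ∈ U, q z ∈ U₀ → ∀ α : E₀ →L[ℝ] ℝ,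
      fderiv ℝ q z (K z (α.comp (fderiv ℝ q z))) = push q σ K (q z) α := by
  have : CompleteSpace (E₀ →L[ℝ] ℝ) := FiniteDimensional.complete ℝ _
  let L : E₁ → (E₀ →L[ℝ] ℝ) →L[ℝ] E₀ := fun z ↦
    (fderiv ℝ q z).comp ((K z).comp ((fderiv ℝ q z).precomp ℝ))
  have hL : ∀ z α, L z α = fderiv ℝ q z (K z (α.comp (fderiv ℝ q z))) := fun _ _ ↦ rfl
  have Lσ : ∀ x, push q σ K x = L (σ x) := fun _ ↦ rfl
  have Lsymm : ∀ z ∈ U, ∀ α β : E₀ →L[ℝ] ℝ, α (L z β) = β (L z α) := fun z hz α β ↦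
    H.cometric_symm hz (α.comp (fderiv ℝ q z)) (β.comp (fderiv ℝ q z))
  have Lpos : ∀ z ∈ U, ∀ α : E₀ →L[ℝ] ℝ, α ≠ 0 → 0 < α (L z α) := fun z hz α hα ↦ by
    refine H.cometric_pos hz (α := α.comp (fderiv ℝ q z)) fun h0 ↦ hα ?_
    ext w
    obtain ⟨u, rfl⟩ := hs z hz w
    exact congrArg (fun γ : E₁ →L[ℝ] ℝ ↦ γ u) h0
  have Linj : ∀ z ∈ U, Function.Injective (L z) := fun z hz ↦ by
    rw [injective_iff_map_eq_zero]
    intro α h0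
    by_contra hα
    exact (Lpos z hz α hα).ne' (by rw [h0, map_zero])
  have fr : Module.finrank ℝ (E₀ →L[ℝ] ℝ) = Module.finrank ℝ E₀ := by
    rw [← (LinearMap.toContinuousLinearMap : (E₀ →ₗ[ℝ] ℝ) ≃ₗ[ℝ] (E₀ →L[ℝ] ℝ)).finrank_eq]
    exact Subspace.dual_finrank_eq
  have Leq : ∀ z ∈ U, ∃ e : (E₀ →L[ℝ] ℝ) ≃L[ℝ] E₀, (e : (E₀ →L[ℝ] ℝ) →L[ℝ] E₀) = L z :=
    fun z hz ↦ ⟨(LinearEquiv.ofInjectiveOfFinrankEq (L z).toLinearMap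
      (Linj z hz) fr).toContinuousLinearEquiv, by ext α; rfl⟩
  have left : ∀ z ∈ U, ∀ u, L z (ContinuousLinearMap.inverse (L z) u) = u := fun z hz u ↦ by
    obtain ⟨e, he⟩ := Leq z hz
    rw [← he, ContinuousLinearMap.inverse_equiv]
    exact e.apply_symm_apply u
  have right : ∀ z ∈ U, ∀ α, ContinuousLinearMap.inverse (L z) (L z α) = α := fun z hz α ↦ by
    obtain ⟨e, he⟩ := Leq z hz
    rw [← he, ContinuousLinearMap.inverse_equiv]
    exact e.symm_apply_apply α
  have sp := smooth_push H.isOpen hq hσ hm H.smooth_inv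
  have P : IsMetricPair (fun x ↦ ContinuousLinearMap.inverse (push q σ K x)) (push q σ K) U₀ :=
    { isOpen := hU₀
      smooth := fun x hx ↦ by
        obtain ⟨e, he⟩ := Leq (σ x) (hm hx)
        have hi : ContDiffAt ℝ ∞ (ContinuousLinearMap.inverse : ((E₀ →L[ℝ] ℝ) →L[ℝ] E₀) → _)
            (push q σ K x) := by
          rw [Lσ, ← he]
          exact contDiffAt_map_inverse e
        exact hi.comp_contDiffWithinAt x (sp x hx)
      smooth_inv := sp
      symm := fun x hx u v ↦ by
        rw [Lσ]
        conv_lhs => rw [← left _ (hm hx) v]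
        conv_rhs => rw [← left _ (hm hx) u]
        exact Lsymm _ (hm hx) _ _
      pos := fun x hx u hu ↦ by
        rw [Lσ]
        conv_rhs => enter [2]; rw [← left _ (hm hx) u]
        refine Lpos _ (hm hx) _ fun h0 ↦ hu ?_
        rw [← left _ (hm hx) u, h0, map_zero]
      left_inv := fun x hx u ↦ left _ (hm hx) u
      right_inv := fun x hx α ↦ right _ (hm hx) α }
  have Q : ∀ x ∈ U₀, ∀ u v, h x u v = ContinuousLinearMap.inverse (push q σ K x) u v := by
    intro x hx u v
    have := hh (σ x) (hm hx) (ContinuousLinearMap.inverse (L (σ x)) u)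
      (ContinuousLinearMap.inverse (L (σ x)) v)
    rw [← hL, ← hL, left _ (hm hx), left _ (hm hx), hqσ x hx] at this
    exact this
  -- It remains to treat points `z` off the section. The value of `h` at `q z` does not depend on
  -- the point of the fibre, and by `hh` it inverts the pushed cometric at `z` as well as the one at
  -- `σ (q z)`; so the two cometrics agree.
  refine ⟨P, Q, fun z hz hqz α ↦ ?_⟩
  have key : ContinuousLinearMap.inverse (push q σ K (q z)) (L z α) = α := by
    ext v
    rw [← left z hz v, ← Q (q z) hqz]
    exact hh z hz α _
  rw [← hL, ← P.left_inv (q z) hqz (L z α), key]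

end Descent

end CheegerBundle

end

noncomputable section

namespace CheegerBundle

/-! ### Linear algebra of the differential of `(p, a, f) ↦ [a • p, f]` -/

section OrbitData

set_option maxSynthPendingDepth 3

variable {EP EG EF E₀ : Type*} [NormedAddCommGroup EP] [NormedSpace ℝ EP]
  [NormedAddCommGroup EG] [NormedSpace ℝ EG] [NormedAddCommGroup EF] [NormedSpace ℝ EF]
  [NormedAddCommGroup E₀] [NormedSpace ℝ E₀]

/-- An inner product and its inverse on covectors. -/
structure IsInnerPair {E : Type*} [NormedAddCommGroup E] [NormedSpace ℝ E]
    (g : E →L[ℝ] E →L[ℝ] ℝ) (J : (E →L[ℝ] ℝ) →L[ℝ] E) : Prop where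
  symm : ∀ u v, g u v = g v u
  pos : ∀ u, u ≠ 0 → 0 < g u u
  left_inv : ∀ u, J (g u) = u
  right_inv : ∀ α, g (J α) = α

namespace IsInnerPair

variable {E : Type*} [NormedAddCommGroup E] [NormedSpace ℝ E] {g : E →L[ℝ] E →L[ℝ] ℝ}
  {J : (E →L[ℝ] ℝ) →L[ℝ] E}

theorem cometric_symm (h : IsInnerPair g J) (α β : E →L[ℝ] ℝ) : α (J β) = β (J α) := by
  rw [← h.right_inv α, h.symm, h.right_inv, h.right_inv]

theorem cometric_pos (h : IsInnerPair g J) {α : E →L[ℝ] ℝ} (hα : α ≠ 0) : 0 < α (J α) := by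
  have := h.pos (J α) fun h0 ↦ hα (by rw [← h.right_inv α, h0, map_zero])
  rwa [h.right_inv] at this

theorem cometric_nonneg (h : IsInnerPair g J) (α : E →L[ℝ] ℝ) : 0 ≤ α (J α) := by
  by_cases hα : α = 0
  · simp [hα]
  · exact (h.cometric_pos hα).le

theorem eq_zero_of_cometric (h : IsInnerPair g J) {α : E →L[ℝ] ℝ} (hα : α (J α) = 0) : α = 0 := by
  by_contra h0
  exact (h.cometric_pos h0).ne' hα

theorem eq_zero (h : IsInnerPair g J) {u : E} (hu : g u u = 0) : u = 0 := by
  by_contra h0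
  exact (h.pos u h0).ne' hu

end IsInnerPair

theorem IsMetricPair.isInnerPair {E : Type*} [NormedAddCommGroup E] [NormedSpace ℝ E]
    {κ : E → E →L[ℝ] E →L[ℝ] ℝ} {K : E → (E →L[ℝ] ℝ) →L[ℝ] E} {U : Set E} {y : E}
    (H : IsMetricPair κ K U) (hy : y ∈ U) : IsInnerPair (κ y) (K y) :=
  ⟨H.symm y hy, H.pos y hy, H.left_inv y hy, H.right_inv y hy⟩

/-- The differential `T` at `(p, 1, f)` of the map `(p, a, f) ↦ [a • p, f]`, with the infinitesimal
actions `aP` and `aF` at `p` and `f`. -/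
structure IsOrbitData (T : EP × EG × EF →L[ℝ] E₀) (aP : EG →L[ℝ] EP) (aF : EG →L[ℝ] EF) :
    Prop where
  surj : Function.Surjective T
  group : ∀ u, T (0, u, 0) = T (aP u, 0, 0)
  inv : ∀ u, T (aP u, 0, aF u) = 0
  ker : ∀ x w, T (x, 0, w) = 0 → ∃ u, x = aP u ∧ w = aF u
  inj : ∀ w, T (0, 0, w) = 0 → w = 0

variable {T : EP × EG × EF →L[ℝ] E₀} {aP : EG →L[ℝ] EP} {aF : EG →L[ℝ] EF}

/-- The component of the pullback of a covector along the first factor. -/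
def coP (T : EP × EG × EF →L[ℝ] E₀) (α : E₀ →L[ℝ] ℝ) : EP →L[ℝ] ℝ :=
  (α.comp T).comp (.inl ℝ EP (EG × EF))

/-- The component of the pullback of a covector along the second factor. -/
def coG (T : EP × EG × EF →L[ℝ] E₀) (α : E₀ →L[ℝ] ℝ) : EG →L[ℝ] ℝ :=
  ((α.comp T).comp (.inr ℝ EP (EG × EF))).comp (.inl ℝ EG EF)

/-- The component of the pullback of a covector along the third factor. -/
def coF (T : EP × EG × EF →L[ℝ] E₀) (α : E₀ →L[ℝ] ℝ) : EF →L[ℝ] ℝ :=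
  ((α.comp T).comp (.inr ℝ EP (EG × EF))).comp (.inr ℝ EG EF)

theorem coP_apply (α : E₀ →L[ℝ] ℝ) (x : EP) : coP T α x = α (T (x, 0, 0)) := rfl
theorem coG_apply (α : E₀ →L[ℝ] ℝ) (x : EG) : coG T α x = α (T (0, x, 0)) := rfl
theorem coF_apply (α : E₀ →L[ℝ] ℝ) (x : EF) : coF T α x = α (T (0, 0, x)) := rfl

theorem coP_sum {ι : Type*} (s : Finset ι) (c : ι → ℝ) (α : ι → E₀ →L[ℝ] ℝ) :
    coP T (∑ i ∈ s, c i • α i) = ∑ i ∈ s, c i • coP T (α i) := by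
  ext x; simp [coP_apply, sum_apply]
theorem coG_sum {ι : Type*} (s : Finset ι) (c : ι → ℝ) (α : ι → E₀ →L[ℝ] ℝ) :
    coG T (∑ i ∈ s, c i • α i) = ∑ i ∈ s, c i • coG T (α i) := by
  ext x; simp [coG_apply, sum_apply]
theorem coF_sum {ι : Type*} (s : Finset ι) (c : ι → ℝ) (α : ι → E₀ →L[ℝ] ℝ) :
    coF T (∑ i ∈ s, c i • α i) = ∑ i ∈ s, c i • coF T (α i) := by
  ext x; simp [coF_apply, sum_apply]

/-- Moving the group element moves `p` along its orbit, and modulo the diagonal action this is a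
motion of `f` in the opposite direction. This is the source of the sign in
`IsCometricPush.limit_group`. -/
theorem IsOrbitData.fiber (h : IsOrbitData T aP aF) (u : EG) : T (0, 0, aF u) = - T (0, u, 0) := by
  have h1 := h.inv u
  have h2 : ((aP u, 0, aF u) : EP × EG × EF) = (aP u, 0, 0) + (0, 0, aF u) := by simp
  rw [h2, map_add, ← h.group] at h1
  exact eq_neg_of_add_eq_zero_right h1

theorem IsOrbitData.surjPF (h : IsOrbitData T aP aF) (v : E₀) : ∃ x w, T (x, 0, w) = v := by
  obtain ⟨⟨x, u, w⟩, rfl⟩ := h.surj v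
  refine ⟨x + aP u, w, ?_⟩
  have h1 : ((x, u, w) : EP × EG × EF) = (x, 0, w) + (0, u, 0) := by simp
  have h2 : ((x + aP u, 0, w) : EP × EG × EF) = (x, 0, w) + (aP u, 0, 0) := by simp
  rw [h1, h2, map_add, map_add, h.group]

variable {gP : EP →L[ℝ] EP →L[ℝ] ℝ} {JP : (EP →L[ℝ] ℝ) →L[ℝ] EP}
  {gG : EG →L[ℝ] EG →L[ℝ] ℝ} {JG : (EG →L[ℝ] ℝ) →L[ℝ] EG}
  {gF : EF →L[ℝ] EF →L[ℝ] ℝ} {JF : (EF →L[ℝ] ℝ) →L[ℝ] EF}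
  {A B : (E₀ →L[ℝ] ℝ) →L[ℝ] E₀}

/-- A pair of vectors orthogonal to the orbits comes from a covector. -/
theorem IsOrbitData.exists_covector [FiniteDimensional ℝ E₀]
    (h : IsOrbitData T aP aF) {xP : EP} {xF : EF} (hP : ∀ u, gP xP (aP u) = 0)
    (hF : ∀ u, gF xF (aF u) = 0) :
    ∃ α : E₀ →L[ℝ] ℝ, coP T α = gP xP ∧ coF T α = gF xF ∧ coG T α = 0 := by
  let TT : EP × EF →ₗ[ℝ] E₀ := T.toLinearMap ∘ₗ
    (LinearMap.prodMap LinearMap.id (LinearMap.inr ℝ EG EF))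
  have hTT : ∀ x w, TT (x, w) = T (x, 0, w) := fun _ _ ↦ rfl
  have sTT : Function.Surjective TT := fun v ↦ by
    obtain ⟨x, w, hv⟩ := h.surjPF v
    exact ⟨(x, w), hv⟩
  obtain ⟨S, hS⟩ := TT.exists_rightInverse_of_surjective (LinearMap.range_eq_top.2 sTT)
  let φ : EP × EF →ₗ[ℝ] ℝ := (gP xP).toLinearMap.coprod (gF xF).toLinearMap
  have hφ : ∀ x w, φ (x, w) = gP xP x + gF xF w := fun _ _ ↦ rfl
  -- The kernel of the differential consists of diagonal action vectors, to which `xP` and `xF` are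
  -- orthogonal; so the functional descends to the quotient.
  have φker : ∀ z, TT z = 0 → φ z = 0 := by
    rintro ⟨x, w⟩ hz
    obtain ⟨u, rfl, rfl⟩ := h.ker x w hz
    rw [hφ, hP, hF, add_zero]
  have φS : ∀ z, φ (S (TT z)) = φ z := fun z ↦ by
    have : TT (S (TT z) - z) = 0 := by
      rw [map_sub, sub_eq_zero]
      exact LinearMap.congr_fun hS (TT z)
    have := φker _ this
    rwa [map_sub, sub_eq_zero] at this
  let α : E₀ →L[ℝ] ℝ := (φ ∘ₗ S).toContinuousLinearMap
  have hα : ∀ x w, α (T (x, 0, w)) = gP xP x + gF xF w := fun x w ↦ φS (x, w)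
  refine ⟨α, ?_, ?_, ?_⟩
  · ext x
    have := hα x 0
    rwa [map_zero, add_zero] at this
  · ext w
    have := hα 0 w
    rwa [map_zero, zero_add] at this
  · ext u
    have := hα (aP u) 0
    rw [map_zero, add_zero, hP] at this
    rw [coG_apply, h.group, this, zero_apply]

variable {n : ℕ} {w : Module.Basis (Fin n) ℝ (E₀ →L[ℝ] ℝ)} {μ : Fin n → ℝ}

/-- The cometrics `A` and `B` are the images of the cometrics of the base factors and of the group
factor. -/
structure IsCometricPush (T : EP × EG × EF →L[ℝ] E₀) (JP : (EP →L[ℝ] ℝ) →L[ℝ] EP)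
    (JG : (EG →L[ℝ] ℝ) →L[ℝ] EG) (JF : (EF →L[ℝ] ℝ) →L[ℝ] EF)
    (A B : (E₀ →L[ℝ] ℝ) →L[ℝ] E₀) : Prop where
  base : ∀ α, A α = T (JP (coP T α), 0, JF (coF T α))
  group : ∀ α, B α = T (0, JG (coG T α), 0)

theorem IsCometricPush.apply_base (h : IsCometricPush T JP JG JF A B) (α β : E₀ →L[ℝ] ℝ) :
    α (A β) = coP T α (JP (coP T β)) + coF T α (JF (coF T β)) := by
  rw [h.base, coP_apply, coF_apply, ← map_add, ← map_add]
  simp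

theorem IsCometricPush.apply_group (h : IsCometricPush T JP JG JF A B) (α β : E₀ →L[ℝ] ℝ) :
    α (B β) = coG T α (JG (coG T β)) := by
  rw [h.group, coG_apply]

/-- The form `A` is positive definite although it omits the group factor, because the `P` and `F`
directions alone already span the target (`IsOrbitData.surjPF`). The form `B` is only semidefinite:
it vanishes on covectors that kill the orbit directions. -/
theorem IsCometricPush.exists_isDiagonalBasis [FiniteDimensional ℝ E₀]
    (h : IsCometricPush T JP JG JF A B) (hd : IsOrbitData T aP aF) (hP : IsInnerPair gP JP)
    (hG : IsInnerPair gG JG) (hF : IsInnerPair gF JF) :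
    ∃ (n : ℕ) (w : Module.Basis (Fin n) ℝ (E₀ →L[ℝ] ℝ)) (μ : Fin n → ℝ),
      IsDiagonalBasis A B w μ := by
  refine CheegerBundle.exists_isDiagonalBasis A B (fun α β ↦ ?_) (fun α β ↦ ?_) (fun α hα ↦ ?_)
    (fun α ↦ ?_)
  · rw [h.apply_base, h.apply_base, hP.cometric_symm, hF.cometric_symm]
  · rw [h.apply_group, h.apply_group, hG.cometric_symm]
  · rw [h.apply_base]
    have h1 := hP.cometric_nonneg (coP T α)
    have h2 := hF.cometric_nonneg (coF T α)
    rcases (add_nonneg h1 h2).lt_or_eq with h3 | h3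
    · exact h3
    · exfalso
      have e1 := hP.eq_zero_of_cometric (α := coP T α) (by linarith)
      have e2 := hF.eq_zero_of_cometric (α := coF T α) (by linarith)
      apply hα
      ext v
      obtain ⟨x, w, rfl⟩ := hd.surjPF v
      have : ((x, 0, w) : EP × EG × EF) = (x, 0, 0) + (0, 0, w) := by simp
      rw [this, map_add, map_add, ← coP_apply, ← coF_apply, e1, e2]
      simp
  · rw [h.apply_group]
    exact hG.cometric_nonneg _

theorem IsDiagonalBasis.covector_eq_sum (hw : IsDiagonalBasis A B w μ)
    (α : E₀ →L[ℝ] ℝ) : α = ∑ b, α (A (w b)) • w b := by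
  classical
  have h := w.sum_repr α
  have : ∀ b, α (A (w b)) = w.repr α b := fun b ↦ by
    have h0 : α (A (w b)) = (∑ i, w.repr α i • w i) (A (w b)) := by rw [h]
    rw [h0, sum_apply]
    simp only [smul_apply, hw.left, smul_eq_mul, mul_ite, mul_one, mul_zero, Finset.sum_ite_eq',
      Finset.mem_univ, if_true]
  simp only [this, h]

/-- The eigenvalue `μ a` is the squared length of the group component of `w a`, since `w a (A (w a))
= 1`. -/
theorem IsCometricPush.coG_eq_zero (h : IsCometricPush T JP JG JF A B)
    (hG : IsInnerPair gG JG) (hw : IsDiagonalBasis A B w μ) {a : Fin n} (ha : μ a = 0) :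
    coG T (w a) = 0 := by
  apply hG.eq_zero_of_cometric
  rw [← h.apply_group, hw.right, ha, zero_smul, map_zero]

/-- A covector that vanishes on the orbit directions is a combination of the basis covectors with
eigenvalue zero. -/
theorem IsCometricPush.coeff_eq_zero (h : IsCometricPush T JP JG JF A B)
    (hw : IsDiagonalBasis A B w μ) {α : E₀ →L[ℝ] ℝ} (hα : coG T α = 0)
    {b : Fin n} (hb : μ b ≠ 0) : α (A (w b)) = 0 := by
  have h1 : α (B (w b)) = 0 := by rw [h.apply_group, hα, zero_apply]
  rw [hw.right, map_smul, smul_eq_mul] at h1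
  exact (mul_eq_zero.1 h1).resolve_left hb

theorem IsCometricPush.apply_base_symm (h : IsCometricPush T JP JG JF A B)
    (hP : IsInnerPair gP JP) (hF : IsInnerPair gF JF) (α β : E₀ →L[ℝ] ℝ) : α (A β) = β (A α) := by
  rw [h.apply_base, h.apply_base, hP.cometric_symm, hF.cometric_symm]

/-- The limit of the horizontal lifts, base components. -/
theorem IsCometricPush.limit_base [FiniteDimensional ℝ E₀] (h : IsCometricPush T JP JG JF A B)
    (hd : IsOrbitData T aP aF) (hP : IsInnerPair gP JP) (hG : IsInnerPair gG JG)
    (hF : IsInnerPair gF JF) (hw : IsDiagonalBasis A B w μ) {xP : EP} {xF : EF} (U : EG)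
    (hxP : ∀ u, gP xP (aP u) = 0) (hxF : ∀ u, gF xF (aF u) = 0) :
    JP (coP T (∑ b, (if μ b = 0 then w b (T (xP, 0, xF + aF U)) else 0) • w b)) = xP ∧
    JF (coF T (∑ b, (if μ b = 0 then w b (T (xP, 0, xF + aF U)) else 0) • w b)) = xF := by
  obtain ⟨α, h1, h2, h3⟩ := hd.exists_covector hxP hxF
  have hAα : A α = T (xP, 0, xF) := by rw [h.base, h1, h2, hP.left_inv, hF.left_inv]
  -- The covector `α` with components `xP`, `xF` and no group part lies in the span of the `w b`
  -- with `μ b = 0`. On these the orbit direction `aF U` is invisible, so their values at the full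
  -- vector are exactly the coefficients of `α`.
  have key : ∑ b, (if μ b = 0 then w b (T (xP, 0, xF + aF U)) else 0) • w b = α := by
    conv_rhs => rw [hw.covector_eq_sum α]
    refine Finset.sum_congr rfl fun b _ ↦ ?_
    congr 1
    split_ifs with hb
    · have e : ((xP, 0, xF + aF U) : EP × EG × EF) = (xP, 0, xF) + (0, 0, aF U) := by simp
      rw [e, map_add, map_add, hd.fiber, map_neg, ← coG_apply, h.coG_eq_zero hG hw hb, zero_apply,
        neg_zero, add_zero, ← hAα, h.apply_base_symm hP hF]
    · exact (h.coeff_eq_zero hw h3 hb).symm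
  rw [key, h1, h2, hP.left_inv, hF.left_inv]
  exact ⟨rfl, rfl⟩

/-- The limit of the horizontal lifts, group component. -/
theorem IsCometricPush.limit_group [FiniteDimensional ℝ E₀] (h : IsCometricPush T JP JG JF A B)
    (hd : IsOrbitData T aP aF) (hP : IsInnerPair gP JP) (hG : IsInnerPair gG JG)
    (hF : IsInnerPair gF JF) (hw : IsDiagonalBasis A B w μ) {xP : EP} {xF : EF} {U : EG}
    (hxP : ∀ u, gP xP (aP u) = 0) (hxF : ∀ u, gF xF (aF u) = 0)
    (hU : ∀ u, aF u = 0 → gG U u = 0) :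
    JG (coG T (∑ b, (w b (T (xP, 0, xF + aF U)) * (μ b)⁻¹) • w b)) = -U := by
  obtain ⟨α, h1, h2, h3⟩ := hd.exists_covector hxP hxF
  have hAα : A α = T (xP, 0, xF) := by rw [h.base, h1, h2, hP.left_inv, hF.left_inv]
  set γ := ∑ b, (w b (T (xP, 0, xF + aF U)) * (μ b)⁻¹) • w b with hγ
  -- The coefficients of `γ` contain `(μ b)⁻¹`, and `B` multiplies by `μ b`. Where `μ b = 0` the
  -- inverse is `0` by convention, in agreement with `w b` vanishing on the orbit directions.
  have hBγ : B γ = - T (0, U, 0) := by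
    rw [hγ, map_sum]
    conv_rhs => rw [hw.eq_sum (-T (0, U, 0))]
    refine Finset.sum_congr rfl fun b _ ↦ ?_
    rw [map_smul, hw.right, smul_smul]
    congr 1
    rw [map_neg, ← coG_apply]
    by_cases hb : μ b = 0
    · rw [h.coG_eq_zero hG hw hb, hb]; simp
    · have e : ((xP, 0, xF + aF U) : EP × EG × EF) = (xP, 0, xF) + (0, 0, aF U) := by simp
      rw [mul_assoc, inv_mul_cancel₀ hb, mul_one, e, map_add, map_add, hd.fiber, ← hAα,
        h.apply_base_symm hP hF, h.coeff_eq_zero hw h3 hb, map_neg, ← coG_apply, zero_add]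
  -- The difference of the claimed limit and `-U` is killed by the differential, hence lies in the
  -- isotropy algebra. Both summands of `Z` are orthogonal to that algebra, so `Z` is orthogonal to
  -- itself.
  set Z := JG (coG T γ) + U with hZ
  have hTZ : T (0, Z, 0) = 0 := by
    have e : ((0, Z, 0) : EP × EG × EF) = (0, JG (coG T γ), 0) + (0, U, 0) := by simp [hZ]
    rw [e, map_add, ← h.group, hBγ, neg_add_cancel]
  have haZ : aF Z = 0 := hd.inj _ (by rw [hd.fiber, hTZ, neg_zero])
  have hZZ : gG Z Z = 0 := by
    have e1 : gG U Z = 0 := hU Z haZ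
    have e2 : gG (JG (coG T γ)) Z = 0 := by rw [hG.right_inv, coG_apply, hTZ, map_zero]
    have e3 : gG Z Z = gG (JG (coG T γ)) Z + gG U Z := by
      rw [← add_apply, ← map_add, ← hZ]
    rw [e3, e1, e2, add_zero]
  have := hG.eq_zero hZZ
  exact eq_neg_of_add_eq_zero_left (hZ ▸ this)

/-- The orthonormal frame of the pair of normal spaces given by the covectors with eigenvalue zero. -/
theorem IsCometricPush.isOrthonormalBasisOf_normal [FiniteDimensional ℝ E₀]
    (h : IsCometricPush T JP JG JF A B) (hd : IsOrbitData T aP aF) (hP : IsInnerPair gP JP)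
    (hG : IsInnerPair gG JG) (hF : IsInnerPair gF JF) (hw : IsDiagonalBasis A B w μ)
    {NP : Submodule ℝ EP} {NF : Submodule ℝ EF} (hNP : ∀ x, x ∈ NP ↔ ∀ u, gP x (aP u) = 0)
    (hNF : ∀ x, x ∈ NF ↔ ∀ u, gF x (aF u) = 0) :
    IsOrthonormalBasisOf (fun z z' : EP × EF ↦ gP z.1 z'.1 + gF z.2 z'.2) (NP.prod NF)
      (fun a : {a // μ a = 0} ↦ (JP (coP T (w a)), JF (coF T (w a)))) := by
  have inner : ∀ a b : {a // μ a = 0}, gP (JP (coP T (w a))) (JP (coP T (w b)))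
      + gF (JF (coF T (w a))) (JF (coF T (w b))) = w a (A (w b)) := fun a b ↦ by
    rw [hP.right_inv, hF.right_inv, h.apply_base]
  refine ⟨fun a ↦ ?_, fun a b hab ↦ ?_, le_antisymm ?_ ?_⟩
  · refine (inner a a).trans ?_
    rw [hw.left, if_pos rfl]
  · refine (inner a b).trans ?_
    rw [hw.left, if_neg (fun h ↦ hab (Subtype.ext h))]
  · rw [Submodule.span_le]
    rintro _ ⟨a, rfl⟩
    have e : ∀ u, w a (T (0, u, 0)) = 0 := fun u ↦ by
      rw [← coG_apply, h.coG_eq_zero hG hw a.2, zero_apply]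
    refine ⟨(hNP _).2 fun u ↦ ?_, (hNF _).2 fun u ↦ ?_⟩
    · rw [hP.right_inv, coP_apply, ← hd.group, e]
    · rw [hF.right_inv, coF_apply, hd.fiber, map_neg, e, neg_zero]
  · rintro ⟨x, y⟩ ⟨hx, hy⟩
    -- With `U = 0` the limit formula becomes the expansion of a normal pair in the frame.
    obtain ⟨e1, e2⟩ := h.limit_base hd hP hG hF hw 0 ((hNP x).1 hx) ((hNF y).1 hy)
    rw [coP_sum, map_sum] at e1
    rw [coF_sum, map_sum] at e2
    have : (x, y) = ∑ b, (if μ b = 0 then w b (T (x, 0, y + aF 0)) else 0) •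
        ((JP (coP T (w b)), JF (coF T (w b))) : EP × EF) := by
      refine Prod.ext ?_ ?_
      · rw [Prod.fst_sum]
        simp only [map_smul] at e1
        exact e1.symm
      · rw [Prod.snd_sum]
        simp only [map_smul] at e2
        exact e2.symm
    rw [this]
    refine Submodule.sum_mem _ fun b _ ↦ ?_
    by_cases hb : μ b = 0
    · exact Submodule.smul_mem _ _ (Submodule.subset_span ⟨⟨b, hb⟩, rfl⟩)
    · rw [if_neg hb, zero_smul]
      exact Submodule.zero_mem _

/-- The orthonormal frame of the complement of the isotropy algebra given by the covectors with
positive eigenvalue. -/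
theorem IsCometricPush.isOrthonormalBasisOf_isotropy [FiniteDimensional ℝ E₀]
    (h : IsCometricPush T JP JG JF A B) (hd : IsOrbitData T aP aF) (hP : IsInnerPair gP JP)
    (hG : IsInnerPair gG JG) (hF : IsInnerPair gF JF) (hw : IsDiagonalBasis A B w μ)
    {NG : Submodule ℝ EG} (hNG : ∀ x, x ∈ NG ↔ ∀ u, aF u = 0 → gG x u = 0) :
    IsOrthonormalBasisOf (fun z z' ↦ gG z z') NG
      (fun a : {a // μ a ≠ 0} ↦ (√(μ a))⁻¹ • JG (coG T (w a))) := by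
  have inner : ∀ a b : {a // μ a ≠ 0}, gG ((√(μ a))⁻¹ • JG (coG T (w a)))
      ((√(μ b))⁻¹ • JG (coG T (w b))) = (√(μ a))⁻¹ * (√(μ b))⁻¹ * (μ b * w a (A (w b))) :=
    fun a b ↦ by
      rw [map_smul, map_smul, smul_apply, hG.right_inv, ← h.apply_group, hw.right, map_smul]
      simp only [smul_eq_mul]
      ring
  refine ⟨fun a ↦ ?_, fun a b hab ↦ ?_, le_antisymm ?_ ?_⟩
  · refine (inner a a).trans ?_
    rw [hw.left, if_pos rfl, mul_one, ← mul_inv, Real.mul_self_sqrt (hw.nonneg a),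
      inv_mul_cancel₀ a.2]
  · refine (inner a b).trans ?_
    rw [hw.left, if_neg (fun h ↦ hab (Subtype.ext h)), mul_zero, mul_zero]
  · rw [Submodule.span_le]
    rintro _ ⟨a, rfl⟩
    refine NG.smul_mem _ ((hNG _).2 fun u hu ↦ ?_)
    have : T (0, u, 0) = 0 := by
      have := hd.fiber u
      rw [hu] at this
      have z : ((0, 0, 0) : EP × EG × EF) = 0 := rfl
      rw [z, map_zero] at this
      exact neg_eq_zero.1 this.symm
    rw [hG.right_inv, coG_apply, this, map_zero]
  · intro x hx
    -- With vanishing normal components the limit formula expands `-x` in the frame.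
    have e := h.limit_group hd hP hG hF hw (xP := 0) (xF := 0) (by simp) (by simp) ((hNG x).1 hx)
    rw [coG_sum, map_sum] at e
    rw [← neg_neg x, ← e]
    refine Submodule.neg_mem _ (Submodule.sum_mem _ fun b _ ↦ ?_)
    rw [map_smul]
    by_cases hb : μ b = 0
    · rw [h.coG_eq_zero hG hw hb, map_zero, smul_zero]
      exact Submodule.zero_mem _
    · refine Submodule.smul_mem _ _ ?_
      have hs : √(μ b) ≠ 0 := Real.sqrt_ne_zero'.2 (lt_of_le_of_ne (hw.nonneg b) (Ne.symm hb))
      have e2 : JG (coG T (w b)) = √(μ b) • ((√(μ b))⁻¹ • JG (coG T (w b))) := by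
        rw [smul_smul, mul_inv_cancel₀ hs, one_smul]
      rw [e2]
      exact Submodule.smul_mem _ _ (Submodule.subset_span ⟨⟨b, hb⟩, rfl⟩)

end OrbitData

end CheegerBundle

end

noncomputable section

namespace CheegerBundle

/-! ### The coordinate theorem: rationality and the limiting lower bound -/

section CoordinateTheorem

set_option maxSynthPendingDepth 3

set_option linter.unusedSectionVars false

variable {EP EG EF E₀ : Type*} [NormedAddCommGroup EP] [NormedSpace ℝ EP] [FiniteDimensional ℝ EP]
  [NormedAddCommGroup EG] [NormedSpace ℝ EG] [FiniteDimensional ℝ EG]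
  [NormedAddCommGroup EF] [NormedSpace ℝ EF] [FiniteDimensional ℝ EF]
  [NormedAddCommGroup E₀] [NormedSpace ℝ E₀] [FiniteDimensional ℝ E₀]

theorem tendsto_inv_linear {μ : ℝ} (hμ : 0 ≤ μ) :
    Tendsto (fun t : ℝ ↦ (1 + μ * t)⁻¹) atTop (𝓝 (if μ = 0 then 1 else 0)) := by
  split_ifs with h
  · simp [h]
  · have hpos : 0 < μ := lt_of_le_of_ne hμ (Ne.symm h)
    exact tendsto_inv_atTop_zero.comp
      (tendsto_atTop_add_const_left _ _ (tendsto_id.const_mul_atTop hpos))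

theorem tendsto_mul_inv_linear {μ : ℝ} (hμ : 0 < μ) :
    Tendsto (fun t : ℝ ↦ t * (1 + μ * t)⁻¹) atTop (𝓝 μ⁻¹) := by
  have h1 : Tendsto (fun t : ℝ ↦ (t⁻¹ + μ)⁻¹) atTop (𝓝 (0 + μ)⁻¹) :=
    (tendsto_inv_atTop_zero.add_const μ).inv₀ (by simpa using hμ.ne')
  rw [zero_add] at h1
  refine h1.congr' ?_
  filter_upwards [eventually_gt_atTop 0] with t ht
  have : 1 + μ * t ≠ 0 := by positivity
  have : t⁻¹ + μ ≠ 0 := by positivity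
  field_simp

variable {κP : EP → EP →L[ℝ] EP →L[ℝ] ℝ} {KP : EP → (EP →L[ℝ] ℝ) →L[ℝ] EP} {UP : Set EP}
  {kP : EP → EP → EP → ℝ}
  {κG : EG → EG →L[ℝ] EG →L[ℝ] ℝ} {KG : EG → (EG →L[ℝ] ℝ) →L[ℝ] EG} {UG : Set EG}
  {kG : EG → EG → EG → ℝ}
  {κF : EF → EF →L[ℝ] EF →L[ℝ] ℝ} {KF : EF → (EF →L[ℝ] ℝ) →L[ℝ] EF} {UF : Set EF}
  {kF : EF → EF → EF → ℝ}

/-- The cometric of the product of `κP`, `t⁻¹ κG` and `κF`. -/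
def totalCoform (KP : EP → (EP →L[ℝ] ℝ) →L[ℝ] EP) (KG : EG → (EG →L[ℝ] ℝ) →L[ℝ] EG)
    (KF : EF → (EF →L[ℝ] ℝ) →L[ℝ] EF) (t : ℝ) :
    EP × EG × EF → ((EP × EG × EF) →L[ℝ] ℝ) →L[ℝ] EP × EG × EF :=
  prodCoform KP (prodCoform (fun x ↦ t • KG x) KF)

/-- The product of `κP`, `t⁻¹ κG` and `κF`. -/
def totalForm (κP : EP → EP →L[ℝ] EP →L[ℝ] ℝ) (κG : EG → EG →L[ℝ] EG →L[ℝ] ℝ)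
    (κF : EF → EF →L[ℝ] EF →L[ℝ] ℝ) (t : ℝ) :
    EP × EG × EF → (EP × EG × EF) →L[ℝ] (EP × EG × EF) →L[ℝ] ℝ :=
  prodForm κP (prodForm (fun x ↦ t⁻¹ • κG x) κF)

theorem isMetricPair_total (HP : IsMetricPair κP KP UP) (HG : IsMetricPair κG KG UG)
    (HF : IsMetricPair κF KF UF) {t : ℝ} (ht : 0 < t) :
    IsMetricPair (totalForm κP κG κF t) (totalCoform KP KG KF t) (UP ×ˢ UG ×ˢ UF) := by
  have h := HG.const_smul (inv_pos.2 ht)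
  rw [inv_inv] at h
  exact HP.prod (h.prod HF)

theorem sec_total (HP : IsMetricPair κP KP UP) (HG : IsMetricPair κG KG UG)
    (HF : IsMetricPair κF KF UF) (hkP : ∀ y ∈ UP, ∀ u v, kP y u v = κP y u v)
    (hkG : ∀ y ∈ UG, ∀ u v, kG y u v = κG y u v) (hkF : ∀ y ∈ UF, ∀ u v, kF y u v = κF y u v)
    {t : ℝ} (ht : 0 < t) {z : EP × EG × EF} (hz : z ∈ UP ×ˢ UG ×ˢ UF) (u v : EP × EG × EF) :
    sec (fun z u v ↦ totalForm κP κG κF t z u v) z u v = sec kP z.1 u.1 v.1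
      + (t⁻¹ * sec kG z.2.1 u.2.1 v.2.1 + sec kF z.2.2 u.2.2 v.2.2) := by
  have h := HG.const_smul (inv_pos.2 ht)
  have e := HP.sec_prod (h.prod HF) hkP
    (k' := fun z u v ↦ prodForm (fun x ↦ t⁻¹ • κG x) κF z u v)
    (kk := fun z u v ↦ totalForm κP κG κF t z u v)
    (fun _ _ _ _ ↦ rfl) (fun _ _ _ _ ↦ rfl) hz u v
  rw [e, h.sec_prod HF (k := fun y u v ↦ t⁻¹ * kG y u v) (k' := kF)
      (fun y hy u v ↦ by rw [hkG y hy]; rfl) hkF (fun _ _ _ _ ↦ rfl) hz.2,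
    sec_const_mul kG (inv_pos.2 ht).ne']

/-- The fixed part of the total cometric. -/
def baseCoform (KP : EP → (EP →L[ℝ] ℝ) →L[ℝ] EP) (KF : EF → (EF →L[ℝ] ℝ) →L[ℝ] EF) :
    EP × EG × EF → ((EP × EG × EF) →L[ℝ] ℝ) →L[ℝ] EP × EG × EF :=
  prodCoform KP (prodCoform (fun _ ↦ 0) KF)

/-- The part of the total cometric that is scaled by the parameter. -/
def groupCoform (KG : EG → (EG →L[ℝ] ℝ) →L[ℝ] EG) :
    EP × EG × EF → ((EP × EG × EF) →L[ℝ] ℝ) →L[ℝ] EP × EG × EF :=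
  prodCoform (fun _ ↦ 0) (prodCoform KG (fun _ ↦ 0))

theorem smooth_prodCoform {E E' : Type*} [NormedAddCommGroup E] [NormedSpace ℝ E]
    [FiniteDimensional ℝ E] [NormedAddCommGroup E'] [NormedSpace ℝ E'] [FiniteDimensional ℝ E']
    {K : E → (E →L[ℝ] ℝ) →L[ℝ] E} {K' : E' → (E' →L[ℝ] ℝ) →L[ℝ] E'} {U : Set E} {U' : Set E'}
    (hK : ContDiffOn ℝ ∞ K U) (hK' : ContDiffOn ℝ ∞ K' U') :
    ContDiffOn ℝ ∞ (prodCoform K K') (U ×ˢ U') := by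
  have h1 : ContDiffOn ℝ ∞ (fun z : E × E' ↦ K z.1) (U ×ˢ U') :=
    hK.comp contDiffOn_fst fun z hz ↦ hz.1
  have h2 : ContDiffOn ℝ ∞ (fun z : E × E' ↦ K' z.2) (U ×ˢ U') :=
    hK'.comp contDiffOn_snd fun z hz ↦ hz.2
  refine contDiffOn_clm_apply.2 fun α ↦ ?_
  exact (h1.clm_apply contDiffOn_const).prodMk (h2.clm_apply contDiffOn_const)

theorem totalCoform_eq (t : ℝ) (z : EP × EG × EF) (α : (EP × EG × EF) →L[ℝ] ℝ) :
    totalCoform KP KG KF t z α = baseCoform KP KF z α + t • groupCoform KG z α := by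
  simp [totalCoform, baseCoform, groupCoform]

/-- The family is affine in `t` because the metric is scaled by `t⁻¹` on the group and its cometric
by `t`. This is the form required by `isRat_ricci`. -/
theorem push_total_eq (q : EP × EG × EF → E₀) (σ : E₀ → EP × EG × EF) (t : ℝ) :
    push q σ (totalCoform KP KG KF t)
      = fun x ↦ push q σ (baseCoform KP KF) x + t • push q σ (groupCoform KG) x := by
  funext x
  ext α
  simp only [push_apply, totalCoform_eq, map_add, map_smul, add_apply, smul_apply]

theorem isCometricPush_push (q : EP × EG × EF → E₀) (σ : E₀ → EP × EG × EF)
    {y : EP × EG × EF} {x : E₀} (hσ : σ x = y) :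
    IsCometricPush (fderiv ℝ q y) (KP y.1) (KG y.2.1) (KF y.2.2) (push q σ (baseCoform KP KF) x)
      (push q σ (groupCoform KG) x) where
  base α := by
    rw [push_apply, hσ]
    rfl
  group α := by
    rw [push_apply, hσ]
    rfl

variable {q : EP × EG × EF → E₀} {U : Set (EP × EG × EF)} {y : EP × EG × EF}
  {h : ℝ → E₀ → E₀ → E₀ → ℝ} {aP : EG →L[ℝ] EP} {aF : EG →L[ℝ] EF}

/-- The limit of the lower bounds for the Ricci curvature, computed in adapted orthonormal frames. -/
theorem sum_limits_eq {n : ℕ} {w : Module.Basis (Fin n) ℝ (E₀ →L[ℝ] ℝ)} {μ : Fin n → ℝ}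
    {T : EP × EG × EF →L[ℝ] E₀} {A B : (E₀ →L[ℝ] ℝ) →L[ℝ] E₀}
    (HP : IsMetricPair κP KP UP) (HG : IsMetricPair κG KG UG)
    (HF : IsMetricPair κF KF UF) (hkP : ∀ y ∈ UP, ∀ u v, kP y u v = κP y u v)
    (hkG : ∀ y ∈ UG, ∀ u v, kG y u v = κG y u v) (hkF : ∀ y ∈ UF, ∀ u v, kF y u v = κF y u v)
    (hyP : y.1 ∈ UP) (hyG : y.2.1 ∈ UG) (hyF : y.2.2 ∈ UF)
    (hd : IsOrbitData T aP aF) (hc : IsCometricPush T (KP y.1) (KG y.2.1) (KF y.2.2) A B)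
    (hw : IsDiagonalBasis A B w μ)
    {NP : Submodule ℝ EP} {NF : Submodule ℝ EF} {NG : Submodule ℝ EG}
    (hNP : ∀ x, x ∈ NP ↔ ∀ u, κP y.1 x (aP u) = 0) (hNF : ∀ x, x ∈ NF ↔ ∀ u, κF y.2.2 x (aF u) = 0)
    (hNG : ∀ x, x ∈ NG ↔ ∀ u, aF u = 0 → κG y.2.1 x u = 0)
    {ιP ιF ιG : Type*} [Fintype ιP] [Fintype ιF] [Fintype ιG]
    {eP : ιP → EP} (heP : IsOrthonormalBasisOf (fun u v ↦ κP y.1 u v) NP eP)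
    {eF : ιF → EF} (heF : IsOrthonormalBasisOf (fun u v ↦ κF y.2.2 u v) NF eF)
    {eG : ιG → EG} (heG : IsOrthonormalBasisOf (fun u v ↦ κG y.2.1 u v) NG eG)
    (xP : EP) (xF : EF) (Z : EG) :
    ∑ a, ((if μ a = 0 then 1 else 0) * (sec kP y.1 xP (KP y.1 (coP T (w a)))
        + sec kF y.2.2 xF (KF y.2.2 (coF T (w a))))
        + (μ a)⁻¹ * sec kG y.2.1 Z (KG y.2.1 (coG T (w a))))
      = ∑ i, sec kP y.1 xP (eP i) + ∑ i, sec kF y.2.2 xF (eF i) + ∑ i, sec kG y.2.1 Z (eG i) := by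
  classical
  have iP := HP.isInnerPair hyP
  have iG := HG.isInnerPair hyG
  have iF := HF.isInnerPair hyF
  obtain ⟨BP, hBP⟩ := HP.sec_eq_bilin_right hkP hyP xP
  obtain ⟨BF, hBF⟩ := HF.sec_eq_bilin_right hkF hyF xF
  obtain ⟨BG, hBG⟩ := HG.sec_eq_bilin_right hkG hyG Z
  rw [Finset.sum_add_distrib]
  congr 1
  -- Single covectors with eigenvalue zero mix `P` and `F`, but together they form an orthonormal
  -- basis of the product of the normal spaces. The union of `eP` and `eF` is another one, and the
  -- two traces coincide.
  · have on1 := hc.isOrthonormalBasisOf_normal hd iP iG iF hw hNP hNF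
    have on2 : IsOrthonormalBasisOf
        (fun z z' : EP × EF ↦ κP y.1 z.1 z'.1 + κF y.2.2 z.2 z'.2) (NP.prod NF)
        (Sum.elim (fun i ↦ (eP i, 0)) (fun i ↦ (0, eF i))) := by
      refine ⟨?_, ?_, ?_⟩
      · rintro (i | i)
        · simpa using heP.1 i
        · simpa using heF.1 i
      · rintro (i | i) (j | j) hij
        · simpa using heP.2.1 i j (fun h ↦ hij (by rw [h]))
        · simp
        · simp
        · simpa using heF.2.1 i j (fun h ↦ hij (by rw [h]))
      · rw [Set.Sum.elim_range, Submodule.span_union, LinearMap.prod_eq_sup_map]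
        congr 1
        · rw [← heP.2.2, Submodule.map_span, ← range_comp]
          rfl
        · rw [← heF.2.2, Submodule.map_span, ← range_comp]
          rfl
    let β : (EP × EF) →ₗ[ℝ] (EP × EF) →ₗ[ℝ] ℝ :=
      LinearMap.mk₂ ℝ (fun z z' ↦ κP y.1 z.1 z'.1 + κF y.2.2 z.2 z'.2)
        (fun a b c ↦ by simp; ring) (fun a b c ↦ by simp; ring)
        (fun a b c ↦ by simp; ring) (fun a b c ↦ by simp; ring)
    let BB : (EP × EF) →ₗ[ℝ] (EP × EF) →ₗ[ℝ] ℝ :=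
      LinearMap.mk₂ ℝ (fun z z' ↦ BP z.1 z'.1 + BF z.2 z'.2)
        (fun a b c ↦ by simp; ring) (fun a b c ↦ by simp; ring)
        (fun a b c ↦ by simp; ring) (fun a b c ↦ by simp; ring)
    have hBB : ∀ z z', BB z z' = BP z.1 z'.1 + BF z.2 z'.2 := fun _ _ ↦ rfl
    have tr := on1.sum_eq (β := β) (fun _ _ ↦ rfl)
      (fun u v ↦ by
        change κP y.1 u.1 v.1 + κF y.2.2 u.2 v.2 = κP y.1 v.1 u.1 + κF y.2.2 v.2 u.2
        rw [iP.symm, iF.symm]) on2 BB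
    rw [Fintype.sum_sum_type] at tr
    simp only [hBB, Sum.elim_inl, Sum.elim_inr, map_zero, add_zero, zero_add] at tr
    simp only [hBP, hBF]
    rw [← tr]
    simp only [ite_mul, one_mul, zero_mul]
    rw [← Finset.sum_filter]
    exact (Finset.sum_subtype (p := fun a ↦ μ a = 0) _ (by simp) _)
  · have on1 := hc.isOrthonormalBasisOf_isotropy hd iP iG iF hw hNG
    let β : EG →ₗ[ℝ] EG →ₗ[ℝ] ℝ :=
      LinearMap.mk₂ ℝ (fun z z' ↦ κG y.2.1 z z')
        (fun a b c ↦ by simp) (fun a b c ↦ by simp)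
        (fun a b c ↦ by simp) (fun a b c ↦ by simp)
    have tr := on1.sum_eq (β := β) (fun _ _ ↦ rfl) (fun u v ↦ iG.symm u v) heG BG
    simp only [hBG]
    rw [← tr]
    -- The weight `(μ a)⁻¹` normalizes the group component of `w a`, whose squared length is `μ a`.
    -- For `μ a = 0` the convention `0⁻¹ = 0` removes the term.
    have e : ∀ a, (μ a)⁻¹ * BG (KG y.2.1 (coG T (w a))) (KG y.2.1 (coG T (w a)))
        = if μ a ≠ 0 then BG ((√(μ a))⁻¹ • KG y.2.1 (coG T (w a)))
          ((√(μ a))⁻¹ • KG y.2.1 (coG T (w a))) else 0 := by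
      intro a
      split_ifs with ha
      · rw [map_smul, map_smul, LinearMap.smul_apply, smul_smul, ← mul_inv,
          Real.mul_self_sqrt (hw.nonneg a), smul_eq_mul]
      · rw [not_ne_iff] at ha
        rw [ha]; simp
    simp only [e]
    rw [← Finset.sum_filter]
    exact (Finset.sum_subtype (p := fun a ↦ μ a ≠ 0) _ (by simp) _)

/-- The coordinate form of the main theorem. -/
theorem exists_tendsto_ricci_coord (HP : IsMetricPair κP KP UP) (HG : IsMetricPair κG KG UG)
    (HF : IsMetricPair κF KF UF) (hkP : ∀ y ∈ UP, ∀ u v, kP y u v = κP y u v)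
    (hkG : ∀ y ∈ UG, ∀ u v, kG y u v = κG y u v) (hkF : ∀ y ∈ UF, ∀ u v, kF y u v = κF y u v)
    (hU : IsOpen U) (hUs : U ⊆ UP ×ˢ UG ×ˢ UF) (hq : ContDiffOn ℝ ∞ q U) (hy : y ∈ U)
    (hs : ∀ z ∈ U, Function.Surjective (fderiv ℝ q z))
    (hh : ∀ t, 0 < t → ∀ z ∈ U, ∀ α β : E₀ →L[ℝ] ℝ,
      h t (q z) (fderiv ℝ q z (totalCoform KP KG KF t z (α.comp (fderiv ℝ q z))))
        (fderiv ℝ q z (totalCoform KP KG KF t z (β.comp (fderiv ℝ q z))))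
        = α (fderiv ℝ q z (totalCoform KP KG KF t z (β.comp (fderiv ℝ q z)))))
    (hd : IsOrbitData (fderiv ℝ q y) aP aF)
    {NP : Submodule ℝ EP} {NF : Submodule ℝ EF} {NG : Submodule ℝ EG}
    (hNP : ∀ x, x ∈ NP ↔ ∀ u, κP y.1 x (aP u) = 0) (hNF : ∀ x, x ∈ NF ↔ ∀ u, κF y.2.2 x (aF u) = 0)
    (hNG : ∀ x, x ∈ NG ↔ ∀ u, aF u = 0 → κG y.2.1 x u = 0)
    {ιP ιF ιG : Type*} [Fintype ιP] [Fintype ιF] [Fintype ιG]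
    {eP : ιP → EP} (heP : IsOrthonormalBasisOf (fun u v ↦ κP y.1 u v) NP eP)
    {eF : ιF → EF} (heF : IsOrthonormalBasisOf (fun u v ↦ κF y.2.2 u v) NF eF)
    {eG : ιG → EG} (heG : IsOrthonormalBasisOf (fun u v ↦ κG y.2.1 u v) NG eG)
    {xP : EP} (hxP : xP ∈ NP) {xF : EF} (hxF : xF ∈ NF) {Z : EG} (hZ : Z ∈ NG) {ric : ℝ → ℝ}
    (hric : ∀ t, 0 < t → (∃ (n : ℕ) (e : Fin n → E₀), IsOrthonormalBasisOf (h t (q y)) ⊤ e) →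
      ∃ (n : ℕ) (e : Fin n → E₀), IsOrthonormalBasisOf (h t (q y)) ⊤ e ∧
        ric t = ∑ i, sec (h t) (q y) (fderiv ℝ q y (xP, 0, xF + aF Z)) (e i)) :
    ∃ L : EReal, Tendsto (fun t ↦ ((ric t : ℝ) : EReal)) atTop (𝓝 L) ∧
      ((∑ i, sec kP y.1 xP (eP i) + ∑ i, sec kF y.2.2 xF (eF i)
        + ∑ i, sec kG y.2.1 Z (eG i) : ℝ) : EReal) ≤ L := by
  classical
  obtain ⟨hyP, hyG, hyF⟩ := hUs hy
  have iP := HP.isInnerPair hyP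
  have iG := HG.isInnerPair hyG
  have iF := HF.isInnerPair hyF
  set T := fderiv ℝ q y with hT
  set v := T (xP, 0, xF + aF Z) with hv
  obtain ⟨U₀, σ, hU₀, hy₀, sσ, mσ, hqσ, hσy⟩ := exists_smooth_section hU hq hy (hs y hy)
  set A := push q σ (baseCoform KP KF) with hA
  set B := push q σ (groupCoform KG) with hB
  have sA : ContDiffOn ℝ ∞ A U₀ := smooth_push hU hq sσ mσ
    ((smooth_prodCoform HP.smooth_inv
      (smooth_prodCoform (U := UG) contDiffOn_const HF.smooth_inv)).mono hUs)
  have sB : ContDiffOn ℝ ∞ B U₀ := smooth_push hU hq sσ mσ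
    ((smooth_prodCoform (U := UP) contDiffOn_const
      (smooth_prodCoform (U' := UF) HG.smooth_inv contDiffOn_const)).mono hUs)
  have H1 : ∀ t, 0 < t → IsMetricPair (totalForm κP κG κF t) (totalCoform KP KG KF t) U :=
    fun t ht ↦ (isMetricPair_total HP HG HF ht).mono hU hUs
  let κ₀ : ℝ → E₀ → E₀ →L[ℝ] E₀ →L[ℝ] ℝ := fun t x ↦ ContinuousLinearMap.inverse (A x + t • B x)
  have desc := fun t ht ↦ isMetricPair_push (H1 t ht) hq hU₀ sσ mσ hqσ hs (hh t ht)
  simp only [push_total_eq] at desc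
  have H0 : ∀ t, 0 < t → IsMetricPair (κ₀ t) (fun x ↦ A x + t • B x) U₀ := fun t ht ↦ (desc t ht).1
  have hk0 : ∀ t, 0 < t → ∀ x ∈ U₀, ∀ u v, h t x u v = κ₀ t x u v := fun t ht ↦ (desc t ht).2.1
  have hc : IsCometricPush T (KP y.1) (KG y.2.1) (KF y.2.2) (A (q y)) (B (q y)) :=
    isCometricPush_push q σ hσy
  obtain ⟨n, w, μ, hw⟩ := hc.exists_isDiagonalBasis hd iP iG iF
  have pos : ∀ t : ℝ, 0 < t → ∀ a, 0 < 1 + μ a * t := fun t ht a ↦ by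
    have := hw.nonneg a
    positivity
  have eA : ∀ t : ℝ, 0 < t → ∀ a, A (q y) (w a)
      = (1 + μ a * t)⁻¹ • (A (q y) + t • B (q y)) (w a) := fun t ht a ↦ by
    rw [hw.family_apply, smul_smul, inv_mul_cancel₀ (pos t ht a).ne', one_smul]
  -- the Ricci curvature in the diagonal frame
  have ric_eq : ∀ t, 0 < t → ric t
      = ∑ a, (1 + μ a * t) * sec (h t) (q y) v (A (q y) (w a)) := by
    intro t ht
    -- The vector `A (w a)` is `(1 + μ a t)⁻¹` times the dual of `w a` for `A + tB`, so its squared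
    -- length is `(1 + μ a t)⁻¹`.
    have on : IsOrthonormalBasisOf (h t (q y)) ⊤ (fun a ↦ √(1 + μ a * t) • A (q y) (w a)) := by
      have inner : ∀ a b, h t (q y) (√(1 + μ a * t) • A (q y) (w a))
          (√(1 + μ b * t) • A (q y) (w b))
          = √(1 + μ a * t) * √(1 + μ b * t) * ((1 + μ a * t)⁻¹ * if a = b then 1 else 0) := by
        intro a b
        rw [hk0 t ht _ hy₀, map_smul, map_smul, smul_apply, eA t ht a, map_smul, smul_apply,
          (H0 t ht).inner_inv hy₀, hw.left]
        simp only [smul_eq_mul]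
        ring
      refine ⟨fun a ↦ ?_, fun a b hab ↦ ?_, ?_⟩
      · rw [inner, if_pos rfl, mul_one, Real.mul_self_sqrt (pos t ht a).le,
          mul_inv_cancel₀ (pos t ht a).ne']
      · rw [inner, if_neg hab, mul_zero, mul_zero]
      · refine eq_top_iff.2 fun x _ ↦ ?_
        rw [hw.eq_sum x]
        refine Submodule.sum_mem _ fun a _ ↦ Submodule.smul_mem _ _ ?_
        have e : A (q y) (w a) = (√(1 + μ a * t))⁻¹ • (√(1 + μ a * t) • A (q y) (w a)) := by
          rw [smul_smul, inv_mul_cancel₀ (Real.sqrt_ne_zero'.2 (pos t ht a)), one_smul]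
        rw [e]
        exact Submodule.smul_mem _ _ (Submodule.subset_span ⟨a, rfl⟩)
    -- The Ricci curvature is computed in some unspecified orthonormal basis, provided that one
    -- exists. The frame just found supplies existence, and invariance of the trace moves the sum to
    -- it.
    obtain ⟨n', e', he', hr⟩ := hric t ht ⟨n, _, on⟩
    obtain ⟨B', hB'⟩ := (H0 t ht).sec_eq_bilin_right (hk0 t ht) hy₀ v
    let β : E₀ →ₗ[ℝ] E₀ →ₗ[ℝ] ℝ := LinearMap.mk₂ ℝ (fun z z' ↦ κ₀ t (q y) z z')
      (fun a b c ↦ by simp) (fun a b c ↦ by simp) (fun a b c ↦ by simp) (fun a b c ↦ by simp)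
    have tr := he'.sum_eq (β := β) (hk0 t ht _ hy₀) (fun u v ↦ (H0 t ht).symm _ hy₀ u v) on B'
    simp only [← hB'] at tr
    rw [hr, tr]
    refine Finset.sum_congr rfl fun a _ ↦ ?_
    rw [(H0 t ht).sec_smul_right (hk0 t ht) hy₀, Real.sq_sqrt (pos t ht a).le]
  have rat : IsRat ric := (isRat_ricci hU₀ sA sB H0 hk0 hy₀ hw v).congr
    (by filter_upwards [eventually_gt_atTop 0] with t ht using ric_eq t ht)
  obtain ⟨L, hL⟩ := rat.exists_tendsto
  refine ⟨L, hL, ?_⟩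
  -- the lower bound
  set s : Fin n → ℝ → ℝ := fun b t ↦ w b v * (1 + μ b * t)⁻¹ with hsdef
  -- This covector is dual to `v` for `A + tB`, so the lift of `v` has components `KP (coP T (α
  -- t))`, `t • KG (coG T (α t))` and `KF (coF T (α t))`. The group component of `α t` itself tends
  -- to zero; multiplied by `t`, as in `αG`, it converges.
  let α : ℝ → E₀ →L[ℝ] ℝ := fun t ↦ ∑ b, s b t • w b
  let αG : ℝ → E₀ →L[ℝ] ℝ := fun t ↦ ∑ b, (t * s b t) • w b
  have hαG : ∀ t, KG y.2.1 (coG T (αG t)) = t • KG y.2.1 (coG T (α t)) := fun t ↦ by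
    simp only [αG, α, coG_sum, map_sum, map_smul, Finset.smul_sum, smul_smul]
  have hα : ∀ t, 0 < t → (A (q y) + t • B (q y)) (α t) = v := fun t ht ↦ by
    conv_rhs => rw [hw.eq_sum v]
    rw [map_sum]
    refine Finset.sum_congr rfl fun b _ ↦ ?_
    rw [map_smul, eA t ht b, smul_smul]
  -- The curvature of the lifts of `v` and of the dual of `w a` in the product, divided by `1 + μ a
  -- t` to match the normalization of the frame. In the group term the factor `t⁻¹` of the metric
  -- and the factor `t²` from the lift of `w a` leave one `t`; the factor `t` in the lift of `v`
  -- goes into `αG`.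
  let lo : Fin n → ℝ → ℝ := fun a t ↦ (1 + μ a * t)⁻¹ *
      (sec kP y.1 (KP y.1 (coP T (α t))) (KP y.1 (coP T (w a)))
        + sec kF y.2.2 (KF y.2.2 (coF T (α t))) (KF y.2.2 (coF T (w a))))
    + (t * (1 + μ a * t)⁻¹) * sec kG y.2.1 (KG y.2.1 (coG T (αG t))) (KG y.2.1 (coG T (w a)))
  have lo_le : ∀ t, 0 < t → ∀ a, lo a t ≤ (1 + μ a * t) * sec (h t) (q y) v (A (q y) (w a)) := by
    intro t ht a
    have hop : IsOpen (U ∩ q ⁻¹' U₀) := hq.continuousOn.isOpen_inter_preimage hU hU₀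
    have on := sec_le_of_submersion (k := fun z u v ↦ totalForm κP κG κF t z u v) (k' := h t)
      ((H1 t ht).mono hop inter_subset_left) (H0 t ht) (fun _ _ _ _ ↦ rfl) (hk0 t ht)
      (hq.mono inter_subset_left) (fun z hz ↦ hz.2)
      (fun z hz γ ↦ (desc t ht).2.2 z hz.1 hz.2 γ) ⟨hy, hy₀⟩ (α t) (w a)
    rw [sec_total HP HG HF hkP hkG hkF ht (hUs hy), hα t ht, hw.family_apply,
      (H0 t ht).sec_smul_right (hk0 t ht) hy₀] at on
    have e1 : ∀ γ : E₀ →L[ℝ] ℝ, totalCoform KP KG KF t y (γ.comp T)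
        = (KP y.1 (coP T γ), t • KG y.2.1 (coG T γ), KF y.2.2 (coF T γ)) := fun γ ↦ rfl
    rw [e1, e1] at on
    simp only [] at on
    rw [← hαG, HG.sec_smul_right hkG hyG] at on
    have p := pos t ht a
    have e2 : lo a t = (1 + μ a * t)⁻¹ *
        (sec kP y.1 (KP y.1 (coP T (α t))) (KP y.1 (coP T (w a)))
        + (t⁻¹ * (t ^ 2 * sec kG y.2.1 (KG y.2.1 (coG T (αG t))) (KG y.2.1 (coG T (w a))))
        + sec kF y.2.2 (KF y.2.2 (coF T (α t))) (KF y.2.2 (coF T (w a))))) := by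
      have : t⁻¹ * t ^ 2 = t := by field_simp
      rw [← mul_assoc t⁻¹, this]
      ring
    rw [e2]
    calc _ ≤ (1 + μ a * t)⁻¹ * ((1 + μ a * t) ^ 2 * sec (h t) (q y) v (A (q y) (w a))) :=
          mul_le_mul_of_nonneg_left on (inv_pos.2 p).le
      _ = _ := by field_simp
  have hv' : ∀ b, w b v = w b (T (xP, 0, xF + aF Z)) := fun _ ↦ rfl
  obtain ⟨lP, lF⟩ := hc.limit_base hd iP iG iF hw Z ((hNP xP).1 hxP) ((hNF xF).1 hxF)
  have lG := hc.limit_group hd iP iG iF hw ((hNP xP).1 hxP) ((hNF xF).1 hxF) ((hNG Z).1 hZ)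
  have ts : ∀ b, Tendsto (s b) atTop (𝓝 (if μ b = 0 then w b (T (xP, 0, xF + aF Z)) else 0)) := by
    intro b
    have := (tendsto_inv_linear (hw.nonneg b)).const_mul (w b v)
    simpa [hv] using this
  have tP : Tendsto (fun t ↦ KP y.1 (coP T (α t))) atTop (𝓝 xP) := by
    rw [← lP]
    simp only [α, coP_sum, map_sum, map_smul]
    exact tendsto_finsetSum _ fun b _ ↦ (ts b).smul_const _
  have tF : Tendsto (fun t ↦ KF y.2.2 (coF T (α t))) atTop (𝓝 xF) := by
    rw [← lF]
    simp only [α, coF_sum, map_sum, map_smul]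
    exact tendsto_finsetSum _ fun b _ ↦ (ts b).smul_const _
  have tG : Tendsto (fun t ↦ KG y.2.1 (coG T (αG t))) atTop (𝓝 (-Z)) := by
    rw [← lG]
    simp only [αG, coG_sum, map_sum, map_smul]
    refine tendsto_finsetSum _ fun b _ ↦ ?_
    by_cases hb : μ b = 0
    · simp [hc.coG_eq_zero iG hw hb]
    · have hpos : 0 < μ b := lt_of_le_of_ne (hw.nonneg b) (Ne.symm hb)
      have := (tendsto_mul_inv_linear hpos).const_mul (w b v)
      refine Tendsto.smul_const ?_ _
      refine this.congr fun t ↦ ?_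
      simp only [hsdef]
      ring
  have tlo : ∀ a, Tendsto (lo a) atTop (𝓝 ((if μ a = 0 then 1 else 0)
      * (sec kP y.1 xP (KP y.1 (coP T (w a))) + sec kF y.2.2 xF (KF y.2.2 (coF T (w a))))
      + (μ a)⁻¹ * sec kG y.2.1 Z (KG y.2.1 (coG T (w a))))) := by
    intro a
    refine Tendsto.add ((tendsto_inv_linear (hw.nonneg a)).mul (Tendsto.add ?_ ?_)) ?_
    · exact ((HP.continuous_sec hkP hyP _).tendsto xP).comp tP
    · exact ((HF.continuous_sec hkF hyF _).tendsto xF).comp tF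
    -- For `μ a = 0` the weight is `t` itself and diverges, but the group component of `w a` is
    -- zero, so the term vanishes identically. Otherwise the limit lift is `-Z`, and the curvature
    -- does not see the sign.
    · by_cases ha : μ a = 0
      · have zero : ∀ u, sec kG y.2.1 u (KG y.2.1 (coG T (w a))) = 0 := fun u ↦ by
          have := HG.sec_smul_right hkG hyG u 0 0
          rw [hc.coG_eq_zero iG hw ha, map_zero]
          simpa using this
        simp only [zero, mul_zero]
        exact tendsto_const_nhds
      · have hpos : 0 < μ a := lt_of_le_of_ne (hw.nonneg a) (Ne.symm ha)
        rw [← HG.sec_neg_left hkG hyG Z]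
        exact (tendsto_mul_inv_linear hpos).mul
          (((HG.continuous_sec hkG hyG _).tendsto (-Z)).comp tG)
  have tsum : Tendsto (fun t ↦ ∑ a, lo a t) atTop (𝓝 (∑ i, sec kP y.1 xP (eP i)
      + ∑ i, sec kF y.2.2 xF (eF i) + ∑ i, sec kG y.2.1 Z (eG i))) := by
    rw [← sum_limits_eq HP HG HF hkP hkG hkF hyP hyG hyF hd hc hw hNP hNF hNG heP heF heG xP xF Z]
    exact tendsto_finsetSum _ fun a _ ↦ tlo a
  refine le_of_tendsto_of_tendsto ((continuous_coe_real_ereal.tendsto _).comp tsum) hL ?_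
  filter_upwards [eventually_gt_atTop 0] with t ht
  rw [ric_eq t ht]
  exact EReal.coe_le_coe_iff.2 (Finset.sum_le_sum fun a _ ↦ lo_le t ht a)

end CoordinateTheorem

end CheegerBundle

end

noncomputable section
namespace CheegerBundle
-- Curvature of biinvariant metrics in coordinates
section InvariantFrames
set_option maxSynthPendingDepth 3

variable {E : Type*} [NormedAddCommGroup E] [NormedSpace ℝ E]

theorem nab_congr {κ : E → E →L[ℝ] E →L[ℝ] ℝ} {K : E → (E →L[ℝ] ℝ) →L[ℝ] E} {U : Set E}
    (hU : IsOpen U) {A B : E → E} (hAB : EqOn A B U) {y : E} (hy : y ∈ U) (u : E) :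
    nab κ K A y u = nab κ K B y u := by
  rw [nab, nab, fderiv_eq_of_eqOn hU hAB hy, hAB hy]

theorem nab_const_smul {κ : E → E →L[ℝ] E →L[ℝ] ℝ} {K : E → (E →L[ℝ] ℝ) →L[ℝ] E}
    (c : ℝ) {A : E → E} {y : E} (hA : DifferentiableAt ℝ A y) (u : E) :
    nab κ K (fun z ↦ c • A z) y u = c • nab κ K A y u := by
  rw [nab, nab, fderiv_fun_const_smul hA]
  simp [smul_add]

/-- Curvature of a metric with a family of vector fields that are closed under brackets, have
constant inner products and are Killing fields. -/
theorem IsMetricPair.sec_of_invariant_frame {κ : E → E →L[ℝ] E →L[ℝ] ℝ}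
    {K : E → (E →L[ℝ] ℝ) →L[ℝ] E} {U : Set E} {k : E → E → E → ℝ}
    (H : IsMetricPair κ K U) (hk : ∀ y ∈ U, ∀ u v, k y u v = κ y u v) {y : E} (hy : y ∈ U)
    {ι : Type*} {A : ι → E → E} {br : ι → ι → ι} (hA : ∀ i, ContDiffOn ℝ ∞ (A i) U)
    (hc : ∀ i j, ∀ z ∈ U, κ z (A i z) (A j z) = κ y (A i y) (A j y))
    (hbr : ∀ i j, ∀ z ∈ U, VectorField.lieBracket ℝ (A i) (A j) z = A (br i j) z)
    (hkill : ∀ i j l, ∀ z ∈ U, κ z (A (br i j) z) (A l z) + κ z (A j z) (A (br i l) z) = 0)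
    (hspan : ∀ z ∈ U, ∀ w, ∃ i, A i z = w) (i j : ι) :
    sec k y (A i y) (A j y) = 1 / 4 * κ y (A (br i j) y) (A (br i j) y) := by
  have hd : ∀ i, ∀ z ∈ U, DifferentiableAt ℝ (A i) z := fun i z hz ↦
    smoothOn_differentiableAt H.isOpen (hA i) hz
  have compat : ∀ i j l, ∀ z ∈ U, κ z (nab κ K (A j) z (A i z)) (A l z)
      + κ z (nab κ K (A l) z (A i z)) (A j z) = 0 := by
    intro i j l z hz
    rw [H.symm z hz (nab κ K (A l) z (A i z)), ← H.fderiv_inner hz (hd j z hz) (hd l z hz),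
      fderiv_eq_of_eqOn H.isOpen (fun w hw ↦ hc j l w hw) hz]
    simp
  have tors : ∀ i j l, ∀ z ∈ U, κ z (nab κ K (A j) z (A i z)) (A l z)
      - κ z (nab κ K (A i) z (A j z)) (A l z) = κ z (A (br i j) z) (A l z) := by
    intro i j l z hz
    rw [← hbr i j z hz, ← H.nab_sub_nab hz, map_sub, sub_apply]
  have swap : ∀ i j, ∀ z ∈ U, A (br i j) z = -A (br j i) z := fun i j z hz ↦ by
    rw [← hbr i j z hz, ← hbr j i z hz, VectorField.lieBracket_swap]
  -- For fields with constant inner products the Koszul formula contains only three bracket terms.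
  -- By the skewness `hkill` two of them cancel, leaving `∇_{A i} (A j) = ½ [A i, A j]`.
  have nabA : ∀ i j, ∀ z ∈ U, nab κ K (A j) z (A i z) = (1 / 2 : ℝ) • A (br i j) z := by
    intro i j z hz
    refine H.ext_inner hz fun w ↦ ?_
    obtain ⟨l, rfl⟩ := hspan z hz w
    rw [map_smul, smul_apply, smul_eq_mul]
    have s1 : κ z (A (br i l) z) (A j z) = κ z (A j z) (A (br i l) z) := H.symm z hz _ _
    have s2 : κ z (A (br j l) z) (A i z) = κ z (A i z) (A (br j l) z) := H.symm z hz _ _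
    have s3 : κ z (A (br j i) z) (A l z) = - κ z (A (br i j) z) (A l z) := by
      rw [swap j i z hz]; simp
    linarith [compat i j l z hz, compat j i l z hz, compat l i j z hz, tors i j l z hz,
      tors i l j z hz, tors j l i z hz, hkill i j l z hz, hkill j i l z hz]
  have self : ∀ j, ∀ z ∈ U, A (br j j) z = 0 := fun j z hz ↦ by
    rw [← hbr j j z hz]; simp
  have n1 : nab κ K (fun z ↦ nab κ K (A j) z (A j z)) y (A i y) = 0 := by
    rw [nab_congr H.isOpen (B := fun _ ↦ 0)
      (fun z hz ↦ by simp only [nabA j j z hz, self j z hz, smul_zero]) hy]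
    simp [nab]
  have n2 : nab κ K (fun z ↦ nab κ K (A j) z (A i z)) y (A j y)
      = (1 / 4 : ℝ) • A (br j (br i j)) y := by
    rw [nab_congr H.isOpen (B := fun z ↦ (1 / 2 : ℝ) • A (br i j) z)
      (fun z hz ↦ nabA i j z hz) hy, nab_const_smul _ (hd _ y hy), nabA _ _ y hy, smul_smul]
    norm_num
  rw [sec, hk y hy, H.curvatureOperator_fields hk hy (hA i) (hA j) (hA j), n1, n2, hbr i j y hy,
    nabA (br i j) j y hy, swap (br i j) j y hy]
  simp only [map_sub, map_zero, sub_apply, map_smul, smul_apply, smul_eq_mul, zero_apply, map_neg,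
    smul_neg, neg_apply]
  -- The curvature has been reduced to `¼ ⟨[A j, [A i, A j]], A i⟩`; skewness moves the outer
  -- bracket to `A i`.
  have h1 := hkill j (br i j) i y hy
  rw [swap j i y hy, map_neg] at h1
  linarith

/-- Curvature of a biinvariant metric in coordinates: `m` is the multiplication, and `br` the
bracket of left-invariant fields. -/
theorem IsMetricPair.sec_of_biinvariant [FiniteDimensional ℝ E] {κ : E → E →L[ℝ] E →L[ℝ] ℝ}
    {K : E → (E →L[ℝ] ℝ) →L[ℝ] E} {U : Set E} {k : E → E → E → ℝ}
    (H : IsMetricPair κ K U) (hk : ∀ y ∈ U, ∀ u v, k y u v = κ y u v) {y : E} (hy : y ∈ U)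
    {m : E × E → E} {W : Set (E × E)} (hW : IsOpen W) (hm : ContDiffOn ℝ ∞ m W)
    (hUW : ∀ z ∈ U, (z, y) ∈ W) (hmz : ∀ z ∈ U, m (z, y) = z)
    {br : E → E → E}
    (hleft : ∀ z ∈ U, ∀ u v, κ z (fderiv ℝ m (z, y) (0, u)) (fderiv ℝ m (z, y) (0, v)) = κ y u v)
    (hright : ∀ z ∈ W, ∀ u v, κ (m z) (fderiv ℝ m z (u, 0)) (fderiv ℝ m z (v, 0)) = κ z.1 u v)
    (hbr : ∀ u v, ∀ z ∈ U, VectorField.lieBracket ℝ (fun z ↦ fderiv ℝ m (z, y) (0, u))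
      (fun z ↦ fderiv ℝ m (z, y) (0, v)) z = fderiv ℝ m (z, y) (0, br u v))
    (hone : ∀ u, fderiv ℝ m (y, y) (0, u) = u) (u v : E) :
    sec k y u v = 1 / 4 * κ y (br u v) (br u v) := by
  let A : E → E → E := fun u z ↦ fderiv ℝ m (z, y) (0, u)
  have hfd := smoothOn_fderiv hW hm
  have hA : ∀ u, ContDiffOn ℝ ∞ (A u) U := fun u ↦
    (hfd.comp (contDiff_id.prodMk contDiff_const).contDiffOn hUW).clm_apply contDiffOn_const
  have hspan : ∀ z ∈ U, ∀ w, ∃ i, A i z = w := by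
    intro z hz
    let T : E →ₗ[ℝ] E := (fderiv ℝ m (z, y)).toLinearMap ∘ₗ LinearMap.inr ℝ E E
    have hT : ∀ u, T u = A u z := fun u ↦ rfl
    have : Function.Injective T := by
      rw [injective_iff_map_eq_zero]
      intro u hu
      by_contra h0
      have := hleft z hz u u
      change κ z (T u) (T u) = _ at this
      rw [hu, map_zero] at this
      exact (H.pos y hy u h0).ne this
    exact LinearMap.injective_iff_surjective.1 this
  have hc : ∀ i j, ∀ z ∈ U, κ z (A i z) (A j z) = κ y (A i y) (A j y) := fun i j z hz ↦ by
    rw [hleft z hz, hleft y hy]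
  -- the field `A u` is a Killing field
  have dA : ∀ u, ∀ z ∈ U, ∀ w, fderiv ℝ (A u) z w = fderiv ℝ (fderiv ℝ m) (z, y) (w, 0) (0, u) := by
    intro u z hz w
    have h1 := (smoothOn_differentiableAt hW hfd (hUW z hz)).hasFDerivAt
    have h2 : HasFDerivAt (fun z : E ↦ (z, y)) (ContinuousLinearMap.inl ℝ E E) z :=
      hasFDerivAt_prodMk_left z y
    have h3 : HasFDerivAt (A u) _ z := (h1.comp z h2).clm_apply (hasFDerivAt_const (0, u) z)
    rw [h3.fderiv]
    simp
  -- The flow of a left-invariant field consists of right translations, which are isometries.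
  -- Infinitesimally this is the identity `hright` differentiated in the second variable; mixed
  -- second derivatives of `m` turn into derivatives of `A u` by symmetry.
  have dR : ∀ u, ∀ z ∈ U, ∀ v w, fderiv ℝ κ z (A u z) v w + κ z (fderiv ℝ (A u) z v) w
      + κ z v (fderiv ℝ (A u) z w) = 0 := by
    intro u z hz v w
    have hzW := hUW z hz
    have hmd := (smoothOn_differentiableAt hW hm hzW).hasFDerivAt
    have hκd : HasFDerivAt κ (fderiv ℝ κ z) (m (z, y)) := by
      rw [hmz z hz]
      exact (smoothOn_differentiableAt H.isOpen H.smooth hz).hasFDerivAt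
    have h1 := (smoothOn_differentiableAt hW hfd hzW).hasFDerivAt
    have e1 : HasFDerivAt (fun x : E × E ↦ κ (m x) (fderiv ℝ m x (v, 0)) (fderiv ℝ m x (w, 0))) _
        (z, y) := ((hκd.comp (z, y) hmd).clm_apply
          (h1.clm_apply (hasFDerivAt_const (v, 0) (z, y)))).clm_apply
            (h1.clm_apply (hasFDerivAt_const (w, 0) (z, y)))
    have e2 := fderiv_eq_of_eqOn hW (fun x hx ↦ hright x hx v w) hzW
    have e3 : fderiv ℝ (fun x : E × E ↦ κ x.1 v w) (z, y) (0, u) = 0 := by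
      have hκ' : HasFDerivAt κ (fderiv ℝ κ z) (z, y).1 :=
        (smoothOn_differentiableAt H.isOpen H.smooth hz).hasFDerivAt
      have : HasFDerivAt (fun x : E × E ↦ κ x.1 v w) _ (z, y) :=
        ((hκ'.comp (z, y) hasFDerivAt_fst).clm_apply (hasFDerivAt_const v (z, y))).clm_apply
          (hasFDerivAt_const w (z, y))
      rw [this.fderiv]
      simp
    rw [← e2, e1.fderiv] at e3
    have hx1 : ∀ v : E, fderiv ℝ m (z, y) (v, 0) = v := by
      intro v
      have h2 : HasFDerivAt (fun z : E ↦ (z, y)) (ContinuousLinearMap.inl ℝ E E) z :=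
        hasFDerivAt_prodMk_left z y
      have h3 := (hmd.comp z h2).fderiv
      rw [fderiv_eq_of_eqOn H.isOpen (f := m ∘ fun z ↦ (z, y)) (h := id) (fun x hx ↦ hmz x hx) hz, fderiv_id] at h3
      have := congrArg (fun T : E →L[ℝ] E ↦ T v) h3
      simpa using this.symm
    have hsw : ∀ v, fderiv ℝ (fderiv ℝ m) (z, y) (0, u) (v, 0) = fderiv ℝ (A u) z v := fun v ↦ by
      rw [dA u z hz, fderiv_fderiv_symm hW hm hzW]
    simp [hx1, hsw, hmz z hz] at e3
    have : A u z = fderiv ℝ m (z, y) (0, u) := rfl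
    rw [this]
    linarith
  -- Subtract the Killing equation of `A i` from the derivative along `A i` of the constant `κ (A j)
  -- (A l)`: the derivatives of `κ` cancel and the others combine to brackets.
  have hkill : ∀ i j l, ∀ z ∈ U,
      κ z (A (br i j) z) (A l z) + κ z (A j z) (A (br i l) z) = 0 := by
    intro i j l z hz
    have hd := (smoothOn_differentiableAt H.isOpen H.smooth hz).hasFDerivAt
    have hj := (smoothOn_differentiableAt H.isOpen (hA j) hz).hasFDerivAt
    have hl := (smoothOn_differentiableAt H.isOpen (hA l) hz).hasFDerivAt
    have e1 : HasFDerivAt (fun x ↦ κ x (A j x) (A l x)) _ z := (hd.clm_apply hj).clm_apply hl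
    have e2 := fderiv_eq_of_eqOn H.isOpen (fun x hx ↦ hc j l x hx) hz
    rw [e1.fderiv] at e2
    have e3 := congrArg (fun T : E →L[ℝ] ℝ ↦ T (A i z)) e2
    simp at e3
    have b1 := hbr i j z hz
    have b2 := hbr i l z hz
    change _ = A (br i j) z at b1
    change _ = A (br i l) z at b2
    change fderiv ℝ (A j) z (A i z) - fderiv ℝ (A i) z (A j z) = _ at b1
    change fderiv ℝ (A l) z (A i z) - fderiv ℝ (A i) z (A l z) = _ at b2
    rw [← b1, ← b2]
    simp only [map_sub, sub_apply]
    linarith [dR i z hz (A j z) (A l z)]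
  have := H.sec_of_invariant_frame hk hy hA hc hbr hkill hspan u v
  change sec k y (fderiv ℝ m (y, y) (0, u)) (fderiv ℝ m (y, y) (0, v)) = _ at this
  rw [hone, hone] at this
  rw [this]
  change 1 / 4 * κ y (fderiv ℝ m (y, y) (0, br u v)) (fderiv ℝ m (y, y) (0, br u v)) = _
  rw [hone]

end InvariantFrames
end CheegerBundle
end

noncomputable section
namespace CheegerBundle
-- Riemannian metrics in charts
section Charts
set_option maxSynthPendingDepth 3

variable {E M : Type*} [NormedAddCommGroup E] [NormedSpace ℝ E]
    [TopologicalSpace M] [ChartedSpace E M] [IsManifold 𝓘(ℝ, E) ∞ M] {x : M}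

theorem infty_ne_zero : (∞ : WithTop ℕ∞) ≠ 0 := by simp

theorem contMDiffAt_chart {z : M} (hz : z ∈ (extChartAt 𝓘(ℝ, E) x).source) :
    ContMDiffAt 𝓘(ℝ, E) 𝓘(ℝ, E) ∞ (extChartAt 𝓘(ℝ, E) x) z :=
  contMDiffAt_extChartAt' (by simpa using hz)

theorem contMDiffAt_chart_symm {y : E} (hy : y ∈ (extChartAt 𝓘(ℝ, E) x).target) :
    ContMDiffAt 𝓘(ℝ, E) 𝓘(ℝ, E) ∞ (extChartAt 𝓘(ℝ, E) x).symm y :=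
  (contMDiffOn_extChartAt_symm x).contMDiffAt ((isOpen_extChartAt_target x).mem_nhds hy)

theorem mdifferentiableAt_chart {z : M} (hz : z ∈ (extChartAt 𝓘(ℝ, E) x).source) :
    MDifferentiableAt 𝓘(ℝ, E) 𝓘(ℝ, E) (extChartAt 𝓘(ℝ, E) x) z :=
  (contMDiffAt_chart hz).mdifferentiableAt infty_ne_zero

theorem mdifferentiableAt_chart_symm {y : E} (hy : y ∈ (extChartAt 𝓘(ℝ, E) x).target) :
    MDifferentiableAt 𝓘(ℝ, E) 𝓘(ℝ, E) (extChartAt 𝓘(ℝ, E) x).symm y :=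
  (contMDiffAt_chart_symm hy).mdifferentiableAt infty_ne_zero

theorem mfderiv_chart_mfderiv_symm {y : E} (hy : y ∈ (extChartAt 𝓘(ℝ, E) x).target) (u : E) :
    mfderiv 𝓘(ℝ, E) 𝓘(ℝ, E) (extChartAt 𝓘(ℝ, E) x) ((extChartAt 𝓘(ℝ, E) x).symm y)
      (mfderiv 𝓘(ℝ, E) 𝓘(ℝ, E) (extChartAt 𝓘(ℝ, E) x).symm y u) = u := by
  have h1 := mfderiv_comp_apply y
    (mdifferentiableAt_chart ((extChartAt 𝓘(ℝ, E) x).map_target hy))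
    (mdifferentiableAt_chart_symm hy) u
  rw [← h1]
  have h2 : (extChartAt 𝓘(ℝ, E) x) ∘ (extChartAt 𝓘(ℝ, E) x).symm =ᶠ[𝓝 y] id :=
    eventually_of_mem ((isOpen_extChartAt_target x).mem_nhds hy)
      fun z hz ↦ (extChartAt 𝓘(ℝ, E) x).right_inv hz
  rw [h2.mfderiv_eq, mfderiv_id]
  rfl

theorem mfderiv_symm_mfderiv_chart {z : M} (hz : z ∈ (extChartAt 𝓘(ℝ, E) x).source)
    (u : TangentSpace 𝓘(ℝ, E) z) :
    mfderiv 𝓘(ℝ, E) 𝓘(ℝ, E) (extChartAt 𝓘(ℝ, E) x).symm (extChartAt 𝓘(ℝ, E) x z)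
      (mfderiv 𝓘(ℝ, E) 𝓘(ℝ, E) (extChartAt 𝓘(ℝ, E) x) z u) = (u : E) := by
  have h1 := mfderiv_comp_apply z
    (mdifferentiableAt_chart_symm ((extChartAt 𝓘(ℝ, E) x).map_source hz))
    (mdifferentiableAt_chart hz) u
  rw [← h1]
  have h2 : (extChartAt 𝓘(ℝ, E) x).symm ∘ (extChartAt 𝓘(ℝ, E) x) =ᶠ[𝓝 z] id :=
    eventually_of_mem ((isOpen_extChartAt_source x).mem_nhds hz)
      fun z hz ↦ (extChartAt 𝓘(ℝ, E) x).left_inv hz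
  rw [h2.mfderiv_eq, mfderiv_id]
  rfl

/-- A Riemannian metric in the chart at `x`, as a map to continuous bilinear forms. -/
def chartForm (g : Metric E M) (x : M) (y : E) : E →L[ℝ] E →L[ℝ] ℝ :=
  ContinuousLinearMap.bilinearComp (E := E) (F := E) (g.inner ((extChartAt 𝓘(ℝ, E) x).symm y))
    (mfderiv 𝓘(ℝ, E) 𝓘(ℝ, E) (extChartAt 𝓘(ℝ, E) x).symm y)
    (mfderiv 𝓘(ℝ, E) 𝓘(ℝ, E) (extChartAt 𝓘(ℝ, E) x).symm y)

/-- The inverse of `chartForm`. -/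
def chartCoform (g : Metric E M) (x : M) (y : E) : (E →L[ℝ] ℝ) →L[ℝ] E :=
  ContinuousLinearMap.inverse (chartForm g x y)

theorem contMDiffOn_mfderiv_chart_symm (x : M) (u : E) :
    ContMDiffOn 𝓘(ℝ, E) 𝓘(ℝ, E).tangent ∞ (fun y : E ↦ (⟨(extChartAt 𝓘(ℝ, E) x).symm y,
      mfderiv 𝓘(ℝ, E) 𝓘(ℝ, E) (extChartAt 𝓘(ℝ, E) x).symm y u⟩ : TangentBundle 𝓘(ℝ, E) M))
      (extChartAt 𝓘(ℝ, E) x).target := by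
  have ho := isOpen_extChartAt_target (I := 𝓘(ℝ, E)) x
  have h1 := (contMDiffOn_extChartAt_symm (I := 𝓘(ℝ, E)) (n := ∞) x).contMDiffOn_tangentMapWithin
    (m := ∞) (by simp) ho.uniqueMDiffOn
  have h2 : ContMDiffOn 𝓘(ℝ, E) 𝓘(ℝ, E).tangent ∞
      (fun y : E ↦ (⟨y, u⟩ : TangentBundle 𝓘(ℝ, E) E)) (extChartAt 𝓘(ℝ, E) x).target :=
    contMDiffOn_vectorSpace_iff_contDiffOn.2 contDiffOn_const
  refine (h1.comp h2 fun y hy ↦ hy).congr fun y hy ↦ ?_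
  simp only [Function.comp_apply, tangentMapWithin]
  rw [mfderivWithin_of_isOpen ho hy]

theorem contMDiffWithinAt_inner (g : Metric E M) {E' N : Type*} [NormedAddCommGroup E']
    [NormedSpace ℝ E'] [TopologicalSpace N] [ChartedSpace E' N] {b : N → M}
    {v w : ∀ y, TangentSpace 𝓘(ℝ, E) (b y)} {s : Set N} {y : N}
    (hb : ContMDiffWithinAt 𝓘(ℝ, E') 𝓘(ℝ, E) ∞ b s y)
    (hv : ContMDiffWithinAt 𝓘(ℝ, E') 𝓘(ℝ, E).tangent ∞
      (fun y ↦ (⟨b y, v y⟩ : TangentBundle 𝓘(ℝ, E) M)) s y)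
    (hw : ContMDiffWithinAt 𝓘(ℝ, E') 𝓘(ℝ, E).tangent ∞
      (fun y ↦ (⟨b y, w y⟩ : TangentBundle 𝓘(ℝ, E) M)) s y) :
    ContMDiffWithinAt 𝓘(ℝ, E') 𝓘(ℝ, ℝ) ∞ (fun y ↦ g.inner (b y) (v y) (w y)) s y := by
  have : ContMDiffWithinAt 𝓘(ℝ, E') (𝓘(ℝ, E).prod 𝓘(ℝ)) ∞
      (fun y ↦ TotalSpace.mk' ℝ (E := Bundle.Trivial M ℝ) (b y)
        (g.inner (b y) (v y) (w y))) s y := by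
    apply ContMDiffWithinAt.clm_bundle_apply₂ (F₁ := E) (F₂ := E)
    · exact ContMDiffAt.comp_contMDiffWithinAt y g.contMDiff.contMDiffAt hb
    · exact hv
    · exact hw
  simp only [contMDiffWithinAt_totalSpace] at this
  exact this.2

theorem chartForm_apply (g : Metric E M) (x : M) (y u v : E) :
    chartForm g x y u v = g.inner ((extChartAt 𝓘(ℝ, E) x).symm y)
      (mfderiv 𝓘(ℝ, E) 𝓘(ℝ, E) (extChartAt 𝓘(ℝ, E) x).symm y u)
      (mfderiv 𝓘(ℝ, E) 𝓘(ℝ, E) (extChartAt 𝓘(ℝ, E) x).symm y v) := rfl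

theorem smooth_chartForm_apply (g : Metric E M) (x : M) (u v : E) :
    ContDiffOn ℝ ∞ (fun y ↦ chartForm g x y u v) (extChartAt 𝓘(ℝ, E) x).target := by
  intro y hy
  have h1 := contMDiffOn_mfderiv_chart_symm x u y hy
  have h2 := contMDiffOn_mfderiv_chart_symm x v y hy
  have hb := (contMDiffOn_extChartAt_symm (I := 𝓘(ℝ, E)) (n := ∞) x) y hy
  exact (contMDiffWithinAt_inner g hb h1 h2).contDiffWithinAt

/-- Positivity makes the coordinate form injective, hence invertible in finite dimension, and
inversion of continuous linear maps is smooth at invertible ones. -/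
theorem isMetricPair_chart [FiniteDimensional ℝ E] (g : Metric E M) (x : M) :
    IsMetricPair (chartForm g x) (chartCoform g x) (extChartAt 𝓘(ℝ, E) x).target := by
  have : CompleteSpace E := FiniteDimensional.complete ℝ _
  have sm : ContDiffOn ℝ ∞ (chartForm g x) (extChartAt 𝓘(ℝ, E) x).target := by
    rw [contDiffOn_clm_apply]
    intro u
    rw [contDiffOn_clm_apply]
    exact fun v ↦ smooth_chartForm_apply g x u v
  have sy : ∀ y u v, chartForm g x y u v = chartForm g x y v u := fun y u v ↦ by
    rw [chartForm_apply, chartForm_apply, g.symm]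
  have po : ∀ y ∈ (extChartAt 𝓘(ℝ, E) x).target, ∀ u, u ≠ 0 → 0 < chartForm g x y u u := by
    intro y hy u hu
    rw [chartForm_apply]
    refine g.pos _ _ fun h0 ↦ hu ?_
    rw [← mfderiv_chart_mfderiv_symm hy u, h0]
    exact (mfderiv 𝓘(ℝ, E) 𝓘(ℝ, E) (extChartAt 𝓘(ℝ, E) x)
      ((extChartAt 𝓘(ℝ, E) x).symm y)).map_zero
  have fr : Module.finrank ℝ E = Module.finrank ℝ (E →L[ℝ] ℝ) := by
    rw [← (LinearMap.toContinuousLinearMap : (E →ₗ[ℝ] ℝ) ≃ₗ[ℝ] (E →L[ℝ] ℝ)).finrank_eq]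
    exact Subspace.dual_finrank_eq.symm
  have eq : ∀ y ∈ (extChartAt 𝓘(ℝ, E) x).target,
      ∃ e : E ≃L[ℝ] (E →L[ℝ] ℝ), (e : E →L[ℝ] E →L[ℝ] ℝ) = chartForm g x y := by
    intro y hy
    refine ⟨(LinearEquiv.ofInjectiveOfFinrankEq (chartForm g x y).toLinearMap
      ?_ fr).toContinuousLinearEquiv, by ext α; rfl⟩
    refine (injective_iff_map_eq_zero _).2 fun u hu ↦ ?_
    by_contra h0
    have h1 := po y hy u h0
    change chartForm g x y u = 0 at hu
    rw [hu] at h1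
    exact lt_irrefl _ h1
  exact
    { isOpen := isOpen_extChartAt_target x
      smooth := sm
      smooth_inv := fun y hy ↦ by
        obtain ⟨e, he⟩ := eq y hy
        have hi : ContDiffAt ℝ ∞ (ContinuousLinearMap.inverse : (E →L[ℝ] E →L[ℝ] ℝ) → _)
            (chartForm g x y) := by
          rw [← he]
          exact contDiffAt_map_inverse e
        exact hi.comp_contDiffWithinAt y (sm y hy)
      symm := fun y _ u v ↦ sy y u v
      pos := po
      left_inv := fun y hy u ↦ by
        obtain ⟨e, he⟩ := eq y hy
        rw [chartCoform, ← he, ContinuousLinearMap.inverse_equiv]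
        exact e.symm_apply_apply u
      right_inv := fun y hy α ↦ by
        obtain ⟨e, he⟩ := eq y hy
        rw [chartCoform, ← he, ContinuousLinearMap.inverse_equiv]
        exact e.apply_symm_apply α }

end Charts
end CheegerBundle
end

noncomputable section
namespace CheegerBundle
-- Derivatives and pairings written on the model spaces, so that base points can be rewritten freely
section TangentMaps
set_option maxSynthPendingDepth 3

variable {E H : Type*} [NormedAddCommGroup E] [NormedSpace ℝ E] [TopologicalSpace H]
  {I : ModelWithCorners ℝ E H} {N : Type*} [TopologicalSpace N] [ChartedSpace H N]
  {E' H' : Type*} [NormedAddCommGroup E'] [NormedSpace ℝ E'] [TopologicalSpace H']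
  {I' : ModelWithCorners ℝ E' H'} {N' : Type*} [TopologicalSpace N'] [ChartedSpace H' N']
  {E'' H'' : Type*} [NormedAddCommGroup E''] [NormedSpace ℝ E''] [TopologicalSpace H'']
  {I'' : ModelWithCorners ℝ E'' H''} {N'' : Type*} [TopologicalSpace N''] [ChartedSpace H'' N'']

/-- The derivative of a map of manifolds as a map of model vector spaces. -/
def tder (I : ModelWithCorners ℝ E H) (I' : ModelWithCorners ℝ E' H') (f : N → N') (x : N) :
    E →L[ℝ] E' :=
  mfderiv I I' f x

theorem tder_comp {f : N → N'} {h : N' → N''} {x : N} (hh : MDifferentiableAt I' I'' h (f x))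
    (hf : MDifferentiableAt I I' f x) (u : E) :
    tder I I'' (h ∘ f) x u = tder I' I'' h (f x) (tder I I' f x u) :=
  mfderiv_comp_apply x hh hf u

theorem tder_congr {f h : N → N'} {x : N} (hfh : f =ᶠ[𝓝 x] h) : tder I I' f x = tder I I' h x :=
  hfh.mfderiv_eq

theorem tder_id (x : N) (u : E) : tder I I (fun x ↦ x) x u = u := by
  change mfderiv I I id x u = u
  rw [mfderiv_id]
  rfl

theorem tder_const (c : N') (x : N) (u : E) : tder I I' (fun _ : N ↦ c) x u = 0 := by
  change mfderiv I I' (fun _ : N ↦ c) x u = 0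
  rw [mfderiv_const]
  rfl

theorem tder_eq_fderiv (f : E → E') (x : E) : tder 𝓘(ℝ, E) 𝓘(ℝ, E') f x = fderiv ℝ f x :=
  mfderiv_eq_fderiv

/-- The pairing of a metric field as a function on the model space. -/
def plain (k : MetricField I N) (z : N) (u v : E) : ℝ := k z u v

end TangentMaps

section ChartMaps
set_option maxSynthPendingDepth 3

variable {E M : Type*} [NormedAddCommGroup E] [NormedSpace ℝ E]
    [TopologicalSpace M] [ChartedSpace E M]

/-- The derivative of the chart at `x`. -/
def dchart (E : Type*) {M : Type*} [NormedAddCommGroup E] [NormedSpace ℝ E]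
    [TopologicalSpace M] [ChartedSpace E M] (x z : M) : E →L[ℝ] E :=
  tder 𝓘(ℝ, E) 𝓘(ℝ, E) (extChartAt 𝓘(ℝ, E) x) z

/-- The derivative of the inverse of the chart at `x`. -/
def dchartSymm {E M : Type*} [NormedAddCommGroup E] [NormedSpace ℝ E]
    [TopologicalSpace M] [ChartedSpace E M] (x : M) (y : E) : E →L[ℝ] E :=
  tder 𝓘(ℝ, E) 𝓘(ℝ, E) (extChartAt 𝓘(ℝ, E) x).symm y

theorem metricInChart_eq (k : MetricField 𝓘(ℝ, E) M) (x : M) (y u v : E) :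
    metricInChart k x y u v
      = plain k ((extChartAt 𝓘(ℝ, E) x).symm y) (dchartSymm x y u) (dchartSymm x y v) := rfl

variable [IsManifold 𝓘(ℝ, E) ∞ M]

theorem dchart_dchartSymm {x : M} {y : E} (hy : y ∈ (extChartAt 𝓘(ℝ, E) x).target) (u : E) :
    dchart E x ((extChartAt 𝓘(ℝ, E) x).symm y) (dchartSymm x y u) = u :=
  mfderiv_chart_mfderiv_symm hy u

theorem dchartSymm_dchart {x z : M} (hz : z ∈ (extChartAt 𝓘(ℝ, E) x).source) (u : E) :
    dchartSymm x (extChartAt 𝓘(ℝ, E) x z) (dchart E x z u) = u :=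
  mfderiv_symm_mfderiv_chart hz u

theorem dchartSymm_dchart' {x : M} {y : E} (hy : y ∈ (extChartAt 𝓘(ℝ, E) x).target) (u : E) :
    dchartSymm x y (dchart E x ((extChartAt 𝓘(ℝ, E) x).symm y) u) = u := by
  have := dchartSymm_dchart ((extChartAt 𝓘(ℝ, E) x).map_target hy) u
  rwa [(extChartAt 𝓘(ℝ, E) x).right_inv hy] at this

theorem metricInChart_dchart (k : MetricField 𝓘(ℝ, E) M) {x z : M}
    (hz : z ∈ (extChartAt 𝓘(ℝ, E) x).source) (u v : E) :
    metricInChart k x (extChartAt 𝓘(ℝ, E) x z) (dchart E x z u) (dchart E x z v)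
      = plain k z u v := by
  rw [metricInChart_eq, (extChartAt 𝓘(ℝ, E) x).left_inv hz, dchartSymm_dchart hz,
    dchartSymm_dchart hz]

theorem chartForm_eq (g : Metric E M) (x : M) (y u v : E) :
    chartForm g x y u v = plain g.field ((extChartAt 𝓘(ℝ, E) x).symm y) (dchartSymm x y u)
      (dchartSymm x y v) := rfl

theorem chartForm_dchart (g : Metric E M) {x z : M}
    (hz : z ∈ (extChartAt 𝓘(ℝ, E) x).source) (u v : E) :
    chartForm g x (extChartAt 𝓘(ℝ, E) x z) (dchart E x z u) (dchart E x z v)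
      = plain g.field z u v :=
  metricInChart_dchart g.field hz u v

end ChartMaps

/-! ### The group in the chart at `1`: left-invariant fields and curvature -/

section Biinvariant
set_option maxSynthPendingDepth 3

variable {E G : Type*} [NormedAddCommGroup E] [NormedSpace ℝ E] [TopologicalSpace G]
  [ChartedSpace E G] [Group G]

/-- The multiplication of the group in the chart at `1`. -/
def chartMul (E G : Type*) [NormedAddCommGroup E] [NormedSpace ℝ E] [TopologicalSpace G]
    [ChartedSpace E G] [Group G] (z : E × E) : E :=
  extChartAt 𝓘(ℝ, E) (1 : G)
    ((extChartAt 𝓘(ℝ, E) (1 : G)).symm z.1 * (extChartAt 𝓘(ℝ, E) (1 : G)).symm z.2)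

/-- The domain of `chartMul`. -/
def chartMulDomain (E G : Type*) [NormedAddCommGroup E] [NormedSpace ℝ E] [TopologicalSpace G]
    [ChartedSpace E G] [Group G] : Set (E × E) :=
  ((extChartAt 𝓘(ℝ, E) (1 : G)).target ×ˢ (extChartAt 𝓘(ℝ, E) (1 : G)).target) ∩
    (fun z : E × E ↦ (extChartAt 𝓘(ℝ, E) (1 : G)).symm z.1
      * (extChartAt 𝓘(ℝ, E) (1 : G)).symm z.2) ⁻¹' (extChartAt 𝓘(ℝ, E) (1 : G)).source

theorem mk_mem_chartMulDomain {z : E} (hz : z ∈ (extChartAt 𝓘(ℝ, E) (1 : G)).target) :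
    (z, extChartAt 𝓘(ℝ, E) (1 : G) 1) ∈ chartMulDomain E G := by
  refine ⟨⟨hz, mem_extChartAt_target _⟩, ?_⟩
  simpa using (extChartAt 𝓘(ℝ, E) (1 : G)).map_target hz

/-- The left-invariant field of `u` as a map to the model space. -/
def leftField (u : E) (a : G) : E :=
  mulInvariantVectorField (I := 𝓘(ℝ, E)) (u : GroupLieAlgebra 𝓘(ℝ, E) G) a

/-- The bracket of the Lie algebra on the model space. -/
def plainBracket (G : Type*) [TopologicalSpace G] [ChartedSpace E G] [Group G] (u v : E) : E :=
  Bracket.bracket (L := GroupLieAlgebra 𝓘(ℝ, E) G) (M := GroupLieAlgebra 𝓘(ℝ, E) G) u v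

/-- The vector in the Lie algebra with coordinates `u`. -/
def lieVec (G : Type*) [TopologicalSpace G] [ChartedSpace E G] [Group G] (u : E) : E :=
  dchartSymm (1 : G) (extChartAt 𝓘(ℝ, E) (1 : G) 1) u

theorem leftField_one (u : E) : leftField u (1 : G) = u := by
  change tder 𝓘(ℝ, E) 𝓘(ℝ, E) (fun x : G ↦ 1 * x) 1 u = u
  simp only [one_mul]
  exact tder_id _ _

variable [LieGroup 𝓘(ℝ, E) ∞ G]

theorem contMDiffOn_mul_chart_symm : ContMDiffOn 𝓘(ℝ, E × E) 𝓘(ℝ, E) ∞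
    (fun z : E × E ↦ (extChartAt 𝓘(ℝ, E) (1 : G)).symm z.1
      * (extChartAt 𝓘(ℝ, E) (1 : G)).symm z.2)
    ((extChartAt 𝓘(ℝ, E) (1 : G)).target ×ˢ (extChartAt 𝓘(ℝ, E) (1 : G)).target) := by
  have h := contMDiffOn_extChartAt_symm (I := 𝓘(ℝ, E)) (n := ∞) (1 : G)
  exact (h.comp contDiff_fst.contMDiff.contMDiffOn fun z hz ↦ hz.1).mul
    (h.comp contDiff_snd.contMDiff.contMDiffOn fun z hz ↦ hz.2)

theorem isOpen_chartMulDomain : IsOpen (chartMulDomain E G) :=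
  contMDiffOn_mul_chart_symm.continuousOn.isOpen_inter_preimage
    ((isOpen_extChartAt_target _).prod (isOpen_extChartAt_target _)) (isOpen_extChartAt_source _)

theorem contDiffOn_chartMul : ContDiffOn ℝ ∞ (chartMul E G) (chartMulDomain E G) := by
  refine ContMDiffOn.contDiffOn ?_
  intro z hz
  have h1 := (contMDiffOn_mul_chart_symm (E := E) (G := G)).mono (fun z hz ↦ hz.1 :
    chartMulDomain E G ⊆ _) z hz
  exact (contMDiffAt_chart (x := (1 : G)) hz.2).comp_contMDiffWithinAt z h1

theorem fderiv_chartMul_left {z : E × E} (hz : z ∈ chartMulDomain E G) (u : E) :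
    fderiv ℝ (chartMul E G) z (u, 0) = dchart E (1 : G)
        ((extChartAt 𝓘(ℝ, E) (1 : G)).symm z.1 * (extChartAt 𝓘(ℝ, E) (1 : G)).symm z.2)
        (tder 𝓘(ℝ, E) 𝓘(ℝ, E) (fun a : G ↦ a * (extChartAt 𝓘(ℝ, E) (1 : G)).symm z.2)
          ((extChartAt 𝓘(ℝ, E) (1 : G)).symm z.1) (dchartSymm (1 : G) z.1 u)) := by
  have h1 : HasFDerivAt (fun a : E ↦ (a, z.2)) (ContinuousLinearMap.inl ℝ E E) z.1 :=
    hasFDerivAt_prodMk_left z.1 z.2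
  have h2 := ((smoothOn_differentiableAt isOpen_chartMulDomain contDiffOn_chartMul
    hz).hasFDerivAt.comp z.1 h1).fderiv
  have h3 := congrArg (fun T : E →L[ℝ] E ↦ T u) h2
  refine h3.symm.trans ?_
  have d1 := mdifferentiableAt_chart_symm (x := (1 : G)) hz.1.1
  have d2 : MDifferentiableAt 𝓘(ℝ, E) 𝓘(ℝ, E)
      (fun a : G ↦ a * (extChartAt 𝓘(ℝ, E) (1 : G)).symm z.2)
      ((extChartAt 𝓘(ℝ, E) (1 : G)).symm z.1) :=
    (contMDiff_mul_right (n := ∞)).mdifferentiableAt infty_ne_zero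
  have d3 := mdifferentiableAt_chart (x := (1 : G)) hz.2
  rw [dchart, dchartSymm, ← tder_comp d2 d1]
  refine Eq.trans ?_ (tder_comp (h := extChartAt 𝓘(ℝ, E) (1 : G))
    (f := (fun a : G ↦ a * (extChartAt 𝓘(ℝ, E) (1 : G)).symm z.2)
      ∘ (extChartAt 𝓘(ℝ, E) (1 : G)).symm) d3 (d2.comp z.1 d1) u)
  rw [tder_eq_fderiv]
  rfl

theorem fderiv_chartMul_right {z : E × E} (hz : z ∈ chartMulDomain E G) (u : E) :
    fderiv ℝ (chartMul E G) z (0, u) = dchart E (1 : G)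
        ((extChartAt 𝓘(ℝ, E) (1 : G)).symm z.1 * (extChartAt 𝓘(ℝ, E) (1 : G)).symm z.2)
        (tder 𝓘(ℝ, E) 𝓘(ℝ, E) (fun a : G ↦ (extChartAt 𝓘(ℝ, E) (1 : G)).symm z.1 * a)
          ((extChartAt 𝓘(ℝ, E) (1 : G)).symm z.2) (dchartSymm (1 : G) z.2 u)) := by
  have h1 : HasFDerivAt (fun a : E ↦ (z.1, a)) (ContinuousLinearMap.inr ℝ E E) z.2 :=
    hasFDerivAt_prodMk_right z.1 z.2
  have h2 := ((smoothOn_differentiableAt isOpen_chartMulDomain contDiffOn_chartMul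
    hz).hasFDerivAt.comp z.2 h1).fderiv
  have h3 := congrArg (fun T : E →L[ℝ] E ↦ T u) h2
  refine h3.symm.trans ?_
  have d1 := mdifferentiableAt_chart_symm (x := (1 : G)) hz.1.2
  have d2 : MDifferentiableAt 𝓘(ℝ, E) 𝓘(ℝ, E)
      (fun a : G ↦ (extChartAt 𝓘(ℝ, E) (1 : G)).symm z.1 * a)
      ((extChartAt 𝓘(ℝ, E) (1 : G)).symm z.2) :=
    (contMDiff_mul_left (n := ∞)).mdifferentiableAt infty_ne_zero
  have d3 := mdifferentiableAt_chart (x := (1 : G)) hz.2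
  rw [dchart, dchartSymm, ← tder_comp d2 d1]
  refine Eq.trans ?_ (tder_comp (h := extChartAt 𝓘(ℝ, E) (1 : G))
    (f := (fun a : G ↦ (extChartAt 𝓘(ℝ, E) (1 : G)).symm z.1 * a)
      ∘ (extChartAt 𝓘(ℝ, E) (1 : G)).symm) d3 (d2.comp z.2 d1) u)
  rw [tder_eq_fderiv]
  rfl

/-- The derivative of `chartMul` in the second variable gives the left-invariant vector fields. -/
theorem fderiv_chartMul_one {z : E} (hz : z ∈ (extChartAt 𝓘(ℝ, E) (1 : G)).target) (u : E) :
    fderiv ℝ (chartMul E G) (z, extChartAt 𝓘(ℝ, E) (1 : G) 1) (0, u) =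
      dchart E (1 : G) ((extChartAt 𝓘(ℝ, E) (1 : G)).symm z)
        (leftField (lieVec G u) ((extChartAt 𝓘(ℝ, E) (1 : G)).symm z)) := by
  rw [fderiv_chartMul_right (mk_mem_chartMulDomain hz)]
  have h1 : (extChartAt 𝓘(ℝ, E) (1 : G)).symm (extChartAt 𝓘(ℝ, E) (1 : G) 1) = 1 := by simp
  rw [h1, mul_one]
  rfl

theorem IsBiinvariant.plain_leftField {Q : Metric E G} (hQ : IsBiinvariant Q)
    (a : G) (u v : E) :
    plain Q.field a (leftField u a) (leftField v a) = plain Q.field 1 u v := by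
  have h : plain Q.field (a * 1) (leftField u a) (leftField v a) = plain Q.field 1 u v :=
    (hQ a).1 1 u v
  rwa [mul_one] at h

theorem mpullback_leftField {z : E} (hz : z ∈ (extChartAt 𝓘(ℝ, E) (1 : G)).target)
    (V : ∀ a : G, TangentSpace 𝓘(ℝ, E) a) :
    VectorField.mpullback 𝓘(ℝ, E) 𝓘(ℝ, E) (extChartAt 𝓘(ℝ, E) (1 : G)).symm V z
      = dchart E (1 : G) ((extChartAt 𝓘(ℝ, E) (1 : G)).symm z)
        (V ((extChartAt 𝓘(ℝ, E) (1 : G)).symm z)) := by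
  have : (dchartSymm (1 : G) z).inverse
      = dchart E (1 : G) ((extChartAt 𝓘(ℝ, E) (1 : G)).symm z) := by
    refine ContinuousLinearMap.inverse_eq ?_ ?_
    · ext u
      exact dchartSymm_dchart' hz u
    · ext u
      exact dchart_dchartSymm hz u
  exact congrArg (fun T : E →L[ℝ] E ↦ T (V ((extChartAt 𝓘(ℝ, E) (1 : G)).symm z))) this

/-- The bracket of left-invariant fields is left-invariant, and pullback by the inverse chart
commutes with brackets. This transfers the bracket of the Lie algebra to the vector space bracket
used by `sec_of_biinvariant`. -/
theorem lieBracket_leftField [FiniteDimensional ℝ E] {z : E}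
    (hz : z ∈ (extChartAt 𝓘(ℝ, E) (1 : G)).target) (u v : E) :
    VectorField.lieBracket ℝ
      (fun z ↦ dchart E (1 : G) ((extChartAt 𝓘(ℝ, E) (1 : G)).symm z)
        (leftField u ((extChartAt 𝓘(ℝ, E) (1 : G)).symm z)))
      (fun z ↦ dchart E (1 : G) ((extChartAt 𝓘(ℝ, E) (1 : G)).symm z)
        (leftField v ((extChartAt 𝓘(ℝ, E) (1 : G)).symm z))) z
      = dchart E (1 : G) ((extChartAt 𝓘(ℝ, E) (1 : G)).symm z)
        (leftField (plainBracket G u v) ((extChartAt 𝓘(ℝ, E) (1 : G)).symm z)) := by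
  have : CompleteSpace E := FiniteDimensional.complete ℝ _
  have : LieGroup 𝓘(ℝ, E) (minSmoothness ℝ 3) G := by
    rw [minSmoothness_of_isRCLikeNormedField]
    infer_instance
  have ho := (isOpen_extChartAt_target (I := 𝓘(ℝ, E)) (1 : G)).mem_nhds hz
  have e : ∀ w : E,
      (fun z ↦ dchart E (1 : G) ((extChartAt 𝓘(ℝ, E) (1 : G)).symm z)
        (leftField w ((extChartAt 𝓘(ℝ, E) (1 : G)).symm z))) =ᶠ[𝓝 z]
      VectorField.mpullback 𝓘(ℝ, E) 𝓘(ℝ, E) (extChartAt 𝓘(ℝ, E) (1 : G)).symm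
        (mulInvariantVectorField (I := 𝓘(ℝ, E)) (w : GroupLieAlgebra 𝓘(ℝ, E) G)) := fun w ↦
    eventually_of_mem ho fun z hz ↦ (mpullback_leftField hz _).symm
  rw [(e u).lieBracket_vectorField_eq (e v)]
  have h1 := VectorField.mpullback_mlieBracket (n := ∞)
    (mdifferentiableAt_mulInvariantVectorField (I := 𝓘(ℝ, E)) (u : GroupLieAlgebra 𝓘(ℝ, E) G))
    (mdifferentiableAt_mulInvariantVectorField (I := 𝓘(ℝ, E)) (v : GroupLieAlgebra 𝓘(ℝ, E) G))
    (contMDiffAt_chart_symm hz)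
    (by rw [minSmoothness_of_isRCLikeNormedField]; exact two_le_infty)
  have h2 : ∀ V W : E → E, VectorField.mlieBracket 𝓘(ℝ, E) V W z = VectorField.lieBracket ℝ V W z := by
    intro V W
    rw [← VectorField.lieBracketWithin_univ]
    exact congrFun (VectorField.mlieBracketWithin_eq_lieBracketWithin (𝕜 := ℝ) (V := V) (W := W)
      (s := univ)) z
  have h3 := mulInvariantVector_mlieBracket (I := 𝓘(ℝ, E)) (G := G) (u : GroupLieAlgebra 𝓘(ℝ, E) G)
    (v : GroupLieAlgebra 𝓘(ℝ, E) G)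
  rw [← h3, mpullback_leftField hz] at h1
  exact ((h1.trans (h2 _ _)).symm :)

/-- The curvature of a biinvariant metric at the identity. -/
theorem IsBiinvariant.sectional_one [FiniteDimensional ℝ E] {Q : Metric E G}
    (hQ : IsBiinvariant Q) (u v : GroupLieAlgebra 𝓘(ℝ, E) G) :
    sectional Q.field 1 u v = 1 / 4 * Q.field 1 ⁅u, v⁆ ⁅u, v⁆ := by
  suffices key : ∀ u v : E, sec (metricInChart Q.field (1 : G)) (extChartAt 𝓘(ℝ, E) (1 : G) 1)
      (dchart E (1 : G) 1 u) (dchart E (1 : G) 1 v)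
        = 1 / 4 * plain Q.field 1 (plainBracket G u v) (plainBracket G u v) from key u v
  intro u v
  have hy := mem_extChartAt_target (I := 𝓘(ℝ, E)) (1 : G)
  have hs := mem_extChartAt_source (I := 𝓘(ℝ, E)) (1 : G)
  have hsy : (extChartAt 𝓘(ℝ, E) (1 : G)).symm (extChartAt 𝓘(ℝ, E) (1 : G) 1) = 1 := by simp
  have SC : ∀ u, lieVec G (dchart E (1 : G) 1 u) = u := fun u ↦ dchartSymm_dchart hs u
  have CS : ∀ u : E, dchart E (1 : G) 1 (lieVec G u) = u := fun u ↦ by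
    have := dchart_dchartSymm hy u
    rwa [hsy] at this
  have H := isMetricPair_chart Q (1 : G)
  have key := H.sec_of_biinvariant (k := metricInChart Q.field (1 : G)) (fun _ _ _ _ ↦ rfl) hy
    (m := chartMul E G) isOpen_chartMulDomain contDiffOn_chartMul
    (fun z hz ↦ mk_mem_chartMulDomain hz)
    (fun z hz ↦ by
      rw [chartMul, hsy, mul_one, (extChartAt 𝓘(ℝ, E) (1 : G)).right_inv hz])
    (br := fun u v ↦ dchart E (1 : G) 1
      (plainBracket G (lieVec G u) (lieVec G v))) ?_ ?_ ?_ ?_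
      (dchart E (1 : G) 1 u) (dchart E (1 : G) 1 v)
  · rw [SC, SC, chartForm_dchart Q hs] at key
    exact key
  · intro z hz u v
    rw [fderiv_chartMul_one hz, fderiv_chartMul_one hz, chartForm_eq, dchartSymm_dchart' hz,
      dchartSymm_dchart' hz, hQ.plain_leftField, chartForm_eq, hsy]
    rfl
  · intro z hz u v
    rw [fderiv_chartMul_left hz, fderiv_chartMul_left hz, chartMul, chartForm_dchart Q hz.2,
      chartForm_eq]
    exact (hQ _).2 _ _ _
  · intro u v z hz
    rw [fderiv_chartMul_one hz, SC, ← lieBracket_leftField hz]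
    have ho := (isOpen_extChartAt_target (I := 𝓘(ℝ, E)) (1 : G)).mem_nhds hz
    exact Filter.EventuallyEq.lieBracket_vectorField_eq
      (eventually_of_mem ho fun z hz ↦ fderiv_chartMul_one hz u)
      (eventually_of_mem ho fun z hz ↦ fderiv_chartMul_one hz v)
  · intro u
    rw [fderiv_chartMul_one hy, hsy, leftField_one, CS]

end Biinvariant
end CheegerBundle
end

noncomputable section
namespace CheegerBundle
-- Derivatives of maps to and from products
section TangentMapsProd
set_option maxSynthPendingDepth 3

variable {E H : Type*} [NormedAddCommGroup E] [NormedSpace ℝ E] [TopologicalSpace H]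
  {I : ModelWithCorners ℝ E H} {N : Type*} [TopologicalSpace N] [ChartedSpace H N]
  {E' H' : Type*} [NormedAddCommGroup E'] [NormedSpace ℝ E'] [TopologicalSpace H']
  {I' : ModelWithCorners ℝ E' H'} {N' : Type*} [TopologicalSpace N'] [ChartedSpace H' N']
  {E'' H'' : Type*} [NormedAddCommGroup E''] [NormedSpace ℝ E''] [TopologicalSpace H'']
  {I'' : ModelWithCorners ℝ E'' H''} {N'' : Type*} [TopologicalSpace N''] [ChartedSpace H'' N'']

theorem tder_prodMk {f : N → N'} {h : N → N''} {x : N} (hf : MDifferentiableAt I I' f x)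
    (hh : MDifferentiableAt I I'' h x) (u : E) :
    tder I (I'.prod I'') (fun x ↦ (f x, h x)) x u = (tder I I' f x u, tder I I'' h x u) := by
  rw [tder, mfderiv_prodMk hf hh]
  rfl

theorem tder_fst (x : N × N') (u : E × E') : tder (I.prod I') I Prod.fst x u = u.1 := by
  rw [tder, mfderiv_fst]
  rfl

theorem tder_snd (x : N × N') (u : E × E') : tder (I.prod I') I' Prod.snd x u = u.2 := by
  rw [tder, mfderiv_snd]
  rfl

theorem tder_left {f : N × N' → N''} {x : N × N'} (hf : MDifferentiableAt (I.prod I') I'' f x)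
    (u : E) : tder I I'' (fun z ↦ f (z, x.2)) x.1 u = tder (I.prod I') I'' f x (u, 0) := by
  have h1 : MDifferentiableAt I (I.prod I') (fun z : N ↦ (z, x.2)) x.1 :=
    mdifferentiableAt_id.prodMk mdifferentiableAt_const
  have h2 := tder_comp (f := fun z : N ↦ (z, x.2)) (h := f) (x := x.1) hf h1 u
  rw [tder_prodMk (f := fun z ↦ z) mdifferentiableAt_id mdifferentiableAt_const, tder_const,
    tder_id] at h2
  exact h2

theorem tder_right {f : N × N' → N''} {x : N × N'} (hf : MDifferentiableAt (I.prod I') I'' f x)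
    (u : E') : tder I' I'' (fun z ↦ f (x.1, z)) x.2 u = tder (I.prod I') I'' f x (0, u) := by
  have h1 : MDifferentiableAt I' (I.prod I') (fun z : N' ↦ (x.1, z)) x.2 :=
    mdifferentiableAt_const.prodMk mdifferentiableAt_id
  have h2 := tder_comp (f := fun z : N' ↦ (x.1, z)) (h := f) (x := x.2) hf h1 u
  rw [tder_prodMk (h := fun z ↦ z) mdifferentiableAt_const mdifferentiableAt_id, tder_const,
    tder_id] at h2
  exact h2

theorem tder_prodMap {E₃ H₃ : Type*} [NormedAddCommGroup E₃] [NormedSpace ℝ E₃]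
    [TopologicalSpace H₃] {I₃ : ModelWithCorners ℝ E₃ H₃} {N₃ : Type*} [TopologicalSpace N₃]
    [ChartedSpace H₃ N₃] {f : N → N''} {h : N' → N₃} {x : N × N'}
    (hf : MDifferentiableAt I I'' f x.1) (hh : MDifferentiableAt I' I₃ h x.2) (u : E × E') :
    tder (I.prod I') (I''.prod I₃) (fun z ↦ (f z.1, h z.2)) x u
      = (tder I I'' f x.1 u.1, tder I' I₃ h x.2 u.2) := by
  have h1 := hf.comp x (mdifferentiableAt_fst (I := I) (I' := I'))
  have h2 := hh.comp x (mdifferentiableAt_snd (I := I) (I' := I'))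
  have h3 := tder_prodMk h1 h2 u
  rw [tder_comp hf mdifferentiableAt_fst, tder_comp hh mdifferentiableAt_snd, tder_fst,
    tder_snd] at h3
  exact h3

theorem tder_surjective {f : N → N'} {h : N' → N} (hfh : ∀ y, f (h y) = y) {x : N}
    (hx : h (f x) = x) (hf : MDifferentiableAt I I' f x) (hh : MDifferentiableAt I' I h (f x)) :
    Function.Surjective (tder I I' f x) := fun v ↦ by
  refine ⟨tder I' I h (f x) v, ?_⟩
  have h1 := tder_comp (f := h) (h := f) (x := f x) (by rwa [hx]) hh v
  have h2 : f ∘ h = fun y ↦ y := funext hfh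
  rw [h2, tder_id, hx] at h1
  exact h1.symm

end TangentMapsProd

section Actions
set_option maxSynthPendingDepth 3

/-- The action vectors as elements of the model space. -/
def aVec (EG EN : Type*) {G N : Type*} [NormedAddCommGroup EG] [NormedSpace ℝ EG] [Group G]
    [TopologicalSpace G] [ChartedSpace EG G] [NormedAddCommGroup EN] [NormedSpace ℝ EN]
    [TopologicalSpace N] [ChartedSpace EN N] [MulAction G N] (x : N) : EG →L[ℝ] EN :=
  tder 𝓘(ℝ, EG) 𝓘(ℝ, EN) (fun a : G ↦ a • x) 1

theorem mdifferentiableAt_smul_const {EG G EN N : Type*} [NormedAddCommGroup EG]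
    [NormedSpace ℝ EG] [Group G] [TopologicalSpace G] [ChartedSpace EG G] [NormedAddCommGroup EN] [NormedSpace ℝ EN]
    [TopologicalSpace N] [ChartedSpace EN N] [MulAction G N]
    [ContMDiffSMul 𝓘(ℝ, EG) 𝓘(ℝ, EN) ∞ G N] (x : N) (a : G) :
    MDifferentiableAt 𝓘(ℝ, EG) 𝓘(ℝ, EN) (fun a : G ↦ a • x) a :=
  (contMDiffAt_id.smul contMDiffAt_const : ContMDiffAt 𝓘(ℝ, EG) 𝓘(ℝ, EN) ∞
    (fun a : G ↦ a • x) a).mdifferentiableAt infty_ne_zero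

end Actions

/-! ### The quotient map `P × F → M`: fibres and smoothness -/

namespace GBundle.PrincipalBundle

variable {EB B EF F EM M EG G EP P : Type*}
  [NormedAddCommGroup EB] [NormedSpace ℝ EB] [TopologicalSpace B] [ChartedSpace EB B]
  [NormedAddCommGroup EF] [NormedSpace ℝ EF] [TopologicalSpace F] [ChartedSpace EF F]
  [NormedAddCommGroup EM] [NormedSpace ℝ EM] [TopologicalSpace M] [ChartedSpace EM M]
  [NormedAddCommGroup EG] [NormedSpace ℝ EG] [TopologicalSpace G] [ChartedSpace EG G]
  [NormedAddCommGroup EP] [NormedSpace ℝ EP] [TopologicalSpace P] [ChartedSpace EP P]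
  [Group G] [MulAction G F] [MulAction G P]
  {ι : Type*} {ξ : GBundle ι EB B EF F EM M G} (pb : ξ.PrincipalBundle EG EP P)

theorem mem_base {i : ι} {b : B} (h : b ∈ (ξ.triv i).baseSet) : b ∈ (pb.triv i).baseSet := by
  rwa [pb.baseSet_eq]

theorem triv_eq {i : ι} {p : P} (h : pb.proj p ∈ (ξ.triv i).baseSet) :
    pb.triv i p = (pb.proj p, (pb.triv i p).2) :=
  ((pb.triv i).mk_proj_snd' (pb.mem_base h)).symm

theorem triv_symm_eq {i : ι} {p : P} (h : pb.proj p ∈ (ξ.triv i).baseSet) :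
    (pb.triv i).toOpenPartialHomeomorph.symm (pb.proj p, (pb.triv i p).2) = p :=
  (pb.triv i).symm_apply_mk_proj ((pb.triv i).mem_source.2 (pb.mem_base h))

/-- The definition uses an arbitrarily chosen index. A change of trivialization multiplies `a` on
the left by the transition function, which then acts on `a • f` exactly as in the transition of `M`.
-/
theorem quotientMap_eq {i : ι} {z : P × F} (h : pb.proj z.1 ∈ (ξ.triv i).baseSet) :
    pb.quotientMap z
      = (ξ.triv i).toOpenPartialHomeomorph.symm (pb.proj z.1, (pb.triv i z.1).2 • z.2) := by
  let j := (ξ.cover (pb.proj z.1)).choose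
  have hj : pb.proj z.1 ∈ (ξ.triv j).baseSet := (ξ.cover (pb.proj z.1)).choose_spec
  have h1 := pb.triv_triv_symm i j _ ⟨pb.mem_base h, pb.mem_base hj⟩ (pb.triv j z.1).2
  rw [pb.triv_symm_eq hj] at h1
  have h2 := ξ.triv_triv_symm i j _ ⟨h, hj⟩ ((pb.triv j z.1).2 • z.2)
  rw [h1, smul_smul] at *
  change _ = (pb.proj z.1, (ξ.trans i j (pb.proj z.1) * (pb.triv j z.1).2) • z.2) at h2
  change (ξ.triv j).toOpenPartialHomeomorph.symm (pb.proj z.1, (pb.triv j z.1).2 • z.2) = _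
  rw [← h2]
  refine ((ξ.triv i).toOpenPartialHomeomorph.left_inv ?_).symm
  refine (ξ.triv i).mem_source.2 ?_
  rwa [(ξ.triv j).proj_symm_apply' hj]

theorem triv_quotientMap {i : ι} {z : P × F} (h : pb.proj z.1 ∈ (ξ.triv i).baseSet) :
    ξ.triv i (pb.quotientMap z) = (pb.proj z.1, (pb.triv i z.1).2 • z.2) := by
  rw [pb.quotientMap_eq h, (ξ.triv i).apply_symm_apply' h]

theorem proj_quotientMap (z : P × F) : ξ.proj (pb.quotientMap z) = pb.proj z.1 := by
  obtain ⟨i, hi⟩ := ξ.cover (pb.proj z.1)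
  rw [pb.quotientMap_eq hi, (ξ.triv i).proj_symm_apply' hi]

theorem quotientMap_smul (r : G) (p : P) (f : F) :
    pb.quotientMap (r • p, r • f) = pb.quotientMap (p, f) := by
  obtain ⟨i, hi⟩ := ξ.cover (pb.proj p)
  have hi' : pb.proj (r • p) ∈ (ξ.triv i).baseSet := by rwa [pb.proj_smul]
  rw [pb.quotientMap_eq (z := (r • p, r • f)) hi', pb.quotientMap_eq (z := (p, f)) hi]
  simp only [pb.proj_smul, pb.triv_smul i r p (pb.mem_base hi), smul_smul, inv_mul_cancel_right]

theorem smul_eq_of_triv {i : ι} {p p' : P} (hi : pb.proj p ∈ (ξ.triv i).baseSet)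
    (hp : pb.proj p' = pb.proj p) : ((pb.triv i p').2⁻¹ * (pb.triv i p).2) • p = p' := by
  have hi' : pb.proj p' ∈ (ξ.triv i).baseSet := by rwa [hp]
  rw [← pb.triv_symm_eq hi', ← pb.triv_symm_eq (p := _ • p) (i := i) (by rwa [pb.proj_smul]),
    pb.triv_smul i _ p (pb.mem_base hi), pb.proj_smul, hp]
  simp [← hp, pb.triv_symm_eq hi']

/-- The fibres of the quotient map are orbits of the diagonal action: the group element is
determined by the group coordinates of the two points of `P`, and the equation in the fibre
coordinate then forces the second components to match. -/
theorem exists_smul_eq {z z' : P × F} (h : pb.quotientMap z' = pb.quotientMap z) :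
    ∃ r : G, z' = (r • z.1, r • z.2) := by
  have hp : pb.proj z'.1 = pb.proj z.1 := by rw [← pb.proj_quotientMap, h, pb.proj_quotientMap]
  obtain ⟨i, hi⟩ := ξ.cover (pb.proj z.1)
  have h1 := pb.triv_quotientMap (z := z') (i := i) (by rwa [hp])
  rw [h, pb.triv_quotientMap hi] at h1
  have h2 := (Prod.mk.inj h1).2
  refine ⟨(pb.triv i z'.1).2⁻¹ * (pb.triv i z.1).2, ?_⟩
  rw [pb.smul_eq_of_triv hi hp, mul_smul, h2, inv_smul_smul]

/-! ### Smoothness -/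

theorem contMDiffAt_triv {i : ι} {p : P} (hi : pb.proj p ∈ (ξ.triv i).baseSet) :
    ContMDiffAt 𝓘(ℝ, EP) (𝓘(ℝ, EB).prod 𝓘(ℝ, EG)) ∞ (pb.triv i) p :=
  (pb.smooth_triv i).contMDiffOn.contMDiffAt
    ((pb.triv i).open_source.mem_nhds ((pb.triv i).mem_source.2 (pb.mem_base hi)))

theorem contMDiffAt_triv_symm {i : ι} {x : B × G} (hi : x.1 ∈ (ξ.triv i).baseSet) :
    ContMDiffAt (𝓘(ℝ, EB).prod 𝓘(ℝ, EG)) 𝓘(ℝ, EP) ∞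
      (pb.triv i).toOpenPartialHomeomorph.symm x :=
  (pb.smooth_triv i).contMDiffOn_symm.contMDiffAt
    ((pb.triv i).open_target.mem_nhds ((pb.triv i).mem_target.2 (pb.mem_base hi)))

theorem eventually_mem_base {i : ι} {p : P} (hi : pb.proj p ∈ (ξ.triv i).baseSet) :
    ∀ᶠ p' in 𝓝 p, pb.proj p' ∈ (ξ.triv i).baseSet := by
  filter_upwards [(pb.triv i).open_source.mem_nhds
    ((pb.triv i).mem_source.2 (pb.mem_base hi))] with p' hp'
  rw [← pb.baseSet_eq]
  exact (pb.triv i).mem_source.1 hp'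

theorem contMDiff_proj : ContMDiff 𝓘(ℝ, EP) 𝓘(ℝ, EB) ∞ pb.proj := fun p ↦ by
  obtain ⟨i, hi⟩ := ξ.cover (pb.proj p)
  have h1 : ContMDiffAt 𝓘(ℝ, EP) 𝓘(ℝ, EB) ∞ (fun p ↦ (pb.triv i p).1) p :=
    contMDiffAt_fst.comp p (pb.contMDiffAt_triv hi)
  refine h1.congr_of_eventuallyEq ?_
  filter_upwards [pb.eventually_mem_base hi] with p' hp'
  rw [pb.triv_eq hp']

theorem contMDiffAt_triv_snd {i : ι} {p : P} (hi : pb.proj p ∈ (ξ.triv i).baseSet) :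
    ContMDiffAt 𝓘(ℝ, EP) 𝓘(ℝ, EG) ∞ (fun p ↦ (pb.triv i p).2) p :=
  contMDiffAt_snd.comp p (pb.contMDiffAt_triv hi)

/-- Smoothness of the principal action is read off from the trivializations, where the action is
right multiplication by the inverse. -/
theorem contMDiffSMul (pb : ξ.PrincipalBundle EG EP P) [LieGroup 𝓘(ℝ, EG) ∞ G] :
    ContMDiffSMul 𝓘(ℝ, EG) 𝓘(ℝ, EP) ∞ G P where
  contMDiff_smul := fun z ↦ by
    obtain ⟨i, hi⟩ := ξ.cover (pb.proj z.2)
    have hs : ContMDiffAt (𝓘(ℝ, EG).prod 𝓘(ℝ, EP)) 𝓘(ℝ, EP) ∞ (fun z : G × P ↦ z.2) z :=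
      contMDiffAt_snd
    have hf : ContMDiffAt (𝓘(ℝ, EG).prod 𝓘(ℝ, EP)) 𝓘(ℝ, EG) ∞ (fun z : G × P ↦ z.1) z :=
      contMDiffAt_fst
    have h1 : ContMDiffAt (𝓘(ℝ, EG).prod 𝓘(ℝ, EP)) (𝓘(ℝ, EB).prod 𝓘(ℝ, EG)) ∞
        (fun z : G × P ↦ (pb.proj z.2, (pb.triv i z.2).2 * z.1⁻¹)) z :=
      (pb.contMDiff_proj.contMDiffAt.comp z hs).prodMk
        (((pb.contMDiffAt_triv_snd hi).comp z hs).mul hf.inv)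
    have h2 := (pb.contMDiffAt_triv_symm (i := i) (x := (pb.proj z.2, (pb.triv i z.2).2 * z.1⁻¹))
      hi).comp z h1
    refine h2.congr_of_eventuallyEq ?_
    filter_upwards [hs.continuousAt.eventually (pb.eventually_mem_base hi)] with z' hz'
    rw [Function.comp_apply, ← pb.triv_symm_eq (i := i) (p := z'.1 • z'.2) (by rwa [pb.proj_smul]),
      pb.triv_smul i _ _ (pb.mem_base hz'), pb.proj_smul]

theorem contMDiffAt_fibre_triv {i : ι} {m : M} (hi : ξ.proj m ∈ (ξ.triv i).baseSet) :
    ContMDiffAt 𝓘(ℝ, EM) (𝓘(ℝ, EB).prod 𝓘(ℝ, EF)) ∞ (ξ.triv i) m :=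
  (ξ.smooth_triv i).contMDiffOn.contMDiffAt
    ((ξ.triv i).open_source.mem_nhds ((ξ.triv i).mem_source.2 hi))

theorem contMDiff_quotientMap [ContMDiffSMul 𝓘(ℝ, EG) 𝓘(ℝ, EF) ∞ G F] :
    ContMDiff (𝓘(ℝ, EP).prod 𝓘(ℝ, EF)) 𝓘(ℝ, EM) ∞ pb.quotientMap := fun z ↦ by
  obtain ⟨i, hi⟩ := ξ.cover (pb.proj z.1)
  have hf : ContMDiffAt (𝓘(ℝ, EP).prod 𝓘(ℝ, EF)) 𝓘(ℝ, EP) ∞ (fun z : P × F ↦ z.1) z :=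
    contMDiffAt_fst
  have hs : ContMDiffAt (𝓘(ℝ, EP).prod 𝓘(ℝ, EF)) 𝓘(ℝ, EF) ∞ (fun z : P × F ↦ z.2) z :=
    contMDiffAt_snd
  have h1 : ContMDiffAt (𝓘(ℝ, EP).prod 𝓘(ℝ, EF)) (𝓘(ℝ, EB).prod 𝓘(ℝ, EF)) ∞
      (fun z : P × F ↦ (pb.proj z.1, (pb.triv i z.1).2 • z.2)) z :=
    (pb.contMDiff_proj.contMDiffAt.comp z hf).prodMk
      (((pb.contMDiffAt_triv_snd hi).comp z hf).smul hs)
  have h0 : ContMDiffAt (𝓘(ℝ, EB).prod 𝓘(ℝ, EF)) 𝓘(ℝ, EM) ∞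
      (ξ.triv i).toOpenPartialHomeomorph.symm (pb.proj z.1, (pb.triv i z.1).2 • z.2) :=
    (ξ.smooth_triv i).contMDiffOn_symm.contMDiffAt
      ((ξ.triv i).open_target.mem_nhds ((ξ.triv i).mem_target.2 hi))
  refine (h0.comp z h1).congr_of_eventuallyEq ?_
  filter_upwards [hf.continuousAt.eventually (pb.eventually_mem_base hi)] with z' hz'
  exact pb.quotientMap_eq hz'

end GBundle.PrincipalBundle
end CheegerBundle
end

noncomputable section
namespace CheegerBundle
namespace GBundle.PrincipalBundle

section
set_option maxSynthPendingDepth 3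
set_option linter.unusedSectionVars false

variable {EB B EF F EM M EG G EP P : Type*}
  [NormedAddCommGroup EB] [NormedSpace ℝ EB] [TopologicalSpace B] [ChartedSpace EB B]
  [NormedAddCommGroup EF] [NormedSpace ℝ EF] [TopologicalSpace F] [ChartedSpace EF F]
  [NormedAddCommGroup EM] [NormedSpace ℝ EM] [TopologicalSpace M] [ChartedSpace EM M]
  [NormedAddCommGroup EG] [NormedSpace ℝ EG] [TopologicalSpace G] [ChartedSpace EG G]
  [NormedAddCommGroup EP] [NormedSpace ℝ EP] [TopologicalSpace P] [ChartedSpace EP P]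
  [Group G] [MulAction G F] [MulAction G P]
  {ι : Type*} {ξ : GBundle ι EB B EF F EM M G} (pb : ξ.PrincipalBundle EG EP P)
  [LieGroup 𝓘(ℝ, EG) ∞ G] [ContMDiffSMul 𝓘(ℝ, EG) 𝓘(ℝ, EF) ∞ G F]

/-- The differential of the quotient map `P × F → M`. -/
def dquot (z : P × F) : EP × EF →L[ℝ] EM :=
  tder (𝓘(ℝ, EP).prod 𝓘(ℝ, EF)) 𝓘(ℝ, EM) pb.quotientMap z

theorem mdifferentiableAt_quotientMap (z : P × F) :
    MDifferentiableAt (𝓘(ℝ, EP).prod 𝓘(ℝ, EF)) 𝓘(ℝ, EM) pb.quotientMap z :=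
  pb.contMDiff_quotientMap.mdifferentiableAt infty_ne_zero

/-- For fixed `p` with group coordinate `a`, the map `f ↦ [p, f]` has the smooth local left inverse
`a⁻¹ •` (fibre coordinate). -/
theorem dquot_injective {z : P × F} {w : EF} (h : pb.dquot z (0, w) = 0) : w = 0 := by
  obtain ⟨i, hi⟩ := ξ.cover (pb.proj z.1)
  let lam : M → F := fun m ↦ (pb.triv i z.1).2⁻¹ • (ξ.triv i m).2
  have hm : ξ.proj (pb.quotientMap z) ∈ (ξ.triv i).baseSet := by rwa [pb.proj_quotientMap]
  have hl : ContMDiffAt 𝓘(ℝ, EM) 𝓘(ℝ, EF) ∞ lam (pb.quotientMap z) :=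
    (contMDiffAt_const (c := (pb.triv i z.1).2⁻¹) (I' := 𝓘(ℝ, EG))).smul
      (contMDiffAt_snd.comp _ (contMDiffAt_fibre_triv hm))
  have hq := pb.mdifferentiableAt_quotientMap z
  have hq' : MDifferentiableAt 𝓘(ℝ, EF) 𝓘(ℝ, EM) (fun f ↦ pb.quotientMap (z.1, f)) z.2 :=
    hq.comp z.2 (mdifferentiableAt_const.prodMk mdifferentiableAt_id)
  have h1 := tder_comp (f := fun f ↦ pb.quotientMap (z.1, f)) (x := z.2)
    (hl.mdifferentiableAt infty_ne_zero) hq' w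
  rw [tder_right hq] at h1
  change _ = tder _ _ _ _ (pb.dquot z (0, w)) at h1
  rw [h, map_zero] at h1
  have h2 : (lam ∘ fun f ↦ pb.quotientMap (z.1, f)) = fun f ↦ f := by
    funext f
    simp only [Function.comp_apply, lam]
    rw [pb.triv_quotientMap (z := (z.1, f)) hi]
    simp
  rwa [h2, tder_id] at h1

/-- A local section through `z` is obtained by keeping the group coordinate of `z.1` constant and
solving for the point of `F`. -/
theorem dquot_surjective (z : P × F) : Function.Surjective (pb.dquot z) := by
  obtain ⟨i, hi⟩ := ξ.cover (pb.proj z.1)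
  set m₀ := pb.quotientMap z with hm₀
  have hm : ξ.proj m₀ ∈ (ξ.triv i).baseSet := by rwa [hm₀, pb.proj_quotientMap]
  let σP : M → P := fun m ↦ (pb.triv i).toOpenPartialHomeomorph.symm
    ((ξ.triv i m).1, (pb.triv i z.1).2)
  let σF : M → F := fun m ↦ (pb.triv i z.1).2⁻¹ • (ξ.triv i m).2
  have ht : ξ.triv i m₀ = (pb.proj z.1, (pb.triv i z.1).2 • z.2) := pb.triv_quotientMap hi
  have hσP : ContMDiffAt 𝓘(ℝ, EM) 𝓘(ℝ, EP) ∞ σP m₀ := by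
    have h1 : ContMDiffAt 𝓘(ℝ, EM) (𝓘(ℝ, EB).prod 𝓘(ℝ, EG)) ∞
        (fun m ↦ ((ξ.triv i m).1, (pb.triv i z.1).2)) m₀ :=
      (contMDiffAt_fst.comp _ (contMDiffAt_fibre_triv hm)).prodMk contMDiffAt_const
    refine (pb.contMDiffAt_triv_symm (i := i)
      (x := ((ξ.triv i m₀).1, (pb.triv i z.1).2)) ?_).comp m₀ h1
    rw [ht]
    exact hi
  have hσF : ContMDiffAt 𝓘(ℝ, EM) 𝓘(ℝ, EF) ∞ σF m₀ :=
    (contMDiffAt_const (c := (pb.triv i z.1).2⁻¹) (I' := 𝓘(ℝ, EG))).smul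
      (contMDiffAt_snd.comp _ (contMDiffAt_fibre_triv hm))
  have hσ : MDifferentiableAt 𝓘(ℝ, EM) (𝓘(ℝ, EP).prod 𝓘(ℝ, EF)) (fun m ↦ (σP m, σF m)) m₀ :=
    (hσP.prodMk hσF).mdifferentiableAt infty_ne_zero
  have hz : (σP m₀, σF m₀) = z := by
    simp only [σP, σF, ht, inv_smul_smul, pb.triv_symm_eq hi]
  have key : pb.quotientMap ∘ (fun m ↦ (σP m, σF m)) =ᶠ[𝓝 m₀] fun m ↦ m := by
    filter_upwards [(ξ.triv i).open_source.mem_nhds ((ξ.triv i).mem_source.2 hm)] with m hms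
    have hb := (ξ.triv i).mem_source.1 hms
    have h1 : pb.proj (σP m) = ξ.proj m := by
      simp only [σP]
      rw [(pb.triv i).proj_symm_apply' (by rw [(ξ.triv i).coe_fst hms]; exact pb.mem_base hb),
        (ξ.triv i).coe_fst hms]
    have h2 : (pb.triv i (σP m)).2 = (pb.triv i z.1).2 := by
      simp only [σP]
      rw [(pb.triv i).apply_symm_apply'
        (by rw [(ξ.triv i).coe_fst hms]; exact pb.mem_base hb)]
    rw [Function.comp_apply, pb.quotientMap_eq (i := i) (z := (σP m, σF m)) (by rwa [h1]), h1, h2]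
    simp only [σF, smul_inv_smul]
    exact (ξ.triv i).symm_apply_mk_proj hms
  intro v
  refine ⟨tder 𝓘(ℝ, EM) (𝓘(ℝ, EP).prod 𝓘(ℝ, EF)) (fun m ↦ (σP m, σF m)) m₀ v, ?_⟩
  have h3 := tder_comp (f := fun m ↦ (σP m, σF m)) (x := m₀) (h := pb.quotientMap)
    (pb.mdifferentiableAt_quotientMap _) hσ v
  rw [tder_congr key, tder_id] at h3
  simp only [hz] at h3
  exact h3.symm

theorem dquot_aVec (p : P) (f : F) (u : EG) :
    pb.dquot (p, f) (aVec EG EP (G := G) p u, aVec EG EF (G := G) f u) = 0 := by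
  have := pb.contMDiffSMul
  have h1 := mdifferentiableAt_smul_const (EG := EG) (G := G) (EN := EP) p 1
  have h2 := mdifferentiableAt_smul_const (EG := EG) (G := G) (EN := EF) f 1
  have h3 := tder_comp (f := fun a : G ↦ (a • p, a • f)) (x := 1) (h := pb.quotientMap)
    (pb.mdifferentiableAt_quotientMap _) (h1.prodMk h2) u
  rw [tder_prodMk h1 h2] at h3
  have h4 : (pb.quotientMap ∘ fun a : G ↦ (a • p, a • f)) = fun _ ↦ pb.quotientMap (p, f) := by
    funext a
    exact pb.quotientMap_smul a p f
  rw [h4, tder_const] at h3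
  simp only [one_smul] at h3
  exact h3.symm

/-- Projecting to `B` shows that `x` is vertical, so it is an action vector for some `u`.
Subtracting the diagonal action vector of `u`, which is also in the kernel, leaves a vector tangent
to `F`, and `dquot_injective` applies. -/
theorem dquot_kernel {p : P} {f : F} {x : EP} {w : EF} (h : pb.dquot (p, f) (x, w) = 0) :
    ∃ u : EG, x = aVec EG EP (G := G) p u ∧ w = aVec EG EF (G := G) f u := by
  have := pb.contMDiffSMul
  obtain ⟨i, hi⟩ := ξ.cover (pb.proj p)
  -- the vector `x` is vertical
  have hproj : tder 𝓘(ℝ, EP) 𝓘(ℝ, EB) pb.proj p x = 0 := by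
    have hm : ξ.proj (pb.quotientMap (p, f)) ∈ (ξ.triv i).baseSet := by rwa [pb.proj_quotientMap]
    have h1 : MDifferentiableAt 𝓘(ℝ, EM) 𝓘(ℝ, EB) (fun m ↦ (ξ.triv i m).1)
        (pb.quotientMap (p, f)) :=
      (contMDiffAt_fst.comp _ (contMDiffAt_fibre_triv hm)).mdifferentiableAt infty_ne_zero
    have h2 := tder_comp (f := pb.quotientMap) (x := (p, f)) h1
      (pb.mdifferentiableAt_quotientMap _) (x, w)
    change _ = tder _ _ _ _ (pb.dquot (p, f) (x, w)) at h2
    rw [h, map_zero] at h2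
    have h3 : ((fun m ↦ (ξ.triv i m).1) ∘ pb.quotientMap) =ᶠ[𝓝 (p, f)] pb.proj ∘ Prod.fst := by
      filter_upwards [continuousAt_fst.eventually (pb.eventually_mem_base hi)] with z hz
      simp only [Function.comp_apply]
      rw [pb.triv_quotientMap hz]
    rw [tder_congr h3, tder_comp (pb.contMDiff_proj.mdifferentiableAt infty_ne_zero)
      mdifferentiableAt_fst, tder_fst] at h2
    exact h2
  let c : P → G := fun p' ↦ (pb.triv i p').2
  have hc : ContMDiffAt 𝓘(ℝ, EP) 𝓘(ℝ, EG) ∞ c p := pb.contMDiffAt_triv_snd hi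
  -- The point `ρ p' • p` lies in the fibre of `p` and has the group coordinate of `p'`. As `x` is
  -- vertical, the derivative of `p' ↦ ρ p' • p` along `x` is `x` itself, which exhibits `x` as an
  -- action vector.
  let ρ : P → G := fun p' ↦ (c p')⁻¹ * c p
  have hρ : ContMDiffAt 𝓘(ℝ, EP) 𝓘(ℝ, EG) ∞ ρ p := hc.inv.mul contMDiffAt_const
  have hρp : ρ p = 1 := by simp [ρ]
  have hσ : MDifferentiableAt (𝓘(ℝ, EB).prod 𝓘(ℝ, EG)) 𝓘(ℝ, EP)
      (pb.triv i).toOpenPartialHomeomorph.symm (pb.proj p, c p) :=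
    (pb.contMDiffAt_triv_symm (i := i) (x := (pb.proj p, c p)) hi).mdifferentiableAt infty_ne_zero
  have hpd : MDifferentiableAt 𝓘(ℝ, EP) 𝓘(ℝ, EB) pb.proj p :=
    pb.contMDiff_proj.mdifferentiableAt infty_ne_zero
  have hcd := hc.mdifferentiableAt infty_ne_zero
  have hx : x = aVec EG EP (G := G) p (tder 𝓘(ℝ, EP) 𝓘(ℝ, EG) ρ p x) := by
    have e1 := tder_comp (f := fun p' ↦ (pb.proj p', c p')) (x := p) hσ (hpd.prodMk hcd) x
    rw [tder_prodMk hpd hcd, hproj] at e1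
    have e2 := tder_comp (f := fun p' ↦ (pb.proj p, c p')) (x := p) hσ
      (mdifferentiableAt_const.prodMk hcd) x
    rw [tder_prodMk (I' := 𝓘(ℝ, EB)) mdifferentiableAt_const hcd, tder_const, ← e1] at e2
    have e3 : (pb.triv i).toOpenPartialHomeomorph.symm ∘ (fun p' ↦ (pb.proj p', c p'))
        =ᶠ[𝓝 p] fun p' ↦ p' := by
      filter_upwards [pb.eventually_mem_base hi] with p' hp'
      exact pb.triv_symm_eq hp'
    have e4 : (pb.triv i).toOpenPartialHomeomorph.symm ∘ (fun p' ↦ (pb.proj p, c p'))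
        = (fun a : G ↦ a • p) ∘ ρ := by
      funext p'
      have hs : pb.proj ((pb.triv i).toOpenPartialHomeomorph.symm (pb.proj p, c p'))
          = pb.proj p := (pb.triv i).proj_symm_apply' (pb.mem_base hi)
      have := pb.smul_eq_of_triv hi hs
      rw [(pb.triv i).apply_symm_apply' (pb.mem_base hi)] at this
      exact this.symm
    rw [tder_congr e3, tder_id, e4, tder_comp (x := p) (mdifferentiableAt_smul_const p (ρ p))
      (hρ.mdifferentiableAt infty_ne_zero), hρp] at e2
    exact e2.symm
  refine ⟨tder 𝓘(ℝ, EP) 𝓘(ℝ, EG) ρ p x, hx, ?_⟩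
  set u := tder 𝓘(ℝ, EP) 𝓘(ℝ, EG) ρ p x
  have h5 := pb.dquot_aVec p f u
  rw [← hx] at h5
  have h6 : pb.dquot (p, f) (0, w - aVec EG EF (G := G) f u) = 0 := by
    have : ((0 : EP), w - aVec EG EF (G := G) f u) = (x, w) - (x, aVec EG EF (G := G) f u) := by
      simp
    rw [this, map_sub, h, h5, sub_zero]
  exact sub_eq_zero.1 (pb.dquot_injective h6)

end
end GBundle.PrincipalBundle
end CheegerBundle
end

noncomputable section
namespace CheegerBundle

/-! ### Submersion metrics whose fibres are orbits of isometries -/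

section SubmersionMetrics
set_option maxSynthPendingDepth 3

variable {E H : Type*} [NormedAddCommGroup E] [NormedSpace ℝ E] [TopologicalSpace H]
  {I : ModelWithCorners ℝ E H} {N : Type*} [TopologicalSpace N] [ChartedSpace H N]
  {E' H' : Type*} [NormedAddCommGroup E'] [NormedSpace ℝ E'] [TopologicalSpace H']
  {J : ModelWithCorners ℝ E' H'} {M : Type*} [TopologicalSpace M] [ChartedSpace H' M]

/-- `u` is orthogonal to the kernel of the differential of `q` at `x`. -/
def IsHor (J : ModelWithCorners ℝ E' H') (k : MetricField I N) (q : N → M) (x : N) (u : E) : Prop :=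
  ∀ w, tder I J q x w = 0 → plain k x u w = 0

theorem IsHorizontalLift.base {k : MetricField I N} {q : N → M} {x : N} {ξ : TangentSpace I x}
    {y : M} {v : E'} (h : IsHorizontalLift J k q x ξ ⟨y, v⟩) : q x = y :=
  congrArg TotalSpace.proj h.1

theorem IsHorizontalLift.tder_eq {k : MetricField I N} {q : N → M} {x : N} {ξ : TangentSpace I x}
    {y : M} {v : E'} (h : IsHorizontalLift J k q x ξ ⟨y, v⟩) : tder I J q x ξ = v := by
  have h1 : HEq (tangentMap I J q ⟨x, ξ⟩).2 v := by
    have := congr_arg_heq (fun z : TangentBundle J M ↦ z.2) h.1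
    exact this
  exact eq_of_heq h1

/-- The submersion metric is well defined when the fibres of `q` are orbits of isometries. -/
theorem submersionMetric_apply {k : MetricField I N} {q : N → M} {x : N} {u v : E}
    (hadd : ∀ z u v w, plain k z (u + v) w = plain k z u w + plain k z v w)
    (hsymm : ∀ z u v, plain k z u v = plain k z v u)
    (hiso : ∀ x', q x' = q x → ∃ s : N → N, s x = x' ∧ q ∘ s = q ∧ MDifferentiableAt I I s x ∧
      Function.Surjective (tder I I s x) ∧
      ∀ u v, plain k (s x) (tder I I s x u) (tder I I s x v) = plain k x u v)
    (hq : ∀ x, MDifferentiableAt I J q x) (hu : IsHor J k q x u) (hv : IsHor J k q x v) :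
    plain (submersionMetric J k q) (q x) (tder I J q x u) (tder I J q x v) = plain k x u v := by
  have key : ∃ r, ∃ (x' : N) (ξ ζ : TangentSpace I x'),
      IsHorizontalLift J k q x' ξ ⟨q x, tder I J q x u⟩ ∧
      IsHorizontalLift J k q x' ζ ⟨q x, tder I J q x v⟩ ∧ r = k x' ξ ζ :=
    ⟨k x u v, x, u, v, ⟨rfl, hu⟩, ⟨rfl, hv⟩, rfl⟩
  obtain ⟨x', ξ, ζ, hξ, hζ, hr⟩ := Classical.epsilon_spec key
  refine hr.trans ?_
  -- The lifts picked by `Classical.epsilon` may sit at another point of the fibre. An isometry over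
  -- the identity of `M` carries `u` and `v` there as horizontal vectors, and horizontal lifts at
  -- one point have the same pairings.
  obtain ⟨s, rfl, hqs, hsd, hss, hsk⟩ := hiso x' hξ.base
  have chain : ∀ w, tder I J q (s x) (tder I I s x w) = tder I J q x w := fun w ↦ by
    rw [← tder_comp (hq _) hsd, hqs]
  have hor : ∀ {w}, IsHor J k q x w → IsHor J k q (s x) (tder I I s x w) := fun {w} hw η hη ↦ by
    obtain ⟨η', rfl⟩ := hss η
    rw [hsk]
    exact hw η' (by rwa [chain] at hη)
  -- a horizontal lift is unique
  have uniq : ∀ {ξ w w' : E}, IsHor J k q (s x) w' → tder I J q (s x) ξ = tder I J q (s x) w →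
      plain k (s x) ξ w' = plain k (s x) w w' := by
    intro ξ w w' hw' h
    have h1 := hadd (s x) w (ξ - w) w'
    rw [add_sub_cancel, hsymm (s x) (ξ - w), hw' (ξ - w) (by rw [map_sub, h, sub_self]),
      add_zero] at h1
    exact h1
  have h1 : plain k (s x) ξ ζ = plain k (s x) (tder I I s x u) ζ :=
    uniq hζ.2 (by rw [chain, hξ.tder_eq])
  have h2 : plain k (s x) ζ (tder I I s x u) = plain k (s x) (tder I I s x v) (tder I I s x u) :=
    uniq (hor hu) (by rw [chain, hζ.tder_eq])
  exact h1.trans ((hsymm _ _ _).trans (h2.trans ((hsymm _ _ _).trans (hsk _ _))))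

/-- Subtract from any lift its orthogonal projection to the kernel. -/
theorem exists_orthogonal_lift {V W : Type*} [AddCommGroup V] [Module ℝ V] [FiniteDimensional ℝ V]
    [AddCommGroup W] [Module ℝ W] {b : V → V → ℝ} {β : V →ₗ[ℝ] V →ₗ[ℝ] ℝ}
    (hb : ∀ u v, b u v = β u v) (hs : ∀ u v, β u v = β v u) (hpos : ∀ u, u ≠ 0 → 0 < β u u)
    {T : V →ₗ[ℝ] W} (hT : Function.Surjective T) (w : W) :
    ∃ v, T v = w ∧ ∀ z, T z = 0 → b v z = 0 := by
  classical
  obtain ⟨v, rfl⟩ := hT w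
  obtain ⟨n, e, he⟩ := exists_isOrthonormalBasisOf hb hs hpos (LinearMap.ker T)
  have hmem : ∀ i, T (e i) = 0 := fun i ↦ by
    have : e i ∈ LinearMap.ker T := he.2.2 ▸ Submodule.subset_span (mem_range_self i)
    exact this
  refine ⟨v - ∑ i, β v (e i) • e i, by simp [hmem], fun z hz ↦ ?_⟩
  rw [hb, he.eq_sum hb (v := z) hz]
  rw [map_sum]
  refine Finset.sum_eq_zero fun j _ ↦ ?_
  rw [map_smul, map_sub, map_sum, LinearMap.sub_apply, LinearMap.sum_apply,
    Finset.sum_eq_single j]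
  · rw [map_smul, LinearMap.smul_apply, ← hb (e j), he.1 j]
    simp
  · intro i _ hij
    rw [map_smul, LinearMap.smul_apply, ← hb (e i) (e j), he.2.1 i j hij, smul_zero]
  · simp

end SubmersionMetrics

/-! ### The Cheeger deformation: well-definedness, bilinearity and invariance -/

section Cheeger
set_option maxSynthPendingDepth 3
set_option linter.unusedSectionVars false

variable {EG G : Type*} [NormedAddCommGroup EG] [NormedSpace ℝ EG] [Group G] [TopologicalSpace G]
  [ChartedSpace EG G] [LieGroup 𝓘(ℝ, EG) ∞ G]
  {EN N : Type*} [NormedAddCommGroup EN] [NormedSpace ℝ EN] [TopologicalSpace N]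
  [ChartedSpace EN N] [IsManifold 𝓘(ℝ, EN) ∞ N] [MulAction G N]

/-- The inner product of a metric as a bilinear form on the model space. -/
def mform (g : Metric EN N) (x : N) : EN →L[ℝ] EN →L[ℝ] ℝ := g.inner x

theorem mform_symm (g : Metric EN N) (x : N) (u v : EN) : mform g x u v = mform g x v u :=
  g.symm x u v

theorem mform_pos (g : Metric EN N) (x : N) (u : EN) (hu : u ≠ 0) : 0 < mform g x u u :=
  g.pos x u hu

/-- The metric `g × t⁻¹ Q` on `N × G`. -/
def cheegerTotal (g : Metric EN N) (Q : Metric EG G) (t : ℝ) :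
    MetricField (𝓘(ℝ, EN).prod 𝓘(ℝ, EG)) (N × G) :=
  prodMetric g.field (fun a u v ↦ t⁻¹ * Q.field a u v)

theorem plain_cheegerTotal (g : Metric EN N) (Q : Metric EG G) (t : ℝ) (z : N × G)
    (u v : EN × EG) : plain (cheegerTotal g Q t) z u v
      = mform g z.1 u.1 v.1 + t⁻¹ * mform Q z.2 u.2 v.2 := rfl

variable [ContMDiffSMul 𝓘(ℝ, EG) 𝓘(ℝ, EN) ∞ G N]

/-- The differential of `(x, a) ↦ a • x`. -/
def dact (EN EG : Type*) {N G : Type*} [NormedAddCommGroup EG] [NormedSpace ℝ EG] [Group G]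
    [TopologicalSpace G] [ChartedSpace EG G] [NormedAddCommGroup EN] [NormedSpace ℝ EN]
    [TopologicalSpace N] [ChartedSpace EN N] [MulAction G N] (z : N × G) : EN × EG →L[ℝ] EN :=
  tder (𝓘(ℝ, EN).prod 𝓘(ℝ, EG)) 𝓘(ℝ, EN) (fun z : N × G ↦ z.2 • z.1) z

theorem contMDiff_act : ContMDiff (𝓘(ℝ, EN).prod 𝓘(ℝ, EG)) 𝓘(ℝ, EN) ∞
    (fun z : N × G ↦ z.2 • z.1) :=
  contMDiff_snd.smul contMDiff_fst

theorem mdifferentiableAt_act (z : N × G) :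
    MDifferentiableAt (𝓘(ℝ, EN).prod 𝓘(ℝ, EG)) 𝓘(ℝ, EN) (fun z : N × G ↦ z.2 • z.1) z :=
  contMDiff_act.mdifferentiableAt infty_ne_zero

/-- The differential of the action of a group element. -/
def dsm (EN : Type*) {N G : Type*} [Group G] [NormedAddCommGroup EN] [NormedSpace ℝ EN]
    [TopologicalSpace N] [ChartedSpace EN N] [MulAction G N] (a : G) (x : N) : EN →L[ℝ] EN :=
  tder 𝓘(ℝ, EN) 𝓘(ℝ, EN) (fun x : N ↦ a • x) x

theorem mdifferentiableAt_const_smul (EG : Type*) [NormedAddCommGroup EG] [NormedSpace ℝ EG]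
    [ChartedSpace EG G] [ContMDiffSMul 𝓘(ℝ, EG) 𝓘(ℝ, EN) ∞ G N] (a : G) (x : N) :
    MDifferentiableAt 𝓘(ℝ, EN) 𝓘(ℝ, EN) (fun x : N ↦ a • x) x :=
  (contMDiffAt_const (c := a) (I' := 𝓘(ℝ, EG)).smul contMDiffAt_id : ContMDiffAt 𝓘(ℝ, EN) 𝓘(ℝ, EN) ∞
    (fun x : N ↦ a • x) x).mdifferentiableAt infty_ne_zero

theorem dsm_inv (EG : Type*) [NormedAddCommGroup EG] [NormedSpace ℝ EG]
    [ChartedSpace EG G] [ContMDiffSMul 𝓘(ℝ, EG) 𝓘(ℝ, EN) ∞ G N] (a : G) (x : N) (u : EN) :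
    dsm EN a⁻¹ (a • x) (dsm EN a x u) = u := by
  have h := tder_comp (f := fun x : N ↦ a • x) (h := fun x : N ↦ a⁻¹ • x) (x := x)
    (mdifferentiableAt_const_smul EG a⁻¹ _) (mdifferentiableAt_const_smul EG a x) u
  have h2 : ((fun x : N ↦ a⁻¹ • x) ∘ fun x : N ↦ a • x) = fun x ↦ x := by
    funext x; simp
  rw [h2, tder_id] at h
  exact h.symm

theorem dsm_inv' (EG : Type*) [NormedAddCommGroup EG] [NormedSpace ℝ EG]
    [ChartedSpace EG G] [ContMDiffSMul 𝓘(ℝ, EG) 𝓘(ℝ, EN) ∞ G N] (a : G) (x : N) (u : EN) :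
    dsm EN a x (dsm EN a⁻¹ (a • x) u) = u := by
  have h := dsm_inv EG a⁻¹ (a • x) u
  rwa [inv_inv, inv_smul_smul] at h

theorem dact_left (z : N × G) (u : EN) : dact EN EG z (u, 0) = dsm EN z.2 z.1 u :=
  (tder_left (mdifferentiableAt_act z) u).symm

theorem dact_surjective (z : N × G) : Function.Surjective (dact EN EG z) := fun v ↦
  ⟨(dsm EN z.2⁻¹ (z.2 • z.1) v, 0), by rw [dact_left, dsm_inv' EG]⟩

theorem dact_one (x : N) (u : EN) (w : EG) :
    dact EN EG (x, (1 : G)) (u, w) = u + aVec EG EN (G := G) x w := by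
  have h1 : (u, w) = (u, (0 : EG)) + ((0 : EN), w) := by simp
  rw [h1, map_add, dact_left]
  congr 1
  · simp only [dsm, one_smul]
    exact tder_id _ _
  · exact (tder_right (mdifferentiableAt_act (x, (1 : G))) w).symm

theorem IsInvariant.plain_dsm {g : Metric EN N} (hg : IsInvariant G g) (a : G) (x : N) (u v : EN) :
    mform g (a • x) (dsm EN a x u) (dsm EN a x v) = mform g x u v :=
  hg a x u v

/-- The fibres of `(x, a) ↦ a • x` are the orbits of `(x, a) ↦ (c • x, a c⁻¹)`, which are isometries
by the invariance of `g` and the right invariance of `Q`. -/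
theorem cheegerDeformation_apply {g : Metric EN N} {Q : Metric EG G} (hg : IsInvariant G g)
    (hQ : IsBiinvariant Q) {t : ℝ} {z : N × G} {u v : EN × EG}
    (hu : IsHor 𝓘(ℝ, EN) (cheegerTotal g Q t) (fun z : N × G ↦ z.2 • z.1) z u)
    (hv : IsHor 𝓘(ℝ, EN) (cheegerTotal g Q t) (fun z : N × G ↦ z.2 • z.1) z v) :
    plain (cheegerDeformation g Q t) (z.2 • z.1) (dact EN EG z u) (dact EN EG z v)
      = plain (cheegerTotal g Q t) z u v := by
  refine submersionMetric_apply (k := cheegerTotal g Q t) ?_ ?_ ?_ mdifferentiableAt_act hu hv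
  · intro z u v w
    simp only [plain_cheegerTotal, Prod.fst_add, Prod.snd_add, map_add, add_apply]
    ring
  · intro z u v
    simp only [plain_cheegerTotal, mform_symm g _ u.1, mform_symm Q _ u.2]
  · intro x' hx'
    set c := x'.2⁻¹ * z.2 with hc
    have hR : MDifferentiableAt 𝓘(ℝ, EG) 𝓘(ℝ, EG) (fun a : G ↦ a * c⁻¹) z.2 :=
      (contMDiff_mul_right (n := ∞)).mdifferentiableAt infty_ne_zero
    have hL := mdifferentiableAt_const_smul (EN := EN) EG c z.1
    have hds := tder_prodMap (x := z) hL hR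
    refine ⟨fun w ↦ (c • w.1, w.2 * c⁻¹), ?_, ?_, ?_, ?_, ?_⟩
    · ext
      · simp only [hc, mul_smul]
        rw [← hx', inv_smul_smul]
      · simp [hc]
    · funext w
      simp only [Function.comp_apply, mul_smul, inv_smul_smul]
    · exact (hL.comp z mdifferentiableAt_fst).prodMk (hR.comp z mdifferentiableAt_snd)
    · rintro ⟨a, b⟩
      obtain ⟨b', hb'⟩ := tder_surjective (f := fun a : G ↦ a * c⁻¹) (h := fun a : G ↦ a * c)
        (x := z.2) (by simp) (by simp) hR
        ((contMDiff_mul_right (n := ∞)).mdifferentiableAt infty_ne_zero) b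
      refine ⟨(dsm EN c⁻¹ (c • z.1) a, b'), ?_⟩
      rw [hds, hb']
      exact Prod.ext (dsm_inv' EG c z.1 a) rfl
    · intro u v
      rw [hds, hds, plain_cheegerTotal, plain_cheegerTotal]
      congr 1
      · exact hg.plain_dsm c z.1 u.1 v.1
      · congr 1
        exact (hQ c⁻¹).2 z.2 u.2 v.2

theorem exists_cheeger_lift [FiniteDimensional ℝ EN] [FiniteDimensional ℝ EG] (g : Metric EN N)
    (Q : Metric EG G) {t : ℝ} (ht : 0 < t) (z : N × G) (X : EN) : ∃ u, dact EN EG z u = X ∧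
      IsHor 𝓘(ℝ, EN) (cheegerTotal g Q t) (fun z : N × G ↦ z.2 • z.1) z u := by
  let β : (EN × EG) →ₗ[ℝ] (EN × EG) →ₗ[ℝ] ℝ := LinearMap.mk₂ ℝ
    (fun u v ↦ mform g z.1 u.1 v.1 + t⁻¹ * mform Q z.2 u.2 v.2)
    (by intro a b c; simp; ring) (by intro a b c; simp; ring)
    (by intro a b c; simp; ring) (by intro a b c; simp; ring)
  refine exists_orthogonal_lift (β := β) (b := plain (cheegerTotal g Q t) z)
    (T := (dact EN EG z).toLinearMap) (fun _ _ ↦ rfl) ?_ ?_ (dact_surjective z) X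
  · intro u v
    change mform g z.1 u.1 v.1 + t⁻¹ * mform Q z.2 u.2 v.2
      = mform g z.1 v.1 u.1 + t⁻¹ * mform Q z.2 v.2 u.2
    rw [mform_symm g, mform_symm Q]
  · intro u hu
    change 0 < mform g z.1 u.1 u.1 + t⁻¹ * mform Q z.2 u.2 u.2
    have hti : 0 < t⁻¹ := inv_pos.2 ht
    have n1 : 0 ≤ mform g z.1 u.1 u.1 := by
      by_cases h : u.1 = 0
      · simp [h]
      · exact (mform_pos g _ _ h).le
    have n2 : 0 ≤ mform Q z.2 u.2 u.2 := by
      by_cases h : u.2 = 0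
      · simp [h]
      · exact (mform_pos Q _ _ h).le
    by_cases h : u.1 = 0
    · have h2 : u.2 ≠ 0 := fun h2 ↦ hu (Prod.ext h h2)
      have := mul_pos hti (mform_pos Q z.2 _ h2)
      linarith
    · have := mform_pos g z.1 _ h
      have := mul_nonneg hti.le n2
      linarith

theorem IsHor.add_cheeger {g : Metric EN N} {Q : Metric EG G} {t : ℝ} {z : N × G} {u v : EN × EG}
    (hu : IsHor 𝓘(ℝ, EN) (cheegerTotal g Q t) (fun z : N × G ↦ z.2 • z.1) z u)
    (hv : IsHor 𝓘(ℝ, EN) (cheegerTotal g Q t) (fun z : N × G ↦ z.2 • z.1) z v) :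
    IsHor 𝓘(ℝ, EN) (cheegerTotal g Q t) (fun z : N × G ↦ z.2 • z.1) z (u + v) := fun w hw ↦ by
  have h1 := hu w hw
  have h2 := hv w hw
  simp only [plain_cheegerTotal, Prod.fst_add, Prod.snd_add, map_add, add_apply] at *
  linarith

variable [FiniteDimensional ℝ EN] [FiniteDimensional ℝ EG] {g : Metric EN N} {Q : Metric EG G}
  {t : ℝ}

/-- The deformed metric is a bare pairing defined by a choice, so symmetry and additivity are not
automatic. They are inherited from the product metric through lifts at `(x, 1)`, and are needed to
apply `submersionMetric_apply` once more. -/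
theorem cheegerDeformation_symm (hg : IsInvariant G g) (hQ : IsBiinvariant Q) (ht : 0 < t) (x : N)
    (X Y : EN) :
    plain (cheegerDeformation g Q t) x X Y = plain (cheegerDeformation g Q t) x Y X := by
  obtain ⟨u, rfl, hu⟩ := exists_cheeger_lift g Q ht (x, (1 : G)) X
  obtain ⟨v, rfl, hv⟩ := exists_cheeger_lift g Q ht (x, (1 : G)) Y
  have h1 := cheegerDeformation_apply hg hQ hu hv
  have h2 := cheegerDeformation_apply hg hQ hv hu
  simp only [one_smul] at h1 h2
  rw [h1, h2, plain_cheegerTotal, plain_cheegerTotal, mform_symm g, mform_symm Q]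

theorem cheegerDeformation_add (hg : IsInvariant G g) (hQ : IsBiinvariant Q) (ht : 0 < t) (x : N)
    (X X' Y : EN) : plain (cheegerDeformation g Q t) x (X + X') Y
      = plain (cheegerDeformation g Q t) x X Y + plain (cheegerDeformation g Q t) x X' Y := by
  obtain ⟨u, rfl, hu⟩ := exists_cheeger_lift g Q ht (x, (1 : G)) X
  obtain ⟨u', rfl, hu'⟩ := exists_cheeger_lift g Q ht (x, (1 : G)) X'
  obtain ⟨v, rfl, hv⟩ := exists_cheeger_lift g Q ht (x, (1 : G)) Y
  have h1 := cheegerDeformation_apply hg hQ hu hv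
  have h2 := cheegerDeformation_apply hg hQ hu' hv
  have h3 := cheegerDeformation_apply hg hQ (hu.add_cheeger hu') hv
  simp only [one_smul] at h1 h2 h3
  rw [← map_add, h1, h2, h3]
  simp only [plain_cheegerTotal, Prod.fst_add, Prod.snd_add, map_add, add_apply]
  ring

/-- The map `(x, a) ↦ (x, r a)` covers the action of `r` and is an isometry because `Q` is left
invariant; so it carries horizontal lifts to horizontal lifts. -/
theorem cheegerDeformation_dsm (hg : IsInvariant G g) (hQ : IsBiinvariant Q) (ht : 0 < t) (r : G)
    (x : N) (X Y : EN) :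
    plain (cheegerDeformation g Q t) (r • x) (dsm EN r x X) (dsm EN r x Y)
      = plain (cheegerDeformation g Q t) x X Y := by
  have hL : MDifferentiableAt 𝓘(ℝ, EG) 𝓘(ℝ, EG) (fun a : G ↦ r * a) 1 :=
    (contMDiff_mul_left (n := ∞)).mdifferentiableAt infty_ne_zero
  let dL := tder 𝓘(ℝ, EG) 𝓘(ℝ, EG) (fun a : G ↦ r * a) 1
  have hds := tder_prodMap (f := fun x : N ↦ x) (x := (x, (1 : G)))
    (mdifferentiableAt_id (I := 𝓘(ℝ, EN))) hL
  simp only [tder_id] at hds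
  have hsd : MDifferentiableAt (𝓘(ℝ, EN).prod 𝓘(ℝ, EG)) (𝓘(ℝ, EN).prod 𝓘(ℝ, EG))
      (fun z : N × G ↦ (z.1, r * z.2)) (x, 1) :=
    (mdifferentiableAt_fst (x := (x, (1 : G)))).prodMk (hL.comp (x, (1 : G)) mdifferentiableAt_snd)
  have chain : ∀ u : EN × EG, dact EN EG (x, r * 1) (u.1, dL u.2)
      = dsm EN r x (dact EN EG (x, (1 : G)) u) := by
    intro u
    have e1 := tder_comp (f := fun z : N × G ↦ (z.1, r * z.2)) (h := fun z : N × G ↦ z.2 • z.1)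
      (x := (x, 1)) (mdifferentiableAt_act _) hsd u
    rw [hds] at e1
    have e2 : ((fun z : N × G ↦ z.2 • z.1) ∘ fun z : N × G ↦ (z.1, r * z.2))
        = (fun x : N ↦ r • x) ∘ fun z : N × G ↦ z.2 • z.1 := by
      funext z
      simp [mul_smul]
    rw [e2, tder_comp (mdifferentiableAt_const_smul EG r _) (mdifferentiableAt_act _)] at e1
    simp only [one_smul] at e1
    exact e1.symm
  have hsurj : Function.Surjective dL :=
    tder_surjective (f := fun a : G ↦ r * a) (h := fun a : G ↦ r⁻¹ * a) (by simp) (by simp) hL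
      ((contMDiff_mul_left (n := ∞)).mdifferentiableAt infty_ne_zero)
  have inv : ∀ u v : EN × EG, plain (cheegerTotal g Q t) (x, r * 1) (u.1, dL u.2) (v.1, dL v.2)
      = plain (cheegerTotal g Q t) (x, 1) u v := by
    intro u v
    rw [plain_cheegerTotal, plain_cheegerTotal]
    congr 2
    exact (hQ r).1 1 u.2 v.2
  have hor : ∀ {u : EN × EG},
      IsHor 𝓘(ℝ, EN) (cheegerTotal g Q t) (fun z : N × G ↦ z.2 • z.1) (x, (1 : G)) u →
      IsHor 𝓘(ℝ, EN) (cheegerTotal g Q t) (fun z : N × G ↦ z.2 • z.1) (x, r * 1)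
        (u.1, dL u.2) := by
    rintro u hu ⟨w1, w2⟩ hw
    obtain ⟨w2, rfl⟩ := hsurj w2
    rw [inv u (w1, w2)]
    refine hu _ ?_
    have h1 := chain (w1, w2)
    have h2 : dact EN EG (x, r * 1) (w1, dL w2) = 0 := hw
    rw [h2] at h1
    have h3 := dsm_inv EG r x (dact EN EG (x, (1 : G)) (w1, w2))
    rw [← h1, map_zero] at h3
    exact h3.symm
  obtain ⟨u, rfl, hu⟩ := exists_cheeger_lift g Q ht (x, (1 : G)) X
  obtain ⟨v, rfl, hv⟩ := exists_cheeger_lift g Q ht (x, (1 : G)) Y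
  have h1 := cheegerDeformation_apply hg hQ hu hv
  have h2 := cheegerDeformation_apply hg hQ (hor hu) (hor hv)
  rw [inv, chain, chain] at h2
  simp only [one_smul, mul_one] at h1 h2
  rw [h1, h2]

end Cheeger
end CheegerBundle
end

noncomputable section
namespace CheegerBundle
namespace GBundle.PrincipalBundle

/-! ### The metric `h_t` as the image of `g × t⁻¹Q × g_F` on `P × G × F` -/

section
set_option maxSynthPendingDepth 3
set_option linter.unusedSectionVars false

variable {EB B EF F EM M EG G EP P : Type*}
  [NormedAddCommGroup EB] [NormedSpace ℝ EB] [TopologicalSpace B] [ChartedSpace EB B]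
  [NormedAddCommGroup EF] [NormedSpace ℝ EF] [TopologicalSpace F] [ChartedSpace EF F]
  [NormedAddCommGroup EM] [NormedSpace ℝ EM] [TopologicalSpace M] [ChartedSpace EM M]
  [NormedAddCommGroup EG] [NormedSpace ℝ EG] [TopologicalSpace G] [ChartedSpace EG G]
  [NormedAddCommGroup EP] [NormedSpace ℝ EP] [TopologicalSpace P] [ChartedSpace EP P]
  [Group G] [MulAction G F] [MulAction G P]
  {ι : Type*} {ξ : GBundle ι EB B EF F EM M G} (pb : ξ.PrincipalBundle EG EP P)
  [LieGroup 𝓘(ℝ, EG) ∞ G] [ContMDiffSMul 𝓘(ℝ, EG) 𝓘(ℝ, EF) ∞ G F]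
  [IsManifold 𝓘(ℝ, EF) ∞ F] [IsManifold 𝓘(ℝ, EP) ∞ P]
  [FiniteDimensional ℝ EP] [FiniteDimensional ℝ EG]
  {g : Metric EP P} {gF : Metric EF F} {Q : Metric EG G} {t : ℝ}

/-- The metric `g_t × g_F` on `P × F`. -/
def bundleTotal (g : Metric EP P) (gF : Metric EF F) (Q : Metric EG G) (t : ℝ) :
    MetricField (𝓘(ℝ, EP).prod 𝓘(ℝ, EF)) (P × F) :=
  prodMetric (cheegerDeformation g Q t) gF.field

theorem plain_bundleTotal (z : P × F) (u v : EP × EF) :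
    plain (bundleTotal g gF Q t) z u v
      = plain (cheegerDeformation g Q t) z.1 u.1 v.1 + mform gF z.2 u.2 v.2 := rfl

theorem deformedMetric_apply (hg : IsInvariant G g) (hgF : IsInvariant G gF)
    (hQ : IsBiinvariant Q) (ht : 0 < t) {z : P × F} {u v : EP × EF}
    (hu : IsHor 𝓘(ℝ, EM) (bundleTotal g gF Q t) pb.quotientMap z u)
    (hv : IsHor 𝓘(ℝ, EM) (bundleTotal g gF Q t) pb.quotientMap z v) :
    plain (pb.deformedMetric g gF Q t) (pb.quotientMap z) (pb.dquot z u) (pb.dquot z v)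
      = plain (bundleTotal g gF Q t) z u v := by
  have := pb.contMDiffSMul
  refine submersionMetric_apply (k := bundleTotal g gF Q t) ?_ ?_ ?_
    pb.mdifferentiableAt_quotientMap hu hv
  · intro z u v w
    simp only [plain_bundleTotal, Prod.fst_add, Prod.snd_add, map_add, add_apply,
      cheegerDeformation_add hg hQ ht]
    ring
  · intro z u v
    rw [plain_bundleTotal, plain_bundleTotal, cheegerDeformation_symm hg hQ ht, mform_symm gF]
  · intro x' hx'
    obtain ⟨r, rfl⟩ := pb.exists_smul_eq hx'
    have h1 := mdifferentiableAt_const_smul (EN := EP) EG r z.1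
    have h2 := mdifferentiableAt_const_smul (EN := EF) EG r z.2
    have hds := tder_prodMap (x := z) h1 h2
    refine ⟨fun w ↦ (r • w.1, r • w.2), rfl, ?_, ?_, ?_, ?_⟩
    · funext w
      exact pb.quotientMap_smul r w.1 w.2
    · exact (h1.comp z mdifferentiableAt_fst).prodMk (h2.comp z mdifferentiableAt_snd)
    · rintro ⟨a, b⟩
      refine ⟨(dsm EP r⁻¹ (r • z.1) a, dsm EF r⁻¹ (r • z.2) b), ?_⟩
      rw [hds]
      exact Prod.ext (dsm_inv' EG r z.1 a) (dsm_inv' EG r z.2 b)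
    · intro u v
      rw [hds, hds, plain_bundleTotal, plain_bundleTotal]
      congr 1
      · exact cheegerDeformation_dsm hg hQ ht r z.1 u.1 v.1
      · exact hgF.plain_dsm r z.2 u.2 v.2

/-- The differential of `(p, a, f) ↦ [a • p, f]`. -/
def dtotal (p : P) (a : G) (f : F) (u : EP × EG × EF) : EM :=
  pb.dquot (a • p, f) (dact EP EG (p, a) (u.1, u.2.1), u.2.2)

/-- The metric `g × t⁻¹ Q × g_F` on `P × G × F`. -/
def tripleForm (g : Metric EP P) (gF : Metric EF F) (Q : Metric EG G) (t : ℝ) (p : P) (a : G)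
    (f : F) (u v : EP × EG × EF) : ℝ :=
  mform g p u.1 v.1 + (t⁻¹ * mform Q a u.2.1 v.2.1 + mform gF f u.2.2 v.2.2)

/-- Riemannian submersions compose: a vector orthogonal to the kernel of the composite is horizontal
for `(p, a) ↦ a • p`, and its image is horizontal for the quotient map, so the two evaluation
formulas can be chained. -/
theorem deformedMetric_dtotal (hg : IsInvariant G g) (hgF : IsInvariant G gF)
    (hQ : IsBiinvariant Q) (ht : 0 < t) {p : P} {a : G} {f : F} {u v : EP × EG × EF}
    (hu : ∀ w, pb.dtotal p a f w = 0 → tripleForm g gF Q t p a f u w = 0)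
    (hv : ∀ w, pb.dtotal p a f w = 0 → tripleForm g gF Q t p a f v w = 0) :
    plain (pb.deformedMetric g gF Q t) (pb.quotientMap (a • p, f)) (pb.dtotal p a f u)
      (pb.dtotal p a f v) = tripleForm g gF Q t p a f u v := by
  have := pb.contMDiffSMul
  have hor₁ : ∀ {u : EP × EG × EF},
      (∀ w, pb.dtotal p a f w = 0 → tripleForm g gF Q t p a f u w = 0) →
      IsHor 𝓘(ℝ, EP) (cheegerTotal g Q t) (fun z : P × G ↦ z.2 • z.1) (p, a) (u.1, u.2.1) := by
    intro u hu w hw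
    have h1 := hu (w.1, w.2, 0) (by
      change pb.dquot (a • p, f) (dact EP EG (p, a) w, 0) = 0
      have : dact EP EG (p, a) w = 0 := hw
      rw [this]
      exact map_zero _)
    simpa [tripleForm, plain_cheegerTotal] using h1
  have hor₂ : ∀ {u : EP × EG × EF},
      (∀ w, pb.dtotal p a f w = 0 → tripleForm g gF Q t p a f u w = 0) →
      IsHor 𝓘(ℝ, EM) (bundleTotal g gF Q t) pb.quotientMap (a • p, f)
        (dact EP EG (p, a) (u.1, u.2.1), u.2.2) := by
    rintro u hu ⟨X, w⟩ hw
    obtain ⟨x, rfl, hx⟩ := exists_cheeger_lift g Q ht (p, a) X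
    have h1 := cheegerDeformation_apply hg hQ (hor₁ hu) hx
    rw [plain_bundleTotal]
    dsimp only at h1 ⊢
    rw [h1, plain_cheegerTotal]
    have h2 := hu (x.1, x.2, w) hw
    simp only [tripleForm] at h2
    dsimp only
    linarith
  have h1 := pb.deformedMetric_apply hg hgF hQ ht (hor₂ hu) (hor₂ hv)
  rw [plain_bundleTotal] at h1
  have h2 := cheegerDeformation_apply hg hQ (hor₁ hu) (hor₁ hv)
  rw [plain_cheegerTotal] at h2
  dsimp only at h1 h2
  rw [h2] at h1
  refine h1.trans ?_
  rw [tripleForm]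
  ring

end
end GBundle.PrincipalBundle
end CheegerBundle
end

noncomputable section
namespace CheegerBundle
namespace GBundle.PrincipalBundle

/-! ### The map `(p', a, f') ↦ [a • p', f']` in charts -/

section
set_option maxSynthPendingDepth 3
set_option linter.unusedSectionVars false

variable {EB B EF F EM M EG G EP P : Type*}
  [NormedAddCommGroup EB] [NormedSpace ℝ EB] [TopologicalSpace B] [ChartedSpace EB B]
  [NormedAddCommGroup EF] [NormedSpace ℝ EF] [TopologicalSpace F] [ChartedSpace EF F]
  [NormedAddCommGroup EM] [NormedSpace ℝ EM] [TopologicalSpace M] [ChartedSpace EM M]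
  [NormedAddCommGroup EG] [NormedSpace ℝ EG] [TopologicalSpace G] [ChartedSpace EG G]
  [NormedAddCommGroup EP] [NormedSpace ℝ EP] [TopologicalSpace P] [ChartedSpace EP P]
  [Group G] [MulAction G F] [MulAction G P]
  {ι : Type*} {ξ : GBundle ι EB B EF F EM M G} (pb : ξ.PrincipalBundle EG EP P)

/-- The domain of the product chart of `P × G × F` around `(p, 1, f)`. -/
def chartBox (EP EG EF G : Type*) {P F : Type*} [NormedAddCommGroup EF] [NormedSpace ℝ EF]
    [TopologicalSpace F] [ChartedSpace EF F]
    [NormedAddCommGroup EG] [NormedSpace ℝ EG] [TopologicalSpace G] [ChartedSpace EG G] [Group G]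
    [NormedAddCommGroup EP] [NormedSpace ℝ EP] [TopologicalSpace P] [ChartedSpace EP P]
    (p : P) (f : F) : Set (EP × EG × EF) :=
  (extChartAt 𝓘(ℝ, EP) p).target ×ˢ (extChartAt 𝓘(ℝ, EG) (1 : G)).target ×ˢ
    (extChartAt 𝓘(ℝ, EF) f).target

/-- The map `(p', a, f') ↦ [a • p', f']` read in the product chart around `(p, 1, f)`. -/
def totalMap (p : P) (f : F) (y : EP × EG × EF) : M :=
  pb.quotientMap ((extChartAt 𝓘(ℝ, EG) (1 : G)).symm y.2.1 • (extChartAt 𝓘(ℝ, EP) p).symm y.1,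
    (extChartAt 𝓘(ℝ, EF) f).symm y.2.2)

/-- The coordinate expression of `(p', a, f') ↦ [a • p', f']`. -/
def chartTotal (p : P) (f : F) (y : EP × EG × EF) : EM :=
  extChartAt 𝓘(ℝ, EM) (pb.quotientMap (p, f)) (pb.totalMap p f y)

/-- The domain of `chartTotal`. -/
def totalDomain (p : P) (f : F) : Set (EP × EG × EF) :=
  chartBox EP EG EF G p f ∩
    pb.totalMap p f ⁻¹' (extChartAt 𝓘(ℝ, EM) (pb.quotientMap (p, f))).source

/-- The centre of the product chart around `(p, 1, f)`. -/
def boxCentre (EP EG EF G : Type*) {P F : Type*} [NormedAddCommGroup EF] [NormedSpace ℝ EF]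
    [TopologicalSpace F] [ChartedSpace EF F]
    [NormedAddCommGroup EG] [NormedSpace ℝ EG] [TopologicalSpace G] [ChartedSpace EG G] [Group G]
    [NormedAddCommGroup EP] [NormedSpace ℝ EP] [TopologicalSpace P] [ChartedSpace EP P]
    (p : P) (f : F) : EP × EG × EF :=
  (extChartAt 𝓘(ℝ, EP) p p, extChartAt 𝓘(ℝ, EG) (1 : G) 1, extChartAt 𝓘(ℝ, EF) f f)

theorem totalMap_centre (p : P) (f : F) :
    pb.totalMap p f (boxCentre EP EG EF G p f) = pb.quotientMap (p, f) := by
  simp [totalMap, boxCentre]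

theorem centre_mem (p : P) (f : F) : boxCentre EP EG EF G p f ∈ pb.totalDomain p f := by
  refine ⟨⟨mem_extChartAt_target _, mem_extChartAt_target _, mem_extChartAt_target _⟩, ?_⟩
  rw [mem_preimage, pb.totalMap_centre]
  exact mem_extChartAt_source _

variable [LieGroup 𝓘(ℝ, EG) ∞ G] [ContMDiffSMul 𝓘(ℝ, EG) 𝓘(ℝ, EF) ∞ G F]
  [IsManifold 𝓘(ℝ, EF) ∞ F] [IsManifold 𝓘(ℝ, EP) ∞ P] [IsManifold 𝓘(ℝ, EM) ∞ M]

theorem contMDiffOn_totalMap (p : P) (f : F) :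
    ContMDiffOn 𝓘(ℝ, EP × EG × EF) 𝓘(ℝ, EM) ∞ (pb.totalMap p f) (chartBox EP EG EF G p f) := by
  have := pb.contMDiffSMul
  have hP : ContMDiffOn 𝓘(ℝ, EP × EG × EF) 𝓘(ℝ, EP) ∞
      (fun y : EP × EG × EF ↦ (extChartAt 𝓘(ℝ, EP) p).symm y.1) (chartBox EP EG EF G p f) :=
    (contMDiffOn_extChartAt_symm p).comp contDiff_fst.contMDiff.contMDiffOn fun z hz ↦ hz.1
  have hG : ContMDiffOn 𝓘(ℝ, EP × EG × EF) 𝓘(ℝ, EG) ∞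
      (fun y : EP × EG × EF ↦ (extChartAt 𝓘(ℝ, EG) (1 : G)).symm y.2.1)
      (chartBox EP EG EF G p f) :=
    (contMDiffOn_extChartAt_symm (1 : G)).comp
      (contDiff_fst.comp contDiff_snd).contMDiff.contMDiffOn fun z hz ↦ hz.2.1
  have hF : ContMDiffOn 𝓘(ℝ, EP × EG × EF) 𝓘(ℝ, EF) ∞
      (fun y : EP × EG × EF ↦ (extChartAt 𝓘(ℝ, EF) f).symm y.2.2) (chartBox EP EG EF G p f) :=
    (contMDiffOn_extChartAt_symm f).comp
      (contDiff_snd.comp contDiff_snd).contMDiff.contMDiffOn fun z hz ↦ hz.2.2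
  exact pb.contMDiff_quotientMap.comp_contMDiffOn ((hG.smul hP).prodMk hF)

theorem isOpen_totalDomain (p : P) (f : F) : IsOpen (pb.totalDomain p f) :=
  (pb.contMDiffOn_totalMap p f).continuousOn.isOpen_inter_preimage
    ((isOpen_extChartAt_target _).prod
      ((isOpen_extChartAt_target _).prod (isOpen_extChartAt_target _)))
    (isOpen_extChartAt_source _)

theorem contDiffOn_chartTotal (p : P) (f : F) :
    ContDiffOn ℝ ∞ (pb.chartTotal p f) (pb.totalDomain p f) := by
  refine ContMDiffOn.contDiffOn ?_
  intro z hz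
  exact (contMDiffAt_chart hz.2).comp_contMDiffWithinAt z
    ((pb.contMDiffOn_totalMap p f).mono inter_subset_left z hz)

/-- The derivative of the inverse of the product chart. -/
def dbox (EP EG EF G : Type*) {P F : Type*} [NormedAddCommGroup EF] [NormedSpace ℝ EF]
    [TopologicalSpace F] [ChartedSpace EF F]
    [NormedAddCommGroup EG] [NormedSpace ℝ EG] [TopologicalSpace G] [ChartedSpace EG G] [Group G]
    [NormedAddCommGroup EP] [NormedSpace ℝ EP] [TopologicalSpace P] [ChartedSpace EP P]
    (p : P) (f : F) (y w : EP × EG × EF) : EP × EG × EF :=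
  (dchartSymm p y.1 w.1, dchartSymm (1 : G) y.2.1 w.2.1, dchartSymm f y.2.2 w.2.2)

theorem dbox_surjective {p : P} {f : F} {y : EP × EG × EF} (hy : y ∈ chartBox EP EG EF G p f) :
    Function.Surjective (dbox EP EG EF G p f y) := fun w ↦
  ⟨(dchart EP p _ w.1, dchart EG (1 : G) _ w.2.1, dchart EF f _ w.2.2),
    Prod.ext (dchartSymm_dchart' hy.1 _) (Prod.ext (dchartSymm_dchart' hy.2.1 _)
      (dchartSymm_dchart' hy.2.2 _))⟩

theorem fderiv_chartTotal {p : P} {f : F} {y : EP × EG × EF} (hy : y ∈ pb.totalDomain p f)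
    (w : EP × EG × EF) :
    fderiv ℝ (pb.chartTotal p f) y w = dchart EM (pb.quotientMap (p, f)) (pb.totalMap p f y)
      (pb.dtotal ((extChartAt 𝓘(ℝ, EP) p).symm y.1) ((extChartAt 𝓘(ℝ, EG) (1 : G)).symm y.2.1)
        ((extChartAt 𝓘(ℝ, EF) f).symm y.2.2) (dbox EP EG EF G p f y w)) := by
  have := pb.contMDiffSMul
  have d1 : MDifferentiableAt 𝓘(ℝ, EP × EG × EF) 𝓘(ℝ, EP) (fun y : EP × EG × EF ↦ y.1) y :=
    contDiff_fst.contMDiff.mdifferentiableAt infty_ne_zero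
  have d2 : MDifferentiableAt 𝓘(ℝ, EP × EG × EF) 𝓘(ℝ, EG) (fun y : EP × EG × EF ↦ y.2.1) y :=
    (contDiff_fst.comp contDiff_snd).contMDiff.mdifferentiableAt infty_ne_zero
  have d3 : MDifferentiableAt 𝓘(ℝ, EP × EG × EF) 𝓘(ℝ, EF) (fun y : EP × EG × EF ↦ y.2.2) y :=
    (contDiff_snd.comp contDiff_snd).contMDiff.mdifferentiableAt infty_ne_zero
  have t1 : tder 𝓘(ℝ, EP × EG × EF) 𝓘(ℝ, EP) (fun y : EP × EG × EF ↦ y.1) y w = w.1 := by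
    rw [tder_eq_fderiv]
    exact congrArg (fun T : EP × EG × EF →L[ℝ] EP ↦ T w) hasFDerivAt_fst.fderiv
  have t2 : tder 𝓘(ℝ, EP × EG × EF) 𝓘(ℝ, EG) (fun y : EP × EG × EF ↦ y.2.1) y w = w.2.1 := by
    rw [tder_eq_fderiv]
    exact congrArg (fun T : EP × EG × EF →L[ℝ] EG ↦ T w) (hasFDerivAt_snd.fst).fderiv
  have t3 : tder 𝓘(ℝ, EP × EG × EF) 𝓘(ℝ, EF) (fun y : EP × EG × EF ↦ y.2.2) y w = w.2.2 := by
    rw [tder_eq_fderiv]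
    exact congrArg (fun T : EP × EG × EF →L[ℝ] EF ↦ T w) (hasFDerivAt_snd.snd).fderiv
  have c1 := mdifferentiableAt_chart_symm (x := p) hy.1.1
  have c2 := mdifferentiableAt_chart_symm (x := (1 : G)) hy.1.2.1
  have c3 := mdifferentiableAt_chart_symm (x := f) hy.1.2.2
  have e1 := tder_comp (f := fun y : EP × EG × EF ↦ y.1) c1 d1 w
  have e2 := tder_comp (f := fun y : EP × EG × EF ↦ y.2.1) c2 d2 w
  have e3 := tder_comp (f := fun y : EP × EG × EF ↦ y.2.2) c3 d3 w
  rw [t1] at e1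
  rw [t2] at e2
  rw [t3] at e3
  have m1 := c1.comp y d1
  have m2 := c2.comp y d2
  have m3 := c3.comp y d3
  let a : EP × EG × EF → P × G := fun y ↦
    ((extChartAt 𝓘(ℝ, EP) p).symm y.1, (extChartAt 𝓘(ℝ, EG) (1 : G)).symm y.2.1)
  have ma : MDifferentiableAt 𝓘(ℝ, EP × EG × EF) (𝓘(ℝ, EP).prod 𝓘(ℝ, EG)) a y := m1.prodMk m2
  have ta : tder 𝓘(ℝ, EP × EG × EF) (𝓘(ℝ, EP).prod 𝓘(ℝ, EG)) a y w
      = (dchartSymm p y.1 w.1, dchartSymm (1 : G) y.2.1 w.2.1) :=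
    (tder_prodMk m1 m2 w).trans (Prod.ext e1 e2)
  have mb := (mdifferentiableAt_act (EN := EP) (EG := EG) (a y)).comp y ma
  have tb := tder_comp (f := a) (mdifferentiableAt_act (EN := EP) (EG := EG) (a y)) ma w
  rw [ta] at tb
  let b : EP × EG × EF → P × F := fun y ↦
    ((a y).2 • (a y).1, (extChartAt 𝓘(ℝ, EF) f).symm y.2.2)
  have mb' : MDifferentiableAt 𝓘(ℝ, EP × EG × EF) (𝓘(ℝ, EP).prod 𝓘(ℝ, EF)) b y := mb.prodMk m3
  have tb' : tder 𝓘(ℝ, EP × EG × EF) (𝓘(ℝ, EP).prod 𝓘(ℝ, EF)) b y w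
      = (dact EP EG (a y) (dchartSymm p y.1 w.1, dchartSymm (1 : G) y.2.1 w.2.1),
        dchartSymm f y.2.2 w.2.2) :=
    (tder_prodMk mb m3 w).trans (Prod.ext tb e3)
  have mq := (pb.mdifferentiableAt_quotientMap (b y)).comp y mb'
  have tq := tder_comp (f := b) (pb.mdifferentiableAt_quotientMap (b y)) mb' w
  rw [tb'] at tq
  have tc := tder_comp (f := pb.quotientMap ∘ b)
    (mdifferentiableAt_chart (x := pb.quotientMap (p, f)) (z := pb.totalMap p f y) hy.2) mq w
  rw [tq, tder_eq_fderiv] at tc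
  exact tc

theorem fderiv_chartTotal_surjective {p : P} {f : F} {y : EP × EG × EF}
    (hy : y ∈ pb.totalDomain p f) : Function.Surjective (fderiv ℝ (pb.chartTotal p f) y) := by
  have := pb.contMDiffSMul
  intro v
  set m := pb.quotientMap (p, f)
  obtain ⟨⟨x, w⟩, h1⟩ := pb.dquot_surjective
    ((extChartAt 𝓘(ℝ, EG) (1 : G)).symm y.2.1 • (extChartAt 𝓘(ℝ, EP) p).symm y.1,
      (extChartAt 𝓘(ℝ, EF) f).symm y.2.2)
    (dchartSymm m (extChartAt 𝓘(ℝ, EM) m (pb.totalMap p f y)) v)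
  obtain ⟨u, rfl⟩ := dact_surjective (EN := EP) (EG := EG)
    ((extChartAt 𝓘(ℝ, EP) p).symm y.1, (extChartAt 𝓘(ℝ, EG) (1 : G)).symm y.2.1) x
  obtain ⟨w', hw'⟩ := dbox_surjective hy.1 (u.1, u.2, w)
  refine ⟨w', ?_⟩
  rw [pb.fderiv_chartTotal hy, hw', dtotal]
  refine (congrArg _ h1).trans ?_
  have h2 := dchart_dchartSymm ((extChartAt 𝓘(ℝ, EM) m).map_source hy.2) v
  rwa [(extChartAt 𝓘(ℝ, EM) m).left_inv hy.2] at h2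

theorem totalForm_eq (g : Metric EP P) (gF : Metric EF F) (Q : Metric EG G) (t : ℝ) (p : P) (f : F)
    (y u v : EP × EG × EF) :
    totalForm (chartForm g p) (chartForm Q (1 : G)) (chartForm gF f) t y u v
      = tripleForm g gF Q t ((extChartAt 𝓘(ℝ, EP) p).symm y.1)
        ((extChartAt 𝓘(ℝ, EG) (1 : G)).symm y.2.1) ((extChartAt 𝓘(ℝ, EF) f).symm y.2.2)
        (dbox EP EG EF G p f y u) (dbox EP EG EF G p f y v) := rfl

variable [FiniteDimensional ℝ EP] [FiniteDimensional ℝ EG] [FiniteDimensional ℝ EF]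
  {g : Metric EP P} {gF : Metric EF F} {Q : Metric EG G} {t : ℝ}

/-- In coordinates, the deformed metric is the metric induced by the coordinate expression of
`(p', a, f') ↦ [a • p', f']`. -/
theorem metricInChart_deformedMetric (hg : IsInvariant G g) (hgF : IsInvariant G gF)
    (hQ : IsBiinvariant Q) (ht : 0 < t) {p : P} {f : F} {y : EP × EG × EF}
    (hy : y ∈ pb.totalDomain p f) (α β : EM →L[ℝ] ℝ) :
    metricInChart (pb.deformedMetric g gF Q t) (pb.quotientMap (p, f)) (pb.chartTotal p f y)
      (fderiv ℝ (pb.chartTotal p f) y (totalCoform (chartCoform g p) (chartCoform Q (1 : G))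
        (chartCoform gF f) t y (α.comp (fderiv ℝ (pb.chartTotal p f) y))))
      (fderiv ℝ (pb.chartTotal p f) y (totalCoform (chartCoform g p) (chartCoform Q (1 : G))
        (chartCoform gF f) t y (β.comp (fderiv ℝ (pb.chartTotal p f) y))))
      = α (fderiv ℝ (pb.chartTotal p f) y (totalCoform (chartCoform g p) (chartCoform Q (1 : G))
        (chartCoform gF f) t y (β.comp (fderiv ℝ (pb.chartTotal p f) y)))) := by
  have H := isMetricPair_total (isMetricPair_chart g p) (isMetricPair_chart Q (1 : G))
    (isMetricPair_chart gF f) ht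
  -- A vector dual to a pulled-back covector is orthogonal to the kernel of the differential, so
  -- `deformedMetric_dtotal` evaluates the metric on its image.
  have hor : ∀ γ : EM →L[ℝ] ℝ, ∀ w, pb.dtotal ((extChartAt 𝓘(ℝ, EP) p).symm y.1)
      ((extChartAt 𝓘(ℝ, EG) (1 : G)).symm y.2.1) ((extChartAt 𝓘(ℝ, EF) f).symm y.2.2) w = 0 →
      tripleForm g gF Q t ((extChartAt 𝓘(ℝ, EP) p).symm y.1)
        ((extChartAt 𝓘(ℝ, EG) (1 : G)).symm y.2.1) ((extChartAt 𝓘(ℝ, EF) f).symm y.2.2)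
        (dbox EP EG EF G p f y (totalCoform (chartCoform g p) (chartCoform Q (1 : G))
          (chartCoform gF f) t y (γ.comp (fderiv ℝ (pb.chartTotal p f) y)))) w = 0 := by
    intro γ w hw
    obtain ⟨w', rfl⟩ := dbox_surjective hy.1 w
    rw [← totalForm_eq, H.inner_inv hy.1, ContinuousLinearMap.comp_apply,
      pb.fderiv_chartTotal hy, hw, map_zero, map_zero]
  have key := pb.deformedMetric_dtotal hg hgF hQ ht (hor α) (hor β)
  rw [← totalForm_eq, H.inner_inv hy.1, ContinuousLinearMap.comp_apply] at key
  rw [← key, pb.fderiv_chartTotal hy, pb.fderiv_chartTotal hy]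
  exact metricInChart_dchart _ hy.2 _ _

end
end GBundle.PrincipalBundle
end CheegerBundle
end

noncomputable section
namespace CheegerBundle

/-! ### Ricci sums, normal spaces and the isotropy complement in charts -/

section ChartBases
set_option maxSynthPendingDepth 3
set_option linter.unusedSectionVars false

theorem IsOrthonormalBasisOf.map {κ V V' : Type*} [AddCommGroup V] [Module ℝ V] [AddCommGroup V']
    [Module ℝ V'] {b : V → V → ℝ} {b' : V' → V' → ℝ} {W : Submodule ℝ V} {e : κ → V}
    (he : IsOrthonormalBasisOf b W e) (T : V →ₗ[ℝ] V') (hT : ∀ u v, b' (T u) (T v) = b u v) :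
    IsOrthonormalBasisOf b' (W.map T) (fun i ↦ T (e i)) := by
  refine ⟨fun i ↦ by rw [hT, he.1], fun i j hij ↦ by rw [hT, he.2.1 i j hij], ?_⟩
  rw [← he.2.2, Submodule.map_span, ← range_comp]
  rfl

variable {E M : Type*} [NormedAddCommGroup E] [NormedSpace ℝ E]
    [TopologicalSpace M] [ChartedSpace E M]

/-- The value of `ricciAlong` is a choice that has meaning only if some orthonormal basis exists.
For `h_t` this existence comes from the diagonal frame, which is why it is kept as a hypothesis. -/
theorem exists_ricciAlong_eq (k : MetricField 𝓘(ℝ, E) M) (x : M)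
    (W : Submodule ℝ (TangentSpace 𝓘(ℝ, E) x)) (u : TangentSpace 𝓘(ℝ, E) x)
    (hex : ∃ (n : ℕ) (e : Fin n → TangentSpace 𝓘(ℝ, E) x), IsOrthonormalBasisOf (k x) W e) :
    ∃ (n : ℕ) (e : Fin n → TangentSpace 𝓘(ℝ, E) x), IsOrthonormalBasisOf (k x) W e ∧
      ricciAlong k x W u = ∑ i, sectional k x u (e i) := by
  obtain ⟨n, e, he⟩ := hex
  exact Classical.epsilon_spec (p := fun r ↦ ∃ (n : ℕ) (e : Fin n → TangentSpace 𝓘(ℝ, E) x),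
    IsOrthonormalBasisOf (k x) W e ∧ r = ∑ i, sectional k x u (e i)) ⟨_, n, e, he, rfl⟩

variable [IsManifold 𝓘(ℝ, E) ∞ M]

theorem dchart_self_symm (x : M) (u : E) :
    dchart E x x (dchartSymm x (extChartAt 𝓘(ℝ, E) x x) u) = u := by
  have h := dchart_dchartSymm (mem_extChartAt_target (I := 𝓘(ℝ, E)) x) u
  rwa [extChartAt_to_inv] at h

theorem dchartSymm_self (x : M) (u : E) :
    dchartSymm x (extChartAt 𝓘(ℝ, E) x x) (dchart E x x u) = u :=
  dchartSymm_dchart (mem_extChartAt_source x) u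

/-- Ricci sums in the chart: an orthonormal basis of a space of tangent vectors that computes
`ricciAlong`, in coordinates. -/
theorem exists_ricciAlong_eq_sec (k : MetricField 𝓘(ℝ, E) M) (x : M) (W : Submodule ℝ E) (u : E)
    (hex : ∃ (n : ℕ) (e : Fin n → E), IsOrthonormalBasisOf (plain k x) W e) :
    ∃ (n : ℕ) (e : Fin n → E),
      IsOrthonormalBasisOf (metricInChart k x (extChartAt 𝓘(ℝ, E) x x))
        (W.map (dchart E x x).toLinearMap) e ∧
      ricciAlong k x W u = ∑ i, sec (metricInChart k x) (extChartAt 𝓘(ℝ, E) x x)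
        (dchart E x x u) (e i) := by
  obtain ⟨n, e, he, hr⟩ := exists_ricciAlong_eq k x W u hex
  have he' : IsOrthonormalBasisOf (V := E) (plain k x) W e := he
  exact ⟨n, _, he'.map (dchart E x x).toLinearMap
    (fun u v ↦ metricInChart_dchart k (mem_extChartAt_source x) u v), hr⟩

theorem exists_ricci_eq_sec (k : MetricField 𝓘(ℝ, E) M) (x : M) (u : E)
    (hex : ∃ (n : ℕ) (e : Fin n → E),
      IsOrthonormalBasisOf (metricInChart k x (extChartAt 𝓘(ℝ, E) x x)) ⊤ e) :
    ∃ (n : ℕ) (e : Fin n → E),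
      IsOrthonormalBasisOf (metricInChart k x (extChartAt 𝓘(ℝ, E) x x)) ⊤ e ∧
      ricci k x u = ∑ i, sec (metricInChart k x) (extChartAt 𝓘(ℝ, E) x x)
        (dchart E x x u) (e i) := by
  obtain ⟨n, e, he⟩ := hex
  have h1 := he.map (b' := plain k x) (dchartSymm x (extChartAt 𝓘(ℝ, E) x x)).toLinearMap
    (fun u v ↦ by
      rw [metricInChart_eq, extChartAt_to_inv]
      rfl)
  have h2 : (⊤ : Submodule ℝ E).map (dchartSymm x (extChartAt 𝓘(ℝ, E) x x)).toLinearMap = ⊤ := by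
    rw [Submodule.map_top, LinearMap.range_eq_top]
    exact fun u ↦ ⟨_, dchartSymm_self x u⟩
  rw [h2] at h1
  obtain ⟨n', e', he', hr⟩ := exists_ricciAlong_eq_sec k x ⊤ u ⟨n, _, h1⟩
  have h3 : (⊤ : Submodule ℝ E).map (dchart E x x).toLinearMap = ⊤ := by
    rw [Submodule.map_top, LinearMap.range_eq_top]
    exact fun u ↦ ⟨_, dchart_self_symm x u⟩
  rw [h3] at he'
  exact ⟨n', e', he', hr⟩

theorem chartForm_self (g : Metric E M) (x : M) (u v : E) :
    chartForm g x (extChartAt 𝓘(ℝ, E) x x) (dchart E x x u) (dchart E x x v) = mform g x u v :=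
  chartForm_dchart g (mem_extChartAt_source x) u v

variable {EG G : Type*} [NormedAddCommGroup EG] [NormedSpace ℝ EG] [Group G]
  [TopologicalSpace G] [ChartedSpace EG G] [MulAction G M]

/-- The action vectors in charts. -/
def coordAct (EG G E : Type*) {M : Type*} [NormedAddCommGroup E] [NormedSpace ℝ E]
    [TopologicalSpace M] [ChartedSpace E M] [NormedAddCommGroup EG] [NormedSpace ℝ EG] [Group G]
    [TopologicalSpace G] [ChartedSpace EG G] [MulAction G M] (x : M) : EG →L[ℝ] E :=
  (dchart E x x).comp ((aVec EG E (G := G) x).comp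
    (dchartSymm (1 : G) (extChartAt 𝓘(ℝ, EG) (1 : G) 1)))

theorem coordAct_apply (x : M) (u : EG) : coordAct EG G E x u = dchart E x x
    (aVec EG E (G := G) x (dchartSymm (1 : G) (extChartAt 𝓘(ℝ, EG) (1 : G) 1) u)) := rfl

/-- The space of coordinate vectors that are normal to the orbit. -/
def coordNormal (EG G : Type*) [NormedAddCommGroup EG] [NormedSpace ℝ EG] [Group G]
    [TopologicalSpace G] [ChartedSpace EG G] [MulAction G M] (g : Metric E M) (x : M) :
    Submodule ℝ E :=
  Submodule.map (M := E) (dchart E x x).toLinearMap (orbitNormal EG G g x)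

theorem exists_horizontalRicci_eq [FiniteDimensional ℝ E] (g : Metric E M) (x : M) (u : E) :
    ∃ (n : ℕ) (e : Fin n → E),
      IsOrthonormalBasisOf (fun u v ↦ chartForm g x (extChartAt 𝓘(ℝ, E) x x) u v)
        (coordNormal EG G g x) e ∧
      horizontalRicci EG G g x u = ∑ i, sec (metricInChart g.field x) (extChartAt 𝓘(ℝ, E) x x)
        (dchart E x x u) (e i) := by
  let β : E →ₗ[ℝ] E →ₗ[ℝ] ℝ := LinearMap.mk₂ ℝ (fun z z' ↦ mform g x z z')
    (fun a b c ↦ by simp) (fun a b c ↦ by simp) (fun a b c ↦ by simp) (fun a b c ↦ by simp)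
  exact exists_ricciAlong_eq_sec g.field x (orbitNormal EG G g x) u
    (exists_isOrthonormalBasisOf (β := β) (fun _ _ ↦ rfl) (mform_symm g x) (mform_pos g x) _)

theorem dchart_mem_coordNormal {g : Metric E M} {x : M} {u : TangentSpace 𝓘(ℝ, E) x}
    (hu : u ∈ orbitNormal EG G g x) : dchart E x x u ∈ coordNormal EG G g x :=
  ⟨u, hu, rfl⟩

variable [LieGroup 𝓘(ℝ, EG) ∞ G]

theorem coordAct_dchart (x : M) (u : EG) :
    coordAct EG G E x (dchart EG (1 : G) 1 u) = dchart E x x (aVec EG E (G := G) x u) := by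
  rw [coordAct_apply, dchartSymm_self]

theorem mem_coordNormal {g : Metric E M} {x : M} (w : E) :
    w ∈ coordNormal EG G g x ↔
      ∀ u, chartForm g x (extChartAt 𝓘(ℝ, E) x x) w (coordAct EG G E x u) = 0 := by
  have hmem : ∀ w : E, w ∈ (orbitNormal EG G g x : Submodule ℝ E) ↔
    ∀ u : EG, mform g x w (aVec EG E (G := G) x u) = 0 := fun w ↦ Iff.rfl
  constructor
  · rintro ⟨w, hw, rfl⟩ u
    refine (chartForm_self g x w _).trans ((hmem w).1 hw _)
  · intro h
    refine ⟨dchartSymm x (extChartAt 𝓘(ℝ, E) x x) w, (hmem _).2 fun u ↦ ?_, dchart_self_symm x w⟩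
    rw [← chartForm_self g x, dchart_self_symm, ← coordAct_dchart]
    exact h _

/-- The space of coordinate vectors that are normal to the isotropy algebra. -/
def coordComplement (E : Type*) [NormedAddCommGroup E] [NormedSpace ℝ E] [ChartedSpace E M]
    (Q : Metric EG G) (x : M) : Submodule ℝ EG :=
  Submodule.map (M := EG) (dchart EG (1 : G) 1).toLinearMap (isotropyComplement E Q x)

theorem dchart_mem_coordComplement {Q : Metric EG G} {x : M} {u : GroupLieAlgebra 𝓘(ℝ, EG) G}
    (hu : u ∈ isotropyComplement E Q x) : dchart EG (1 : G) 1 u ∈ coordComplement E Q x :=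
  ⟨u, hu, rfl⟩

theorem mem_coordComplement {Q : Metric EG G} {x : M} (w : EG) :
    w ∈ coordComplement E Q x ↔ ∀ u, coordAct EG G E x u = 0 →
      chartForm Q (1 : G) (extChartAt 𝓘(ℝ, EG) (1 : G) 1) w u = 0 := by
  have hmem : ∀ w : EG, w ∈ (isotropyComplement E Q x : Submodule ℝ EG) ↔
    ∀ u : EG, aVec EG E (G := G) x u = 0 → mform Q (1 : G) w u = 0 := fun w ↦ Iff.rfl
  constructor
  · rintro ⟨w, hw, rfl⟩ u hu
    rw [← dchart_self_symm (1 : G) u]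
    refine (chartForm_self Q (1 : G) w _).trans ((hmem w).1 hw _ ?_)
    rw [← dchartSymm_self x (aVec EG E x _), ← coordAct_apply, hu, map_zero]
  · intro h
    refine ⟨dchartSymm (1 : G) (extChartAt 𝓘(ℝ, EG) (1 : G) 1) w, (hmem _).2 fun u hu ↦ ?_,
      dchart_self_symm (1 : G) w⟩
    rw [← chartForm_self Q (1 : G), dchart_self_symm]
    refine h _ ?_
    rw [coordAct_dchart, hu, map_zero]

theorem isOrthonormalBasisOf_dchart_one {κ : Type*} {Q : Metric EG G} {x : M}
    {v : κ → GroupLieAlgebra 𝓘(ℝ, EG) G}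
    (hv : IsOrthonormalBasisOf (Q.field 1) (isotropyComplement E Q x) v) :
    IsOrthonormalBasisOf (fun u v ↦ chartForm Q (1 : G) (extChartAt 𝓘(ℝ, EG) (1 : G) 1) u v)
      (coordComplement E Q x) (fun i ↦ dchart EG (1 : G) 1 (v i)) := by
  have hv' : IsOrthonormalBasisOf (V := EG) (plain Q.field (1 : G)) (isotropyComplement E Q x) v :=
    hv
  exact hv'.map (dchart EG (1 : G) 1).toLinearMap (chartForm_self Q (1 : G))

/-- The curvature of a biinvariant metric in the chart at `1`. -/
theorem IsBiinvariant.sec_chart [FiniteDimensional ℝ EG] {Q : Metric EG G} (hQ : IsBiinvariant Q)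
    (u v : GroupLieAlgebra 𝓘(ℝ, EG) G) :
    sec (metricInChart Q.field (1 : G)) (extChartAt 𝓘(ℝ, EG) (1 : G) 1) (dchart EG (1 : G) 1 u)
      (dchart EG (1 : G) 1 v) = 1 / 4 * Q.field 1 ⁅v, u⁆ ⁅v, u⁆ := by
  have : CompleteSpace EG := FiniteDimensional.complete ℝ _
  have : LieGroup 𝓘(ℝ, EG) (minSmoothness ℝ 3) G := by
    rw [minSmoothness_of_isRCLikeNormedField]
    infer_instance
  refine (hQ.sectional_one u v).trans ?_
  -- The final sum has the basis vector first in the bracket; its norm does not see the order.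
  have h : ⁅u, v⁆ = -⁅v, u⁆ := (lie_skew u v).symm
  rw [h]
  have h2 : ∀ w : EG, mform Q (1 : G) (-w) (-w) = mform Q (1 : G) w w := fun w ↦ by simp
  exact congrArg (1 / 4 * ·) (h2 (plainBracket G v u))

end ChartBases

namespace GBundle.PrincipalBundle

/-! ### Assembly: the orbit data at `(p, 1, f)` and the theorem on `M` -/

section
set_option maxSynthPendingDepth 3
set_option linter.unusedSectionVars false

variable {EB B EF F EM M EG G EP P : Type*}
  [NormedAddCommGroup EB] [NormedSpace ℝ EB] [TopologicalSpace B] [ChartedSpace EB B]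
  [NormedAddCommGroup EF] [NormedSpace ℝ EF] [TopologicalSpace F] [ChartedSpace EF F]
  [NormedAddCommGroup EM] [NormedSpace ℝ EM] [TopologicalSpace M] [ChartedSpace EM M]
  [NormedAddCommGroup EG] [NormedSpace ℝ EG] [TopologicalSpace G] [ChartedSpace EG G]
  [NormedAddCommGroup EP] [NormedSpace ℝ EP] [TopologicalSpace P] [ChartedSpace EP P]
  [Group G] [MulAction G F] [MulAction G P]
  {ι : Type*} {ξ : GBundle ι EB B EF F EM M G} (pb : ξ.PrincipalBundle EG EP P)
  [LieGroup 𝓘(ℝ, EG) ∞ G] [ContMDiffSMul 𝓘(ℝ, EG) 𝓘(ℝ, EF) ∞ G F]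
  [IsManifold 𝓘(ℝ, EF) ∞ F] [IsManifold 𝓘(ℝ, EP) ∞ P] [IsManifold 𝓘(ℝ, EM) ∞ M]

theorem chartTotal_centre (p : P) (f : F) : pb.chartTotal p f (boxCentre EP EG EF G p f)
    = extChartAt 𝓘(ℝ, EM) (pb.quotientMap (p, f)) (pb.quotientMap (p, f)) := by
  rw [chartTotal, totalMap_centre]

/-- The derivative of `(p', a, f') ↦ [a • p', f']` at `(p, 1, f)` in coordinates. -/
theorem fderiv_chartTotal_centre (p : P) (f : F) (x : EP) (u : EG) (w : EF) :
    fderiv ℝ (pb.chartTotal p f) (boxCentre EP EG EF G p f)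
        (dchart EP p p x, dchart EG (1 : G) 1 u, dchart EF f f w)
      = dchart EM (pb.quotientMap (p, f)) (pb.quotientMap (p, f))
        (pb.dquot (p, f) (x + aVec EG EP (G := G) p u, w)) := by
  have := pb.contMDiffSMul
  rw [pb.fderiv_chartTotal (pb.centre_mem p f), pb.totalMap_centre]
  simp only [dbox, boxCentre, extChartAt_to_inv, dchartSymm_self, dtotal, one_smul, dact_one]

theorem isOrbitData (p : P) (f : F) :
    IsOrbitData (fderiv ℝ (pb.chartTotal p f) (boxCentre EP EG EF G p f)) (coordAct EG G EP p)
      (coordAct EG G EF f) := by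
  set m := pb.quotientMap (p, f) with hm
  have inj : ∀ v : EM, dchart EM m m v = 0 → v = 0 := fun v hv ↦ by
    rw [← dchartSymm_self m v, hv, map_zero]
  have surjP : ∀ x : EP, ∃ x', dchart EP p p x' = x := fun x ↦ ⟨_, dchart_self_symm p x⟩
  have surjF : ∀ x : EF, ∃ x', dchart EF f f x' = x := fun x ↦ ⟨_, dchart_self_symm f x⟩
  have surjG : ∀ x : EG, ∃ x', dchart EG (1 : G) 1 x' = x := fun x ↦
    ⟨_, dchart_self_symm (1 : G) x⟩
  have T := pb.fderiv_chartTotal_centre p f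
  refine ⟨pb.fderiv_chartTotal_surjective (pb.centre_mem p f), ?_, ?_, ?_, ?_⟩
  · intro u
    obtain ⟨u, rfl⟩ := surjG u
    have h1 := T 0 u 0
    have h2 := T (aVec EG EP (G := G) p u) 0 0
    simp only [map_zero, zero_add, add_zero] at h1 h2
    rw [coordAct_dchart, h1, h2]
  · intro u
    obtain ⟨u, rfl⟩ := surjG u
    have h2 := T (aVec EG EP (G := G) p u) 0 (aVec EG EF (G := G) f u)
    simp only [map_zero, add_zero, dquot_aVec] at h2
    rw [coordAct_dchart, coordAct_dchart, h2]
  · intro x w h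
    obtain ⟨x, rfl⟩ := surjP x
    obtain ⟨w, rfl⟩ := surjF w
    have h2 := T x 0 w
    simp only [map_zero, add_zero] at h2
    obtain ⟨u, hx, hw⟩ := pb.dquot_kernel (inj _ (h2.symm.trans h))
    refine ⟨dchart EG (1 : G) 1 u, ?_, ?_⟩
    · rw [coordAct_dchart, hx]
    · rw [coordAct_dchart, hw]
  · intro w h
    obtain ⟨w, rfl⟩ := surjF w
    have h2 := T 0 0 w
    simp only [map_zero, add_zero] at h2
    rw [pb.dquot_injective (inj _ (h2.symm.trans h)), map_zero]

/-- The tangent vector `X + X_F + U*` in coordinates. -/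
theorem fderiv_chartTotal_tangentVec (p : P) (f : F) (X : EP) (XF : EF) (U : EG) :
    fderiv ℝ (pb.chartTotal p f) (boxCentre EP EG EF G p f) (dchart EP p p X, 0,
        dchart EF f f XF + coordAct EG G EF f (dchart EG (1 : G) 1 U))
      = dchart EM (pb.quotientMap (p, f)) (pb.quotientMap (p, f)) (pb.tangentVec p f X XF U) := by
  have h := pb.fderiv_chartTotal_centre p f X 0 (XF + aVec EG EF (G := G) f U)
  simp only [map_zero, add_zero, map_add] at h
  rw [coordAct_dchart, h]
  rfl

variable [FiniteDimensional ℝ EP] [FiniteDimensional ℝ EG] [FiniteDimensional ℝ EF]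
  [FiniteDimensional ℝ EM]

/-- The Ricci curvature of the deformed metrics converges, and the limit is bounded below by the
horizontal Ricci curvatures and the curvature of the group. -/
theorem exists_tendsto_ricci_deformedMetric {g : Metric EP P} {gF : Metric EF F} {Q : Metric EG G}
    (hg : IsInvariant G g) (hgF : IsInvariant G gF) (hQ : IsBiinvariant Q) (p : P) (f : F)
    {X : TangentSpace 𝓘(ℝ, EP) p} (hX : X ∈ orbitNormal EG G g p)
    {XF : TangentSpace 𝓘(ℝ, EF) f} (hXF : XF ∈ orbitNormal EG G gF f)
    {U : GroupLieAlgebra 𝓘(ℝ, EG) G} (hU : U ∈ isotropyComplement EF Q f)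
    {κ : Type*} [Fintype κ] {v : κ → GroupLieAlgebra 𝓘(ℝ, EG) G}
    (hv : IsOrthonormalBasisOf (Q.field 1) (isotropyComplement EF Q f) v) :
    ∃ L : EReal,
      Tendsto (fun t : ℝ ↦ ((ricci (pb.deformedMetric g gF Q t) (pb.quotientMap (p, f))
        (pb.tangentVec p f X XF U) : ℝ) : EReal)) atTop (𝓝 L) ∧
      ((horizontalRicci EG G g p X + horizontalRicci EG G gF f XF
          + ∑ k, (1 / 4) * Q.field 1 ⁅v k, U⁆ ⁅v k, U⁆ : ℝ) : EReal) ≤ L := by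
  obtain ⟨nP, eP, heP, hrP⟩ := exists_horizontalRicci_eq (EG := EG) (G := G) g p X
  obtain ⟨nF, eF, heF, hrF⟩ := exists_horizontalRicci_eq (EG := EG) (G := G) gF f XF
  obtain ⟨L, hL, hle⟩ := exists_tendsto_ricci_coord
    (kP := metricInChart g.field p) (kG := metricInChart Q.field (1 : G))
    (kF := metricInChart gF.field f) (y := boxCentre EP EG EF G p f) (q := pb.chartTotal p f)
    (h := fun t ↦ metricInChart (pb.deformedMetric g gF Q t) (pb.quotientMap (p, f)))
    (ric := fun t ↦ ricci (pb.deformedMetric g gF Q t) (pb.quotientMap (p, f))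
      (pb.tangentVec p f X XF U))
    (isMetricPair_chart g p) (isMetricPair_chart Q (1 : G)) (isMetricPair_chart gF f)
    (fun _ _ _ _ ↦ rfl) (fun _ _ _ _ ↦ rfl) (fun _ _ _ _ ↦ rfl)
    (pb.isOpen_totalDomain p f) inter_subset_left (pb.contDiffOn_chartTotal p f)
    (pb.centre_mem p f) (fun z hz ↦ pb.fderiv_chartTotal_surjective hz)
    (fun t ht z hz α β ↦ pb.metricInChart_deformedMetric hg hgF hQ ht hz α β)
    (pb.isOrbitData p f) mem_coordNormal mem_coordNormal mem_coordComplement heP heF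
    (isOrthonormalBasisOf_dchart_one hv) (dchart_mem_coordNormal hX) (dchart_mem_coordNormal hXF)
    (dchart_mem_coordComplement hU)
    (fun t ht hex ↦ by
      rw [pb.chartTotal_centre] at hex ⊢
      rw [pb.fderiv_chartTotal_tangentVec p f X XF U]
      exact exists_ricci_eq_sec _ _ _ hex)
  refine ⟨L, hL, le_of_eq_of_le ?_ hle⟩
  rw [hrP, hrF]
  congr 2
  exact Finset.sum_congr rfl fun k _ ↦ (hQ.sec_chart U (v k)).symm

end
end GBundle.PrincipalBundle
end CheegerBundle
end
theorem mainTheorem3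
    {ι κ EB B EF F EM M EG G EP P : Type*}
    [NormedAddCommGroup EB] [NormedSpace ℝ EB] [FiniteDimensional ℝ EB]
    [TopologicalSpace B] [T2Space B] [SecondCountableTopology B]
    [ChartedSpace EB B] [IsManifold 𝓘(ℝ, EB) ∞ B]
    [NormedAddCommGroup EF] [NormedSpace ℝ EF] [FiniteDimensional ℝ EF]
    [TopologicalSpace F] [T2Space F] [SecondCountableTopology F]
    [ChartedSpace EF F] [IsManifold 𝓘(ℝ, EF) ∞ F]
    [NormedAddCommGroup EM] [NormedSpace ℝ EM] [FiniteDimensional ℝ EM]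
    [TopologicalSpace M] [T2Space M] [SecondCountableTopology M]
    [ChartedSpace EM M] [IsManifold 𝓘(ℝ, EM) ∞ M]
    [NormedAddCommGroup EG] [NormedSpace ℝ EG] [FiniteDimensional ℝ EG]
    [TopologicalSpace G] [T2Space G] [SecondCountableTopology G] [CompactSpace G]
    [ChartedSpace EG G] [Group G] [LieGroup 𝓘(ℝ, EG) ∞ G]
    [NormedAddCommGroup EP] [NormedSpace ℝ EP] [FiniteDimensional ℝ EP]
    [TopologicalSpace P] [T2Space P] [SecondCountableTopology P]
    [ChartedSpace EP P] [IsManifold 𝓘(ℝ, EP) ∞ P]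
    [MulAction G F] [ContMDiffSMul 𝓘(ℝ, EG) 𝓘(ℝ, EF) ∞ G F] [MulAction G P]
    (ξ : CheegerBundle.GBundle ι EB B EF F EM M G)
    (pb : ξ.PrincipalBundle EG EP P)
    (g : CheegerBundle.Metric EP P) (hg : CheegerBundle.IsInvariant G g)
    (gF : CheegerBundle.Metric EF F) (hgF : CheegerBundle.IsInvariant G gF)
    (Q : CheegerBundle.Metric EG G) (hQ : CheegerBundle.IsBiinvariant Q)
    (p : P) (f : F)
    (X : TangentSpace 𝓘(ℝ, EP) p) (hX : X ∈ CheegerBundle.orbitNormal EG G g p)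
    (XF : TangentSpace 𝓘(ℝ, EF) f) (hXF : XF ∈ CheegerBundle.orbitNormal EG G gF f)
    (U : GroupLieAlgebra 𝓘(ℝ, EG) G) (hU : U ∈ CheegerBundle.isotropyComplement EF Q f)
    [Fintype κ] (v : κ → GroupLieAlgebra 𝓘(ℝ, EG) G)
    (hv : CheegerBundle.IsOrthonormalBasisOf (Q.field 1)
      (CheegerBundle.isotropyComplement EF Q f) v) :
    ∃ L : EReal,
      Tendsto (fun t : ℝ ↦
          ((CheegerBundle.ricci (pb.deformedMetric g gF Q t) (pb.quotientMap (p, f))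
            (pb.tangentVec p f X XF U) : ℝ) : EReal)) atTop (𝓝 L) ∧
      ((CheegerBundle.horizontalRicci EG G g p X + CheegerBundle.horizontalRicci EG G gF f XF
          + ∑ k, (1 / 4) * Q.field 1 ⁅v k, U⁆ ⁅v k, U⁆ : ℝ) : EReal) ≤ L := by
  exact pb.exists_tendsto_ricci_deformedMetric hg hgF hQ p f hX hXF hU hv
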